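/- **Conventions.** $\mathbf F$ is a field of characteristic $0$. All compositions are written from left to right: $fg$ is the composite of $1$-morphisms $f\colon A\to B$, $g\colon B\to D$; $\alpha\cdot\beta$ is the vertical and $\alpha\circ\beta$ the horizontal composite of $2$-morphisms; $f\circ\alpha=1_f\circ\alpha$ and $\alpha\circ f=\alpha\circ 1_f$. $\mathrm{Hom}(A,B)$ is the category of $1$-morphisms $A\to B$ and their $2$-morphisms, $\mathrm{2Hom}(f,g)$ is the set of $2$-morphisms $f\Rightarrow g$, $\mathrm{End}(A)=\mathrm{Hom}(A,A)$ and $\mathrm{2End}(f)=\mathrm{2Hom}(f,f)$. **Semi-strict spherical 2-categories.** A *semi-strict monoidal 2-category* $C$ is a strict 2-category with a semi-strict monoidal structure in the sense of Kapranov and Voevodsky (a Gray monoid), with unit object $I$ and natural invertible *tensorators* $\otimes_{f,g}\colon (f\otimes B)(A'\otimes g)\Rightarrow(A\otimes g)(f\otimes B')$ for $f\colon A\to A'$, $g\colon B\to B'$. It *has duals* if there are given: for each $2$-morphism $\alpha\colon f\Rightarrow g$ a dual $\alpha^*\colon g\Rightarrow f$; for each $1$-morphism $f\colon A\to B$ a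 dual $f^*\colon B\to A$ with $i_f\colon 1_A\Rightarrow ff^*$ and $e_f\colon f^*f\Rightarrow 1_B$; for each object $A$ a dual $A^*$ with $i_A\colon I\to A\otimes A^*$, $e_A\colon A^*\otimes A\to I$ and $T_A\colon(i_A\otimes A)(A\otimes e_A)\Rightarrow 1_A$. Call $\alpha$ *unitary* if $\alpha^{-1}=\alpha^*$. For $\alpha\colon f\Rightarrow g$ put $\alpha^\dagger=(g^*\circ i_f)\cdot(g^*\circ\alpha\circ f^*)\cdot(e_g\circ f^*)$ and ${}^\dagger\alpha=(i_{f^*}\circ g^*)\cdot(f^*\circ\alpha\circ g^*)\cdot(f^*\circ e_{g^*})$. The requirements are: $X^{**}=X$ for objects, $1$- and $2$-morphisms; $(1_X)^*=1_X$ for objects and $1$-morphisms $X$; $(\alpha\cdot\beta)^*=\beta^*\cdot\alpha^*$, $(\alpha\circ\beta)^*=\alpha^*\circ\beta^*$, $(fg)^*=g^*f^*$, $(A\otimes X)^*=A\otimes X^*$ and $(X\otimes A)^*=X^*\otimes A$ for $1$- and $2$-morphisms $X$, $(A\otimes B)^*=B^*\otimes A^*$; all $\otimes_{f,g}$ and $T_A$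 are unitary; $i_{X^*}=e_X^*$ and $e_{X^*}=i_X^*$ for objects and $1$-morphisms $X$; $i_{A\otimes B}=i_A(A\otimes i_B\otimes A^*)$, $e_{A\otimes B}=(B^*\otimes e_A\otimes B)e_B$, $$T_{A\otimes B}=\bigl[(i_A\otimes A\otimes B)\circ(A\otimes\otimes_{i_B,e_A}\otimes B)\circ(A\otimes B\otimes e_B)\bigr]\cdot\bigl[(T_A\otimes B)\circ(A\otimes T_B)\bigr],\qquad T_I=1_{1_I};$$ $i_{A\otimes f}=A\otimes i_f$, $i_{f\otimes A}=i_f\otimes A$, $e_{A\otimes f}=A\otimes e_f$, $e_{f\otimes A}=e_f\otimes A$; $i_{fg}=i_f\cdot(f\circ i_g\circ f^*)$ and $e_{fg}=(g^*\circ e_f\circ g)\cdot e_g$; $(i_f\circ f)\cdot(f\circ e_f)=1_f$ and $(f^*\circ i_f)\cdot(e_f\circ f^*)=1_{f^*}$; $(\alpha^\dagger)^*=(\alpha^*)^\dagger$; and $$\bigl[i_A\circ(A\otimes T_{A^*}^\dagger)\bigr]\cdot\bigl[\otimes_{i_A,i_A}\circ(A\otimes e_A\otimes A^*)\bigr]\cdot\bigl[i_A\circ(T_A\otimes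 A^*)\bigr]=1_{i_A}.$$ For $f\colon A\to B$ let ${}^\#f=(i_{A^*}\otimes B^*)(A^*\otimes f\otimes B^*)(A^*\otimes e_{B^*})$ and $f^\#=(B^*\otimes i_A)(B^*\otimes f\otimes A^*)(e_B\otimes A^*)$, both $B^*\to A^*$, and define ${}^\#\alpha\colon{}^\#f\Rightarrow{}^\#g$ and $\alpha^\#\colon f^\#\Rightarrow g^\#$ by the same formulas. For $f\colon A\to B$, $g\colon B\to D$ there are canonical $2$-isomorphisms ${}^\#(fg)\cong{}^\#g\,{}^\#f$, $$\begin{aligned}&\bigl(1_{(i_{A^*}\otimes D^*)(A^*\otimes f\otimes D^*)}\circ(A^*\otimes T_B^\dagger\otimes D^*)\circ1_{(A^*\otimes g\otimes D^*)(A^*\otimes e_{D^*})}\bigr)\\&\cdot\bigl(1_{(i_{A^*}\otimes D^*)(A^*\otimes f\otimes D^*)(A^*\otimes B\otimes i_{B^*}\otimes D^*)}\circ(A^*\otimes\otimes_{e_{B^*},g}\otimes D^*)\circ1_{A^*\otimes e_{D^*}}\bigr)\\&\cdot\bigl(\otimes_{i_{A^*}(A^*\otimes f),\,Y}\circ1_{(A^*\otimes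 e_{B^*}\otimes D\otimes D^*)(A^*\otimes e_{D^*})}\bigr)\cdot\bigl(1_Y\circ\otimes_{{}^\#f,\,e_{D^*}}\bigr),\qquad Y=(i_{B^*}\otimes D^*)(B^*\otimes g\otimes D^*),\end{aligned}$$ and $(fg)^\#\cong g^\#f^\#$, $$\begin{aligned}&\bigl(1_{(D^*\otimes i_A)(D^*\otimes f\otimes A^*)}\circ(D^*\otimes T_B^{-1}\otimes A^*)\circ1_{(D^*\otimes g\otimes A^*)(e_D\otimes A^*)}\bigr)\\&\cdot\bigl(1_{(D^*\otimes i_A)(D^*\otimes f\otimes A^*)(D^*\otimes i_B\otimes B\otimes A^*)}\circ(D^*\otimes\otimes_{g,e_B}^{-1}\otimes A^*)\circ1_{e_D\otimes A^*}\bigr)\\&\cdot\bigl(\otimes^{-1}_{X,\,i_A(f\otimes A^*)}\circ1_{(D^*\otimes D\otimes e_B\otimes A^*)(e_D\otimes A^*)}\bigr)\cdot\bigl(1_X\circ\otimes^{-1}_{e_D,\,f^\#}\bigr),\qquad X=(D^*\otimes i_B)(D^*\otimes g\otimes B^*).\end{aligned}$$ $C$ is *pivotal* if it is equipped with unitary $\phi_f\colon{}^\#f\Rightarrow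 f^\#$ such that ${}^\#\alpha\cdot\phi_g=\phi_f\cdot\alpha^\#$ for $\alpha\colon f\Rightarrow g$; $\phi_f^\dagger=\phi_{f^*}$; $\phi_{fg}$ corresponds to $\phi_g\circ\phi_f$ under these $2$-isomorphisms; and ${}^\#(\alpha^\dagger)={}^\dagger(\alpha^\#)$, $({}^\#\alpha)^\dagger=({}^\dagger\alpha)^\#$. For $f\in\mathrm{End}(A)$ put $\mathrm{Tr}_L(f)=i_{A^*}(A^*\otimes f)e_A$ and $\mathrm{Tr}_R(f)=i_A(f\otimes A^*)e_{A^*}$, and likewise on $2$-morphisms. For $f\colon A\to B$, $g\colon B\to A$ let $\theta^R_{f,g}\colon\mathrm{Tr}_R(fg)\Rightarrow\mathrm{Tr}_R(gf)$ be $$\begin{aligned}&\bigl(1_{i_A(f\otimes A^*)}\circ(T_B^\dagger\otimes A^*)\circ1_{(g\otimes A^*)e_{A^*}}\bigr)\cdot\bigl(1_{i_A(f\otimes A^*)(B\otimes i_{B^*}\otimes A^*)}\circ\otimes_{e_{B^*},(g\otimes A^*)e_{A^*}}\bigr)\\&\cdot\bigl(1_{i_A(f\otimes A^*)}\circ(B\otimes\phi_g)\circ1_{e_{B^*}}\bigr)\cdot\bigl(\otimes_{i_A(f\otimes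 A^*),\,i_B(g\otimes B^*)}\circ1_{(B\otimes e_A\otimes B^*)e_{B^*}}\bigr)\\&\cdot\bigl(1_{i_B(g\otimes B^*)(i_A\otimes A\otimes B^*)}\circ(\otimes_{f,e_A}\otimes B^*)\circ1_{e_{B^*}}\bigr)\cdot\bigl(1_{i_B(g\otimes B^*)}\circ(T_A\otimes B^*)\circ1_{(f\otimes B^*)e_{B^*}}\bigr),\end{aligned}$$ and, as its mirror image (all tensor products in the reversed order), let $\theta^L_{f,g}\colon\mathrm{Tr}_L(fg)\Rightarrow\mathrm{Tr}_L(gf)$ be $$\begin{aligned}&\bigl(1_{i_{A^*}(A^*\otimes f)}\circ(A^*\otimes T_B^{-1})\circ1_{(A^*\otimes g)e_A}\bigr)\cdot\bigl(1_{i_{A^*}(A^*\otimes f)(A^*\otimes i_B\otimes B)}\circ\otimes^{-1}_{(A^*\otimes g)e_A,\,e_B}\bigr)\\&\cdot\bigl(1_{i_{A^*}(A^*\otimes f)}\circ(\phi_g^{-1}\otimes B)\circ1_{e_B}\bigr)\cdot\bigl(\otimes^{-1}_{i_{B^*}(B^*\otimes g),\,i_{A^*}(A^*\otimes f)}\circ1_{(B^*\otimes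 e_{A^*}\otimes B)e_B}\bigr)\\&\cdot\bigl(1_{i_{B^*}(B^*\otimes g)(B^*\otimes A\otimes i_{A^*})}\circ(B^*\otimes\otimes^{-1}_{e_{A^*},f})\circ1_{e_B}\bigr)\cdot\bigl(1_{i_{B^*}(B^*\otimes g)}\circ(B^*\otimes(T_A^\dagger)^{-1})\circ1_{(B^*\otimes f)e_B}\bigr).\end{aligned}$$ With $\cap^R_f=i_{\,i_A(f\otimes A^*)}\colon1_I\Rightarrow\mathrm{Tr}_R(ff^*)$, $\cap^L_f=i_{\,i_{A^*}(A^*\otimes f)}\colon1_I\Rightarrow\mathrm{Tr}_L(ff^*)$, $\cup^R_f=(\cap^R_f)^*$, $\cup^L_f=(\cap^L_f)^*$, the 2-category $C$ is *consistent* if $\cap_f^\bullet\cdot\theta^\bullet_{f,f^*}=\cap^\bullet_{f^*}$ and $\theta^\bullet_{f,f^*}\cdot\cup^\bullet_{f^*}=\cup^\bullet_f$ for $\bullet\in\{L,R\}$. A *semi-strict spherical 2-category* is a consistent pivotal one with unitary $\sigma_f\colon\mathrm{Tr}_L(f)\Rightarrow\mathrm{Tr}_R(f)$ for all objects $A$ and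 $f\in\mathrm{End}(A)$, such that $\sigma_f\cdot\mathrm{Tr}_R(\alpha)=\mathrm{Tr}_L(\alpha)\cdot\sigma_g$ for $\alpha\colon f\Rightarrow g$, $\cap^L_{1_A}\cdot\sigma_{1_A}=\cap^R_{1_A}$ and $\sigma_{1_A}\cdot\cup^R_{1_A}=\cup^L_{1_A}$. **Linearity and semi-simplicity.** $C$ is *Vect-linear* if every $\mathrm{Hom}(A,B)$ is a 2-vector space of finite rank (an $\mathbf F$-linear category which is $\mathbf F$-linearly equivalent to $\mathrm{Vect}^n$ for some $n\ge 0$, where $\mathrm{Vect}$ denotes finite-dimensional vector spaces and $n$ is the rank) and compositions and tensor products are $\mathbf F$-(bi)linear. We also assume that $\mathrm{End}(I)$ is equivalent to $\mathrm{Vect}$ and that $2\mathrm{End}(1_I)=\mathbf F$. The *pairing* is $$\langle\alpha,\beta\rangle=\cap^R_f\cdot\mathrm{Tr}_R\bigl((\alpha\cdot\beta)\circ1_{f^*}\bigr)\cdot\cup^R_f\in2\mathrm{End}(1_I)=\mathbf F\qquad(\alpha\in\mathrm{2Hom}(f,g),\ \beta\in\mathrm{2Hom}(g,f)),$$ and $C$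 is *non-degenerate* if all these pairings are non-degenerate, so that $\mathrm{2Hom}(f,g)=\mathrm{2Hom}(g,f)^*$. Put $\dim_q(f)=\langle1_f,1_f\rangle$ for $1$-morphisms $f$ and $\dim_q(A)=\dim_q(1_A)$ for objects $A$. $C$ is *finitely semi-simple* if there is a finite set $\mathcal E$ (a *basis of simple objects*) of mutually non-equivalent objects with $\mathrm{End}(X)\neq0$ for $X\in\mathcal E$, such that composition gives an equivalence $\bigoplus_{X\in\mathcal E}\mathrm{Hom}(A,X)\otimes\mathrm{Hom}(X,B)\simeq\mathrm{Hom}(A,B)$ for all objects $A,B$. **Labels and partition functions.** Let $C$ be a finitely semi-simple non-degenerate Vect-linear semi-strict spherical 2-category. Fix a basis $\mathcal E$ of simple objects and, for all objects $A,B$, a finite basis $\mathcal F_{A,B}$ of simple $1$-morphisms of $\mathrm{Hom}(A,B)$ (one from each isomorphism class). For $0\le i<j<k\le4$ let $e_{ij}\in\mathcal E$ and $f_{ijk}\in\mathcal F_{e_{ik},\,e_{jk}\otimes e_{ij}}$ be labels of the edges and triangles of the 4-simplex $(01234)$. Put $$f_{(ijk)l}=f_{ikl}(e_{kl}\otimes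 f_{ijk}),\quad f_{i(jkl)}=f_{ijl}(f_{jkl}\otimes e_{ij}),\quad 2H(ijkl)=\mathrm{2Hom}(f_{(ijk)l},f_{i(jkl)}),\quad 2H(ijkl)^*=\mathrm{2Hom}(f_{i(jkl)},f_{(ijk)l}).$$ For $\alpha\in2H(1234)$, $\beta\in2H(0234)$, $\gamma\in2H(0134)$, $\delta\in2H(0124)$, $\epsilon\in2H(0123)$, and $\alpha',\dots,\epsilon'$ in the respective spaces $2H(\cdot)^*$, put $$\begin{aligned} \beta\delta&=(\beta\circ(e_{34}\otimes e_{23}\otimes f_{012}))\cdot(f_{024}\circ\otimes_{f_{234},f_{012}})\cdot(\delta\circ(f_{234}\otimes e_{12}\otimes e_{01})),\\ \alpha'\gamma'\epsilon'&=(f_{014}\circ(\alpha'\otimes e_{01}))\cdot(\gamma'\circ(e_{34}\otimes f_{123}\otimes e_{01}))\cdot(f_{034}\circ(e_{34}\otimes\epsilon')),\\ \epsilon\gamma\alpha&=(f_{034}\circ(e_{34}\otimes\epsilon))\cdot(\gamma\circ(e_{34}\otimes f_{123}\otimes e_{01}))\cdot(f_{014}\circ(\alpha\otimes e_{01})),\\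 \delta'\beta'&=(\delta'\circ(f_{234}\otimes e_{12}\otimes e_{01}))\cdot(f_{024}\circ\otimes^{-1}_{f_{234},f_{012}})\cdot(\beta'\circ(e_{34}\otimes e_{23}\otimes f_{012})). \end{aligned}$$ The linear maps $$Z(+(01234))\colon2H(0234)\otimes2H(0124)\to2H(1234)\otimes2H(0134)\otimes2H(0123),$$ $$Z(-(01234))\colon2H(1234)\otimes2H(0134)\otimes2H(0123)\to2H(0234)\otimes2H(0124)$$ are determined, $\langle\cdot,\cdot\rangle$ being extended to tensor products factor by factor, by $$\langle Z(+(01234))(\beta\otimes\delta),\ \alpha'\otimes\gamma'\otimes\epsilon'\rangle=\langle\beta\delta,\ \alpha'\gamma'\epsilon'\rangle,\qquad\langle Z(-(01234))(\alpha\otimes\gamma\otimes\epsilon),\ \beta'\otimes\delta'\rangle=\langle\delta'\beta',\ \epsilon\gamma\alpha\rangle .$$ **Lemma (Orthogonality).** (1) For all labels $e_{ij}\in\mathcal E$ with $(ij)\ne(13)$ and all labels $f_{012},f_{014},f_{023},f_{024},f_{034},f_{124},f_{234}$ as above, $$\dim_q(f_{024})\sum_{e_{13},\,f_{013},\,f_{123},\,f_{134}}\dim_q(e_{13})^{-1}\dim_q(f_{013})\dim_q(f_{123})\dim_q(f_{134})\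 Z(+(01234))\,Z(-(01234))=\mathrm{id}_{2H(0234)\otimes2H(0124)},$$ where $e_{13}$ runs over $\mathcal E$ and each $f_{ijk}$ in the sum runs over $\mathcal F_{e_{ik},\,e_{jk}\otimes e_{ij}}$. (2) For all labels $e_{ij}\in\mathcal E$ and all labels $f_{ijk}$ with $(ijk)\neq(024)$, $$\dim_q(e_{13})^{-1}\dim_q(f_{013})\dim_q(f_{123})\dim_q(f_{134})\sum_{f_{024}}\dim_q(f_{024})\ Z(-(01234))\,Z(+(01234))=\mathrm{id}_{2H(1234)\otimes2H(0134)\otimes2H(0123)},$$ where $f_{024}$ runs over $\mathcal F_{e_{04},\,e_{24}\otimes e_{02}}$. In both formulas the linear maps, too, are composed from left to right. -/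

import Mathlib

open CategoryTheory
open scoped TensorProduct

universe u v₀ v₁ v₂

set_option linter.checkUnivs false

/-- The operations of a (linear) spherical 2-category, presented by its globular set
`Cell ⇉ Mor ⇉ Obj` of objects, 1-morphisms and 2-morphisms.  Compositions are written as total
functions; every law below is imposed exactly on composable (respectively parallel) arguments, and
values on other arguments carry no information.  Compositions are in diagrammatic order. -/
structure TwoCatData (F : Type u) where
  Obj : Type v₀
  Mor : Type v₁
  Cell : Type v₂
  /-- source and target objects of a 1-morphism -/
  src : Mor → Obj
  tgt : Mor → Obj
  /-- source and target 1-morphisms of a 2-morphism -/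
  dom : Cell → Mor
  cod : Cell → Mor
  id₁ : Obj → Mor
  comp : Mor → Mor → Mor
  id₂ : Mor → Cell
  /-- vertical and horizontal composition of 2-morphisms -/
  vcomp : Cell → Cell → Cell
  hcomp : Cell → Cell → Cell
  /-- the identity object `I` and the tensor product, `X ⊗ -` and `- ⊗ X` on 1- and 2-morphisms -/
  one : Obj
  tensor : Obj → Obj → Obj
  tl₁ : Obj → Mor → Mor
  tr₁ : Mor → Obj → Mor
  tl₂ : Obj → Cell → Cell
  tr₂ : Cell → Obj → Cell
  /-- the tensorator `⊗_{f,g}` -/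
  tau : Mor → Mor → Cell
  /-- duals of objects, 1-morphisms, 2-morphisms -/
  d₀ : Obj → Obj
  d₁ : Mor → Mor
  d₂ : Cell → Cell
  /-- unit `i_A`, counit `e_A` and triangulator `T_A` of an object -/
  i₀ : Obj → Mor
  e₀ : Obj → Mor
  T : Obj → Cell
  /-- unit `i_f` and counit `e_f` of a 1-morphism -/
  i₁ : Mor → Cell
  e₁ : Mor → Cell
  /-- the pivotal 2-morphisms `φ_f : #f ⇒ f#` -/
  phi : Mor → Cell
  /-- the spherical 2-morphisms `σ_f : Tr_L f ⇒ Tr_R f` (for endomorphisms `f`) -/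
  sigma : Mor → Cell
  /-- the linear structure on the sets of 2-morphisms between two parallel 1-morphisms -/
  zero : Mor → Mor → Cell
  add : Cell → Cell → Cell
  smul : F → Cell → Cell

namespace TwoCatData

infixr:80 " ≫₁ " => TwoCatData.comp _
infixr:70 " ⊙ᵥ " => TwoCatData.vcomp _
infixr:80 " ⊙ₕ " => TwoCatData.hcomp _
infixr:90 " ⊗₀ " => TwoCatData.tensor _
infixr:90 " ⊲₁ " => TwoCatData.tl₁ _
infixl:90 " ⊳₁ " => TwoCatData.tr₁ _
infixr:90 " ⊲₂ " => TwoCatData.tl₂ _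
infixl:90 " ⊳₂ " => TwoCatData.tr₂ _
prefix:max "𝟙₂ " => TwoCatData.id₂ _
postfix:max "⋆₀" => TwoCatData.d₀ _
postfix:max "⋆₁" => TwoCatData.d₁ _
postfix:max "⋆₂" => TwoCatData.d₂ _

/-! ### Strict 2-categories -/

class IsStrictTwoCategory {F : Type u} (C : TwoCatData.{u, v₀, v₁, v₂} F) : Prop where
  src_cod : ∀ α : C.Cell, C.src (C.cod α) = C.src (C.dom α)
  tgt_cod : ∀ α : C.Cell, C.tgt (C.cod α) = C.tgt (C.dom α)
  src_id₁ : ∀ A : C.Obj, C.src (C.id₁ A) = A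
  tgt_id₁ : ∀ A : C.Obj, C.tgt (C.id₁ A) = A
  src_comp : ∀ f g : C.Mor, C.tgt f = C.src g → C.src (f ≫₁ g) = C.src f
  tgt_comp : ∀ f g : C.Mor, C.tgt f = C.src g → C.tgt (f ≫₁ g) = C.tgt g
  dom_id₂ : ∀ f : C.Mor, C.dom (𝟙₂ f) = f
  cod_id₂ : ∀ f : C.Mor, C.cod (𝟙₂ f) = f
  dom_vcomp : ∀ α β : C.Cell, C.cod α = C.dom β → C.dom (α ⊙ᵥ β) = C.dom α
  cod_vcomp : ∀ α β : C.Cell, C.cod α = C.dom β → C.cod (α ⊙ᵥ β) = C.cod β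
  dom_hcomp : ∀ α β : C.Cell, C.tgt (C.dom α) = C.src (C.dom β) →
    C.dom (α ⊙ₕ β) = C.dom α ≫₁ C.dom β
  cod_hcomp : ∀ α β : C.Cell, C.tgt (C.dom α) = C.src (C.dom β) →
    C.cod (α ⊙ₕ β) = C.cod α ≫₁ C.cod β
  id_comp : ∀ f : C.Mor, C.id₁ (C.src f) ≫₁ f = f
  comp_id : ∀ f : C.Mor, f ≫₁ C.id₁ (C.tgt f) = f
  comp_assoc : ∀ f g h : C.Mor, C.tgt f = C.src g → C.tgt g = C.src h →
    (f ≫₁ g) ≫₁ h = f ≫₁ (g ≫₁ h)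
  id_vcomp : ∀ α : C.Cell, 𝟙₂ (C.dom α) ⊙ᵥ α = α
  vcomp_id : ∀ α : C.Cell, α ⊙ᵥ 𝟙₂ (C.cod α) = α
  vcomp_assoc : ∀ α β γ : C.Cell, C.cod α = C.dom β → C.cod β = C.dom γ →
    (α ⊙ᵥ β) ⊙ᵥ γ = α ⊙ᵥ (β ⊙ᵥ γ)
  id_hcomp : ∀ α : C.Cell, 𝟙₂ (C.id₁ (C.src (C.dom α))) ⊙ₕ α = α
  hcomp_id : ∀ α : C.Cell, α ⊙ₕ 𝟙₂ (C.id₁ (C.tgt (C.dom α))) = α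
  hcomp_assoc : ∀ α β γ : C.Cell, C.tgt (C.dom α) = C.src (C.dom β) →
    C.tgt (C.dom β) = C.src (C.dom γ) →
    (α ⊙ₕ β) ⊙ₕ γ = α ⊙ₕ (β ⊙ₕ γ)
  id₂_hcomp_id₂ : ∀ f g : C.Mor, C.tgt f = C.src g → 𝟙₂ f ⊙ₕ 𝟙₂ g = 𝟙₂ (f ≫₁ g)
  interchange : ∀ α α' β β' : C.Cell, C.cod α = C.dom α' → C.cod β = C.dom β' →
    C.tgt (C.dom α) = C.src (C.dom β) →
    (α ⊙ᵥ α') ⊙ₕ (β ⊙ᵥ β') = (α ⊙ₕ β) ⊙ᵥ (α' ⊙ₕ β')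

/-- `β` is a (two-sided) vertical inverse of `α`. -/
def IsInverse {F : Type u} (C : TwoCatData.{u, v₀, v₁, v₂} F) (α β : C.Cell) : Prop :=
  C.dom β = C.cod α ∧ C.cod β = C.dom α ∧
    α ⊙ᵥ β = 𝟙₂ (C.dom α) ∧ β ⊙ᵥ α = 𝟙₂ (C.cod α)

/-! ### Semi-strict monoidal 2-categories -/

/-- Semi-strict monoidal 2-categories (Gray monoids), with
`⊗_{f,g} : (f ⊗ B)(A' ⊗ g) ⇒ (A ⊗ g)(f ⊗ B')` for `f : A → A'` and `g : B → B'`. -/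
class IsSemistrictMonoidal {F : Type u} (C : TwoCatData.{u, v₀, v₁, v₂} F) : Prop
    extends IsStrictTwoCategory C where
  -- `X ⊗ -` is a strict 2-functor
  src_tl : ∀ (X : C.Obj) (f : C.Mor), C.src (X ⊲₁ f) = X ⊗₀ C.src f
  tgt_tl : ∀ (X : C.Obj) (f : C.Mor), C.tgt (X ⊲₁ f) = X ⊗₀ C.tgt f
  dom_tl : ∀ (X : C.Obj) (α : C.Cell), C.dom (X ⊲₂ α) = X ⊲₁ C.dom α
  cod_tl : ∀ (X : C.Obj) (α : C.Cell), C.cod (X ⊲₂ α) = X ⊲₁ C.cod α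
  tl_id₁ : ∀ X A : C.Obj, X ⊲₁ C.id₁ A = C.id₁ (X ⊗₀ A)
  tl_comp : ∀ (X : C.Obj) (f g : C.Mor), C.tgt f = C.src g → X ⊲₁ (f ≫₁ g) = X ⊲₁ f ≫₁ X ⊲₁ g
  tl_id₂ : ∀ (X : C.Obj) (f : C.Mor), X ⊲₂ 𝟙₂ f = 𝟙₂ (X ⊲₁ f)
  tl_vcomp : ∀ (X : C.Obj) (α β : C.Cell), C.cod α = C.dom β → X ⊲₂ (α ⊙ᵥ β) = X ⊲₂ α ⊙ᵥ X ⊲₂ β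
  tl_hcomp : ∀ (X : C.Obj) (α β : C.Cell), C.tgt (C.dom α) = C.src (C.dom β) →
    X ⊲₂ (α ⊙ₕ β) = X ⊲₂ α ⊙ₕ X ⊲₂ β
  -- `- ⊗ X` is a strict 2-functor
  src_tr : ∀ (X : C.Obj) (f : C.Mor), C.src (f ⊳₁ X) = C.src f ⊗₀ X
  tgt_tr : ∀ (X : C.Obj) (f : C.Mor), C.tgt (f ⊳₁ X) = C.tgt f ⊗₀ X
  dom_tr : ∀ (X : C.Obj) (α : C.Cell), C.dom (α ⊳₂ X) = C.dom α ⊳₁ X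
  cod_tr : ∀ (X : C.Obj) (α : C.Cell), C.cod (α ⊳₂ X) = C.cod α ⊳₁ X
  tr_id₁ : ∀ X A : C.Obj, C.id₁ A ⊳₁ X = C.id₁ (A ⊗₀ X)
  tr_comp : ∀ (X : C.Obj) (f g : C.Mor), C.tgt f = C.src g → (f ≫₁ g) ⊳₁ X = f ⊳₁ X ≫₁ g ⊳₁ X
  tr_id₂ : ∀ (X : C.Obj) (f : C.Mor), 𝟙₂ f ⊳₂ X = 𝟙₂ (f ⊳₁ X)
  tr_vcomp : ∀ (X : C.Obj) (α β : C.Cell), C.cod α = C.dom β → (α ⊙ᵥ β) ⊳₂ X = α ⊳₂ X ⊙ᵥ β ⊳₂ X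
  tr_hcomp : ∀ (X : C.Obj) (α β : C.Cell), C.tgt (C.dom α) = C.src (C.dom β) →
    (α ⊙ₕ β) ⊳₂ X = α ⊳₂ X ⊙ₕ β ⊳₂ X
  -- strict unit
  one_tensor : ∀ A : C.Obj, C.one ⊗₀ A = A
  tensor_one : ∀ A : C.Obj, A ⊗₀ C.one = A
  one_tl₁ : ∀ f : C.Mor, C.one ⊲₁ f = f
  tr₁_one : ∀ f : C.Mor, f ⊳₁ C.one = f
  one_tl₂ : ∀ α : C.Cell, C.one ⊲₂ α = α
  tr₂_one : ∀ α : C.Cell, α ⊳₂ C.one = α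
  -- strict associativity
  tensor_assoc : ∀ A B D : C.Obj, (A ⊗₀ B) ⊗₀ D = A ⊗₀ (B ⊗₀ D)
  tl₁_tl₁ : ∀ (A B : C.Obj) (f : C.Mor), A ⊲₁ (B ⊲₁ f) = (A ⊗₀ B) ⊲₁ f
  tl₁_tr₁ : ∀ (A : C.Obj) (f : C.Mor) (B : C.Obj), A ⊲₁ (f ⊳₁ B) = (A ⊲₁ f) ⊳₁ B
  tr₁_tr₁ : ∀ (f : C.Mor) (A B : C.Obj), (f ⊳₁ A) ⊳₁ B = f ⊳₁ (A ⊗₀ B)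
  tl₂_tl₂ : ∀ (A B : C.Obj) (α : C.Cell), A ⊲₂ (B ⊲₂ α) = (A ⊗₀ B) ⊲₂ α
  tl₂_tr₂ : ∀ (A : C.Obj) (α : C.Cell) (B : C.Obj), A ⊲₂ (α ⊳₂ B) = (A ⊲₂ α) ⊳₂ B
  tr₂_tr₂ : ∀ (α : C.Cell) (A B : C.Obj), (α ⊳₂ A) ⊳₂ B = α ⊳₂ (A ⊗₀ B)
  -- the tensorator
  dom_tau : ∀ f g : C.Mor, C.dom (C.tau f g) = f ⊳₁ C.src g ≫₁ C.tgt f ⊲₁ g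
  cod_tau : ∀ f g : C.Mor, C.cod (C.tau f g) = C.src f ⊲₁ g ≫₁ f ⊳₁ C.tgt g
  tau_invertible : ∀ f g : C.Mor, ∃ β, C.IsInverse (C.tau f g) β
  tau_tl : ∀ (A : C.Obj) (f g : C.Mor), C.tau (A ⊲₁ f) g = A ⊲₂ C.tau f g
  tau_tr_tl : ∀ (f : C.Mor) (A : C.Obj) (g : C.Mor), C.tau (f ⊳₁ A) g = C.tau f (A ⊲₁ g)
  tau_tr : ∀ (f g : C.Mor) (A : C.Obj), C.tau f (g ⊳₁ A) = C.tau f g ⊳₂ A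
  tau_id_left : ∀ (A : C.Obj) (g : C.Mor), C.tau (C.id₁ A) g = 𝟙₂ (A ⊲₁ g)
  tau_id_right : ∀ (f : C.Mor) (A : C.Obj), C.tau f (C.id₁ A) = 𝟙₂ (f ⊳₁ A)
  tau_natural_left : ∀ (α : C.Cell) (g : C.Mor),
    (α ⊳₂ C.src g ⊙ₕ 𝟙₂ (C.tgt (C.dom α) ⊲₁ g)) ⊙ᵥ C.tau (C.cod α) g =
      C.tau (C.dom α) g ⊙ᵥ (𝟙₂ (C.src (C.dom α) ⊲₁ g) ⊙ₕ α ⊳₂ C.tgt g)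
  tau_natural_right : ∀ (f : C.Mor) (β : C.Cell),
    (𝟙₂ (f ⊳₁ C.src (C.dom β)) ⊙ₕ C.tgt f ⊲₂ β) ⊙ᵥ C.tau f (C.cod β) =
      C.tau f (C.dom β) ⊙ᵥ (C.src f ⊲₂ β ⊙ₕ 𝟙₂ (f ⊳₁ C.tgt (C.dom β)))
  tau_comp_left : ∀ f f' g : C.Mor, C.tgt f = C.src f' →
    C.tau (f ≫₁ f') g =
      (𝟙₂ (f ⊳₁ C.src g) ⊙ₕ C.tau f' g) ⊙ᵥ (C.tau f g ⊙ₕ 𝟙₂ (f' ⊳₁ C.tgt g))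
  tau_comp_right : ∀ f g g' : C.Mor, C.tgt g = C.src g' →
    C.tau f (g ≫₁ g') =
      (C.tau f g ⊙ₕ 𝟙₂ (C.tgt f ⊲₁ g')) ⊙ᵥ (𝟙₂ (C.src f ⊲₁ g) ⊙ₕ C.tau f g')

/-! ### Duals -/

section Duals

variable {F : Type u} (C : TwoCatData.{u, v₀, v₁, v₂} F)

/-- `α` is invertible with inverse `α*`. -/
def IsUnitary (α : C.Cell) : Prop :=
  α ⊙ᵥ α⋆₂ = 𝟙₂ (C.dom α) ∧ α⋆₂ ⊙ᵥ α = 𝟙₂ (C.cod α)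

/-- The adjoint `α† : g* ⇒ f*` of `α : f ⇒ g`. -/
def adj (α : C.Cell) : C.Cell :=
  (𝟙₂ (C.cod α)⋆₁ ⊙ₕ C.i₁ (C.dom α)) ⊙ᵥ
    (𝟙₂ (C.cod α)⋆₁ ⊙ₕ α ⊙ₕ 𝟙₂ (C.dom α)⋆₁) ⊙ᵥ
    (C.e₁ (C.cod α) ⊙ₕ 𝟙₂ (C.dom α)⋆₁)

/-- The other adjoint `†α : g* ⇒ f*` of `α : f ⇒ g`. -/
def ladj (α : C.Cell) : C.Cell :=
  (C.i₁ (C.dom α)⋆₁ ⊙ₕ 𝟙₂ (C.cod α)⋆₁) ⊙ᵥ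
    (𝟙₂ (C.dom α)⋆₁ ⊙ₕ α ⊙ₕ 𝟙₂ (C.cod α)⋆₁) ⊙ᵥ
    (𝟙₂ (C.dom α)⋆₁ ⊙ₕ C.e₁ (C.cod α)⋆₁)

/-- Semi-strict monoidal 2-categories with duals. -/
class HasDuals : Prop extends IsSemistrictMonoidal C where
  src_d₁ : ∀ f : C.Mor, C.src f⋆₁ = C.tgt f
  tgt_d₁ : ∀ f : C.Mor, C.tgt f⋆₁ = C.src f
  dom_d₂ : ∀ α : C.Cell, C.dom α⋆₂ = C.cod α
  cod_d₂ : ∀ α : C.Cell, C.cod α⋆₂ = C.dom α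
  src_i₀ : ∀ A : C.Obj, C.src (C.i₀ A) = C.one
  tgt_i₀ : ∀ A : C.Obj, C.tgt (C.i₀ A) = A ⊗₀ A⋆₀
  src_e₀ : ∀ A : C.Obj, C.src (C.e₀ A) = A⋆₀ ⊗₀ A
  tgt_e₀ : ∀ A : C.Obj, C.tgt (C.e₀ A) = C.one
  dom_T : ∀ A : C.Obj, C.dom (C.T A) = C.i₀ A ⊳₁ A ≫₁ A ⊲₁ C.e₀ A
  cod_T : ∀ A : C.Obj, C.cod (C.T A) = C.id₁ A
  dom_i₁ : ∀ f : C.Mor, C.dom (C.i₁ f) = C.id₁ (C.src f)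
  cod_i₁ : ∀ f : C.Mor, C.cod (C.i₁ f) = f ≫₁ f⋆₁
  dom_e₁ : ∀ f : C.Mor, C.dom (C.e₁ f) = f⋆₁ ≫₁ f
  cod_e₁ : ∀ f : C.Mor, C.cod (C.e₁ f) = C.id₁ (C.tgt f)
  -- involutivity
  d₀_d₀ : ∀ A : C.Obj, A⋆₀⋆₀ = A
  d₁_d₁ : ∀ f : C.Mor, f⋆₁⋆₁ = f
  d₂_d₂ : ∀ α : C.Cell, α⋆₂⋆₂ = α
  -- compatibility with identities, compositions, tensor products
  d₁_id₁ : ∀ A : C.Obj, (C.id₁ A)⋆₁ = C.id₁ A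
  d₂_id₂ : ∀ f : C.Mor, (𝟙₂ f)⋆₂ = 𝟙₂ f
  d₂_vcomp : ∀ α β : C.Cell, C.cod α = C.dom β → (α ⊙ᵥ β)⋆₂ = β⋆₂ ⊙ᵥ α⋆₂
  d₂_hcomp : ∀ α β : C.Cell, C.tgt (C.dom α) = C.src (C.dom β) →
    (α ⊙ₕ β)⋆₂ = α⋆₂ ⊙ₕ β⋆₂
  d₁_comp : ∀ f g : C.Mor, C.tgt f = C.src g → (f ≫₁ g)⋆₁ = g⋆₁ ≫₁ f⋆₁
  d₂_tl : ∀ (A : C.Obj) (α : C.Cell), (A ⊲₂ α)⋆₂ = A ⊲₂ α⋆₂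
  d₁_tl : ∀ (A : C.Obj) (f : C.Mor), (A ⊲₁ f)⋆₁ = A ⊲₁ f⋆₁
  d₂_tr : ∀ (A : C.Obj) (α : C.Cell), (α ⊳₂ A)⋆₂ = α⋆₂ ⊳₂ A
  d₁_tr : ∀ (A : C.Obj) (f : C.Mor), (f ⊳₁ A)⋆₁ = f⋆₁ ⊳₁ A
  d₀_tensor : ∀ A B : C.Obj, (A ⊗₀ B)⋆₀ = B⋆₀ ⊗₀ A⋆₀
  -- the tensorator and the triangulator are unitary
  tau_unitary : ∀ f g : C.Mor, C.IsUnitary (C.tau f g)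
  T_unitary : ∀ A : C.Obj, C.IsUnitary (C.T A)
  -- units and counits of duals
  i₀_d₀ : ∀ A : C.Obj, C.i₀ A⋆₀ = (C.e₀ A)⋆₁
  e₀_d₀ : ∀ A : C.Obj, C.e₀ A⋆₀ = (C.i₀ A)⋆₁
  i₁_d₁ : ∀ f : C.Mor, C.i₁ f⋆₁ = (C.e₁ f)⋆₂
  e₁_d₁ : ∀ f : C.Mor, C.e₁ f⋆₁ = (C.i₁ f)⋆₂
  -- units, counits and triangulators of tensor products
  i₀_tensor : ∀ A B : C.Obj, C.i₀ (A ⊗₀ B) = C.i₀ A ≫₁ (A ⊲₁ C.i₀ B ⊳₁ A⋆₀)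
  e₀_tensor : ∀ A B : C.Obj, C.e₀ (A ⊗₀ B) = (B⋆₀ ⊲₁ C.e₀ A ⊳₁ B) ≫₁ C.e₀ B
  T_tensor : ∀ A B : C.Obj, C.T (A ⊗₀ B) =
    (𝟙₂ (C.i₀ A ⊳₁ (A ⊗₀ B)) ⊙ₕ (A ⊲₂ C.tau (C.i₀ B) (C.e₀ A) ⊳₂ B) ⊙ₕ
        𝟙₂ ((A ⊗₀ B) ⊲₁ C.e₀ B)) ⊙ᵥ
      (C.T A ⊳₂ B ⊙ₕ A ⊲₂ C.T B)
  T_one : C.T C.one = 𝟙₂ (C.id₁ C.one)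
  -- units and counits of tensor products of a 1-morphism with an object, and of composites
  i₁_tl : ∀ (A : C.Obj) (f : C.Mor), C.i₁ (A ⊲₁ f) = A ⊲₂ C.i₁ f
  i₁_tr : ∀ (A : C.Obj) (f : C.Mor), C.i₁ (f ⊳₁ A) = C.i₁ f ⊳₂ A
  e₁_tl : ∀ (A : C.Obj) (f : C.Mor), C.e₁ (A ⊲₁ f) = A ⊲₂ C.e₁ f
  e₁_tr : ∀ (A : C.Obj) (f : C.Mor), C.e₁ (f ⊳₁ A) = C.e₁ f ⊳₂ A
  i₁_comp : ∀ f g : C.Mor, C.tgt f = C.src g →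
    C.i₁ (f ≫₁ g) = C.i₁ f ⊙ᵥ (𝟙₂ f ⊙ₕ C.i₁ g ⊙ₕ 𝟙₂ f⋆₁)
  e₁_comp : ∀ f g : C.Mor, C.tgt f = C.src g →
    C.e₁ (f ≫₁ g) = (𝟙₂ g⋆₁ ⊙ₕ C.e₁ f ⊙ₕ 𝟙₂ g) ⊙ᵥ C.e₁ g
  -- the triangle identities
  triangle_left : ∀ f : C.Mor, (C.i₁ f ⊙ₕ 𝟙₂ f) ⊙ᵥ (𝟙₂ f ⊙ₕ C.e₁ f) = 𝟙₂ f
  triangle_right : ∀ f : C.Mor, (𝟙₂ f⋆₁ ⊙ₕ C.i₁ f) ⊙ᵥ (C.e₁ f ⊙ₕ 𝟙₂ f⋆₁) = 𝟙₂ f⋆₁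
  adj_d₂ : ∀ α : C.Cell, (C.adj α)⋆₂ = C.adj α⋆₂
  -- the coherence (swallowtail) law for the triangulator
  swallowtail : ∀ A : C.Obj,
    (𝟙₂ (C.i₀ A) ⊙ₕ A ⊲₂ C.adj (C.T A⋆₀)) ⊙ᵥ
      (C.tau (C.i₀ A) (C.i₀ A) ⊙ₕ 𝟙₂ (A ⊲₁ C.e₀ A ⊳₁ A⋆₀)) ⊙ᵥ
      (𝟙₂ (C.i₀ A) ⊙ₕ C.T A ⊳₂ A⋆₀) = 𝟙₂ (C.i₀ A)

/-! ### Pivotal and spherical 2-categories.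
The tensorators, the triangulators and the `φ_f` are unitary, so that their inverses are written as
their duals. -/

/-- `#f : B* → A*` for `f : A → B`. -/
def lsharp (f : C.Mor) : C.Mor :=
  C.i₀ (C.src f)⋆₀ ⊳₁ (C.tgt f)⋆₀ ≫₁ ((C.src f)⋆₀ ⊲₁ f ⊳₁ (C.tgt f)⋆₀) ≫₁
    (C.src f)⋆₀ ⊲₁ C.e₀ (C.tgt f)⋆₀

/-- `f# : B* → A*` for `f : A → B`. -/
def rsharp (f : C.Mor) : C.Mor :=
  (C.tgt f)⋆₀ ⊲₁ C.i₀ (C.src f) ≫₁ ((C.tgt f)⋆₀ ⊲₁ f ⊳₁ (C.src f)⋆₀) ≫₁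
    C.e₀ (C.tgt f) ⊳₁ (C.src f)⋆₀

/-- `#α : #f ⇒ #g` for `α : f ⇒ g`. -/
def lsharp₂ (α : C.Cell) : C.Cell :=
  let A := C.src (C.dom α)
  let B := C.tgt (C.dom α)
  𝟙₂ (C.i₀ A⋆₀ ⊳₁ B⋆₀) ⊙ₕ (A⋆₀ ⊲₂ α ⊳₂ B⋆₀) ⊙ₕ 𝟙₂ (A⋆₀ ⊲₁ C.e₀ B⋆₀)

/-- `α# : f# ⇒ g#` for `α : f ⇒ g`. -/
def rsharp₂ (α : C.Cell) : C.Cell :=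
  let A := C.src (C.dom α)
  let B := C.tgt (C.dom α)
  𝟙₂ (B⋆₀ ⊲₁ C.i₀ A) ⊙ₕ (B⋆₀ ⊲₂ α ⊳₂ A⋆₀) ⊙ₕ 𝟙₂ (C.e₀ B ⊳₁ A⋆₀)

/-- The 2-isomorphism `#(fg) ≅ #g #f` for `f : A → B` and `g : B → D`. -/
def lsharpComp (f g : C.Mor) : C.Cell :=
  let A := C.src f
  let B := C.tgt f
  let D := C.tgt g
  let iA := C.i₀ A⋆₀ ⊳₁ D⋆₀
  let fA := A⋆₀ ⊲₁ f ⊳₁ D⋆₀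
  let Y := C.i₀ B⋆₀ ⊳₁ D⋆₀ ≫₁ (B⋆₀ ⊲₁ g ⊳₁ D⋆₀)
  (𝟙₂ (iA ≫₁ fA) ⊙ₕ (A⋆₀ ⊲₂ C.adj (C.T B) ⊳₂ D⋆₀) ⊙ₕ
      𝟙₂ ((A⋆₀ ⊲₁ g ⊳₁ D⋆₀) ≫₁ A⋆₀ ⊲₁ C.e₀ D⋆₀)) ⊙ᵥ
    (𝟙₂ (iA ≫₁ fA ≫₁ ((A⋆₀ ⊗₀ B) ⊲₁ C.i₀ B⋆₀ ⊳₁ D⋆₀)) ⊙ₕ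
      (A⋆₀ ⊲₂ C.tau (C.e₀ B⋆₀) g ⊳₂ D⋆₀) ⊙ₕ 𝟙₂ (A⋆₀ ⊲₁ C.e₀ D⋆₀)) ⊙ᵥ
    (C.tau (C.i₀ A⋆₀ ≫₁ A⋆₀ ⊲₁ f) Y ⊙ₕ
      𝟙₂ ((A⋆₀ ⊲₁ C.e₀ B⋆₀ ⊳₁ (D ⊗₀ D⋆₀)) ≫₁ A⋆₀ ⊲₁ C.e₀ D⋆₀)) ⊙ᵥ
    (𝟙₂ Y ⊙ₕ C.tau (C.lsharp f) (C.e₀ D⋆₀))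

/-- The 2-isomorphism `(fg)# ≅ g# f#` for `f : A → B` and `g : B → D`. -/
def rsharpComp (f g : C.Mor) : C.Cell :=
  let A := C.src f
  let B := C.tgt f
  let D := C.tgt g
  let X := D⋆₀ ⊲₁ C.i₀ B ≫₁ (D⋆₀ ⊲₁ g ⊳₁ B⋆₀)
  let iA := D⋆₀ ⊲₁ C.i₀ A
  let fA := D⋆₀ ⊲₁ f ⊳₁ A⋆₀
  (𝟙₂ (iA ≫₁ fA) ⊙ₕ (D⋆₀ ⊲₂ (C.T B)⋆₂ ⊳₂ A⋆₀) ⊙ₕ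
      𝟙₂ ((D⋆₀ ⊲₁ g ⊳₁ A⋆₀) ≫₁ C.e₀ D ⊳₁ A⋆₀)) ⊙ᵥ
    (𝟙₂ (iA ≫₁ fA ≫₁ (D⋆₀ ⊲₁ C.i₀ B ⊳₁ (B ⊗₀ A⋆₀))) ⊙ₕ
      (D⋆₀ ⊲₂ (C.tau g (C.e₀ B))⋆₂ ⊳₂ A⋆₀) ⊙ₕ 𝟙₂ (C.e₀ D ⊳₁ A⋆₀)) ⊙ᵥ
    ((C.tau X (C.i₀ A ≫₁ f ⊳₁ A⋆₀))⋆₂ ⊙ₕ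
      𝟙₂ (((D⋆₀ ⊗₀ D) ⊲₁ C.e₀ B ⊳₁ A⋆₀) ≫₁ C.e₀ D ⊳₁ A⋆₀)) ⊙ᵥ
    (𝟙₂ X ⊙ₕ (C.tau (C.e₀ D) (C.rsharp f))⋆₂)

/-- Semi-strict pivotal 2-categories. -/
class IsPivotal : Prop extends HasDuals C where
  dom_phi : ∀ f : C.Mor, C.dom (C.phi f) = C.lsharp f
  cod_phi : ∀ f : C.Mor, C.cod (C.phi f) = C.rsharp f
  phi_unitary : ∀ f : C.Mor, C.IsUnitary (C.phi f)
  phi_natural : ∀ α : C.Cell, C.lsharp₂ α ⊙ᵥ C.phi (C.cod α) = C.phi (C.dom α) ⊙ᵥ C.rsharp₂ α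
  adj_phi : ∀ f : C.Mor, C.adj (C.phi f) = C.phi f⋆₁
  phi_comp : ∀ f g : C.Mor, C.tgt f = C.src g →
    C.phi (f ≫₁ g) ⊙ᵥ C.rsharpComp f g = C.lsharpComp f g ⊙ᵥ (C.phi g ⊙ₕ C.phi f)
  lsharp_adj : ∀ α : C.Cell, C.lsharp₂ (C.adj α) = C.ladj (C.rsharp₂ α)
  adj_lsharp : ∀ α : C.Cell, C.adj (C.lsharp₂ α) = C.rsharp₂ (C.ladj α)

/-- The left and right trace functors `End(A) → End(I)` on 1-morphisms and 2-morphisms. -/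
def trL (f : C.Mor) : C.Mor :=
  C.i₀ (C.src f)⋆₀ ≫₁ (C.src f)⋆₀ ⊲₁ f ≫₁ C.e₀ (C.src f)

def trL₂ (α : C.Cell) : C.Cell :=
  let A := C.src (C.dom α)
  𝟙₂ (C.i₀ A⋆₀) ⊙ₕ A⋆₀ ⊲₂ α ⊙ₕ 𝟙₂ (C.e₀ A)

def trR (f : C.Mor) : C.Mor :=
  C.i₀ (C.src f) ≫₁ f ⊳₁ (C.src f)⋆₀ ≫₁ C.e₀ (C.src f)⋆₀

def trR₂ (α : C.Cell) : C.Cell :=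
  let A := C.src (C.dom α)
  𝟙₂ (C.i₀ A) ⊙ₕ α ⊳₂ A⋆₀ ⊙ₕ 𝟙₂ (C.e₀ A⋆₀)

/-- `θ^R_{f,g} : Tr_R(fg) ⇒ Tr_R(gf)` for `f : A → B` and `g : B → A`. -/
def thetaR (f g : C.Mor) : C.Cell :=
  let A := C.src f
  let B := C.tgt f
  let X := C.i₀ A ≫₁ f ⊳₁ A⋆₀
  let Y := C.i₀ B ≫₁ g ⊳₁ B⋆₀
  let Z := g ⊳₁ A⋆₀ ≫₁ C.e₀ A⋆₀
  (𝟙₂ X ⊙ₕ C.adj (C.T B) ⊳₂ A⋆₀ ⊙ₕ 𝟙₂ Z) ⊙ᵥ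
    (𝟙₂ (X ≫₁ (B ⊲₁ C.i₀ B⋆₀ ⊳₁ A⋆₀)) ⊙ₕ C.tau (C.e₀ B⋆₀) Z) ⊙ᵥ
    (𝟙₂ X ⊙ₕ B ⊲₂ C.phi g ⊙ₕ 𝟙₂ (C.e₀ B⋆₀)) ⊙ᵥ
    (C.tau X Y ⊙ₕ 𝟙₂ ((B ⊲₁ C.e₀ A ⊳₁ B⋆₀) ≫₁ C.e₀ B⋆₀)) ⊙ᵥ
    (𝟙₂ (Y ≫₁ C.i₀ A ⊳₁ (A ⊗₀ B⋆₀)) ⊙ₕ C.tau f (C.e₀ A) ⊳₂ B⋆₀ ⊙ₕ 𝟙₂ (C.e₀ B⋆₀)) ⊙ᵥ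
    (𝟙₂ Y ⊙ₕ C.T A ⊳₂ B⋆₀ ⊙ₕ 𝟙₂ (f ⊳₁ B⋆₀ ≫₁ C.e₀ B⋆₀))

/-- `θ^L_{f,g} : Tr_L(fg) ⇒ Tr_L(gf)` for `f : A → B` and `g : B → A`, the mirror image of
`θ^R_{f,g}` (reversing the order of the tensor products). -/
def thetaL (f g : C.Mor) : C.Cell :=
  let A := C.src f
  let B := C.tgt f
  let X := C.i₀ A⋆₀ ≫₁ A⋆₀ ⊲₁ f
  let Y := C.i₀ B⋆₀ ≫₁ B⋆₀ ⊲₁ g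
  let Z := A⋆₀ ⊲₁ g ≫₁ C.e₀ A
  (𝟙₂ X ⊙ₕ A⋆₀ ⊲₂ (C.T B)⋆₂ ⊙ₕ 𝟙₂ Z) ⊙ᵥ
    (𝟙₂ (X ≫₁ (A⋆₀ ⊲₁ C.i₀ B ⊳₁ B)) ⊙ₕ (C.tau Z (C.e₀ B))⋆₂) ⊙ᵥ
    (𝟙₂ X ⊙ₕ (C.phi g)⋆₂ ⊳₂ B ⊙ₕ 𝟙₂ (C.e₀ B)) ⊙ᵥ
    ((C.tau Y X)⋆₂ ⊙ₕ 𝟙₂ ((B⋆₀ ⊲₁ C.e₀ A⋆₀ ⊳₁ B) ≫₁ C.e₀ B)) ⊙ᵥ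
    (𝟙₂ (Y ≫₁ (B⋆₀ ⊗₀ A) ⊲₁ C.i₀ A⋆₀) ⊙ₕ B⋆₀ ⊲₂ (C.tau (C.e₀ A⋆₀) f)⋆₂ ⊙ₕ 𝟙₂ (C.e₀ B)) ⊙ᵥ
    (𝟙₂ Y ⊙ₕ B⋆₀ ⊲₂ (C.adj (C.T A))⋆₂ ⊙ₕ 𝟙₂ (B⋆₀ ⊲₁ f ≫₁ C.e₀ B))

/-- Caps and cups of a 1-morphism with respect to the right and the left trace functors. -/
def capR (f : C.Mor) : C.Cell := C.i₁ (C.i₀ (C.src f) ≫₁ f ⊳₁ (C.src f)⋆₀)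

def cupR (f : C.Mor) : C.Cell := (C.capR f)⋆₂

def capL (f : C.Mor) : C.Cell := C.i₁ (C.i₀ (C.src f)⋆₀ ≫₁ (C.src f)⋆₀ ⊲₁ f)

def cupL (f : C.Mor) : C.Cell := (C.capL f)⋆₂

/-- Semi-strict spherical 2-categories (their pivotal structure is always assumed consistent). -/
class IsSpherical : Prop extends IsPivotal C where
  -- consistency
  capR_theta : ∀ f : C.Mor, C.capR f ⊙ᵥ C.thetaR f f⋆₁ = C.capR f⋆₁
  theta_cupR : ∀ f : C.Mor, C.thetaR f f⋆₁ ⊙ᵥ C.cupR f⋆₁ = C.cupR f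
  capL_theta : ∀ f : C.Mor, C.capL f ⊙ᵥ C.thetaL f f⋆₁ = C.capL f⋆₁
  theta_cupL : ∀ f : C.Mor, C.thetaL f f⋆₁ ⊙ᵥ C.cupL f⋆₁ = C.cupL f
  -- the spherical structure
  dom_sigma : ∀ f : C.Mor, C.src f = C.tgt f → C.dom (C.sigma f) = C.trL f
  cod_sigma : ∀ f : C.Mor, C.src f = C.tgt f → C.cod (C.sigma f) = C.trR f
  sigma_unitary : ∀ f : C.Mor, C.src f = C.tgt f → C.IsUnitary (C.sigma f)
  sigma_natural : ∀ α : C.Cell, C.src (C.dom α) = C.tgt (C.dom α) →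
    C.sigma (C.dom α) ⊙ᵥ C.trR₂ α = C.trL₂ α ⊙ᵥ C.sigma (C.cod α)
  capL_sigma : ∀ A : C.Obj, C.capL (C.id₁ A) ⊙ᵥ C.sigma (C.id₁ A) = C.capR (C.id₁ A)
  sigma_cupR : ∀ A : C.Obj, C.sigma (C.id₁ A) ⊙ᵥ C.cupR (C.id₁ A) = C.cupL (C.id₁ A)

end Duals

/-! ### Linear structure -/

/-- The sets of 2-morphisms between parallel 1-morphisms are `F`-vector spaces, and the vertical and
horizontal compositions and the tensor product are `F`-(bi)linear. -/
class IsLinear {F : Type u} [Field F] (C : TwoCatData.{u, v₀, v₁, v₂} F) : Prop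
    extends IsSemistrictMonoidal C where
  dom_zero : ∀ f g : C.Mor, C.src f = C.src g → C.tgt f = C.tgt g → C.dom (C.zero f g) = f
  cod_zero : ∀ f g : C.Mor, C.src f = C.src g → C.tgt f = C.tgt g → C.cod (C.zero f g) = g
  dom_add : ∀ α β : C.Cell, C.dom α = C.dom β → C.cod α = C.cod β →
    C.dom (C.add α β) = C.dom α
  cod_add : ∀ α β : C.Cell, C.dom α = C.dom β → C.cod α = C.cod β →
    C.cod (C.add α β) = C.cod α
  dom_smul : ∀ (c : F) (α : C.Cell), C.dom (C.smul c α) = C.dom α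
  cod_smul : ∀ (c : F) (α : C.Cell), C.cod (C.smul c α) = C.cod α
  add_assoc : ∀ α β γ : C.Cell, C.dom α = C.dom β → C.cod α = C.cod β → C.dom β = C.dom γ →
    C.cod β = C.cod γ → C.add (C.add α β) γ = C.add α (C.add β γ)
  add_comm : ∀ α β : C.Cell, C.dom α = C.dom β → C.cod α = C.cod β → C.add α β = C.add β α
  zero_add : ∀ α : C.Cell, C.add (C.zero (C.dom α) (C.cod α)) α = α
  zero_smul : ∀ α : C.Cell, C.smul 0 α = C.zero (C.dom α) (C.cod α)
  one_smul : ∀ α : C.Cell, C.smul 1 α = α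
  mul_smul : ∀ (c d : F) (α : C.Cell), C.smul (c * d) α = C.smul c (C.smul d α)
  add_smul : ∀ (c d : F) (α : C.Cell), C.smul (c + d) α = C.add (C.smul c α) (C.smul d α)
  smul_add : ∀ (c : F) (α β : C.Cell), C.dom α = C.dom β → C.cod α = C.cod β →
    C.smul c (C.add α β) = C.add (C.smul c α) (C.smul c β)
  add_vcomp : ∀ α α' β : C.Cell, C.dom α = C.dom α' → C.cod α = C.cod α' → C.cod α = C.dom β →
    C.add α α' ⊙ᵥ β = C.add (α ⊙ᵥ β) (α' ⊙ᵥ β)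
  vcomp_add : ∀ α β β' : C.Cell, C.dom β = C.dom β' → C.cod β = C.cod β' → C.cod α = C.dom β →
    α ⊙ᵥ C.add β β' = C.add (α ⊙ᵥ β) (α ⊙ᵥ β')
  smul_vcomp : ∀ (c : F) (α β : C.Cell), C.cod α = C.dom β →
    C.smul c α ⊙ᵥ β = C.smul c (α ⊙ᵥ β)
  vcomp_smul : ∀ (c : F) (α β : C.Cell), C.cod α = C.dom β →
    α ⊙ᵥ C.smul c β = C.smul c (α ⊙ᵥ β)
  add_hcomp : ∀ α α' β : C.Cell, C.dom α = C.dom α' → C.cod α = C.cod α' →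
    C.tgt (C.dom α) = C.src (C.dom β) → C.add α α' ⊙ₕ β = C.add (α ⊙ₕ β) (α' ⊙ₕ β)
  hcomp_add : ∀ α β β' : C.Cell, C.dom β = C.dom β' → C.cod β = C.cod β' →
    C.tgt (C.dom α) = C.src (C.dom β) → α ⊙ₕ C.add β β' = C.add (α ⊙ₕ β) (α ⊙ₕ β')
  smul_hcomp : ∀ (c : F) (α β : C.Cell), C.tgt (C.dom α) = C.src (C.dom β) →
    C.smul c α ⊙ₕ β = C.smul c (α ⊙ₕ β)
  hcomp_smul : ∀ (c : F) (α β : C.Cell), C.tgt (C.dom α) = C.src (C.dom β) →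
    α ⊙ₕ C.smul c β = C.smul c (α ⊙ₕ β)
  tl_add : ∀ (X : C.Obj) (α β : C.Cell), C.dom α = C.dom β → C.cod α = C.cod β →
    X ⊲₂ C.add α β = C.add (X ⊲₂ α) (X ⊲₂ β)
  tl_smul : ∀ (X : C.Obj) (c : F) (α : C.Cell), X ⊲₂ C.smul c α = C.smul c (X ⊲₂ α)
  tr_add : ∀ (X : C.Obj) (α β : C.Cell), C.dom α = C.dom β → C.cod α = C.cod β →
    C.add α β ⊳₂ X = C.add (α ⊳₂ X) (β ⊳₂ X)
  tr_smul : ∀ (X : C.Obj) (c : F) (α : C.Cell), C.smul c α ⊳₂ X = C.smul c (α ⊳₂ X)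

/-- The type of 1-morphisms `A → B`. -/
def Hom1 {F : Type u} (C : TwoCatData.{u, v₀, v₁, v₂} F) (A B : C.Obj) : Type v₁ :=
  {f : C.Mor // C.src f = A ∧ C.tgt f = B}

/-- The type of 2-morphisms `f ⇒ g`, for `f g : A → B`. -/
def Hom2 {F : Type u} {C : TwoCatData.{u, v₀, v₁, v₂} F} {A B : C.Obj} (f g : C.Hom1 A B) :
    Type v₂ :=
  {α : C.Cell // C.dom α = f.1 ∧ C.cod α = g.1}

section Hom

open IsStrictTwoCategory IsSemistrictMonoidal IsLinear

variable {F : Type u} {C : TwoCatData.{u, v₀, v₁, v₂} F} {A B D A' B' : C.Obj}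

theorem Hom1.src_eq (f : C.Hom1 A B) : C.src f.1 = A := f.2.1
theorem Hom1.tgt_eq (f : C.Hom1 A B) : C.tgt f.1 = B := f.2.2
theorem Hom2.dom_eq {f g : C.Hom1 A B} (α : Hom2 f g) : C.dom α.1 = f.1 := α.2.1
theorem Hom2.cod_eq {f g : C.Hom1 A B} (α : Hom2 f g) : C.cod α.1 = g.1 := α.2.2

attribute [local simp] Hom1.src_eq Hom1.tgt_eq Hom2.dom_eq Hom2.cod_eq src_cod tgt_cod src_id₁
  tgt_id₁ src_comp tgt_comp dom_id₂ cod_id₂ dom_vcomp cod_vcomp dom_hcomp cod_hcomp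
  src_tl tgt_tl dom_tl cod_tl src_tr tgt_tr dom_tr cod_tr dom_add cod_add dom_smul cod_smul
  dom_zero cod_zero

theorem Hom1.src_parallel (f g : C.Hom1 A B) : C.src f.1 = C.src g.1 := by simp
theorem Hom1.tgt_parallel (f g : C.Hom1 A B) : C.tgt f.1 = C.tgt g.1 := by simp

theorem Hom2.dom_parallel {f g : C.Hom1 A B} (α β : Hom2 f g) : C.dom α.1 = C.dom β.1 := by simp
theorem Hom2.cod_parallel {f g : C.Hom1 A B} (α β : Hom2 f g) : C.cod α.1 = C.cod β.1 := by simp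

section Strict

variable [IsStrictTwoCategory C]

/-- `Hom(A, B)`, with the vertical composition of 2-morphisms. -/
instance : Category (C.Hom1 A B) where
  Hom f g := Hom2 f g
  id f := ⟨𝟙₂ f.1, by simp⟩
  comp α β := ⟨α.1 ⊙ᵥ β.1, by simp⟩
  id_comp α := Subtype.ext (by
    have := id_vcomp α.1
    rwa [α.dom_eq] at this)
  comp_id α := Subtype.ext (by
    have := vcomp_id α.1
    rwa [α.cod_eq] at this)
  assoc α β γ := Subtype.ext (vcomp_assoc _ _ _ (by rw [α.cod_eq, β.dom_eq])
    (by rw [β.cod_eq, γ.dom_eq]))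

/-- The identity 1-morphism and the composition of 1-morphisms. -/
def Hom1.id (C : TwoCatData.{u, v₀, v₁, v₂} F) [IsStrictTwoCategory C] (A : C.Obj) : C.Hom1 A A :=
  ⟨C.id₁ A, by simp⟩

def Hom1.comp (f : C.Hom1 A B) (g : C.Hom1 B D) : C.Hom1 A D := ⟨f.1 ≫₁ g.1, by simp⟩

end Strict

section Monoidal

variable [IsSemistrictMonoidal C]

/-- The tensor products of an object and a 1-morphism. -/
def Hom1.tl (X : C.Obj) (f : C.Hom1 A B) : C.Hom1 (X ⊗₀ A) (X ⊗₀ B) := ⟨X ⊲₁ f.1, by simp⟩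

def Hom1.tr (f : C.Hom1 A B) (X : C.Obj) : C.Hom1 (A ⊗₀ X) (B ⊗₀ X) := ⟨f.1 ⊳₁ X, by simp⟩

end Monoidal

/-- A 1-morphism `A → B`, regarded as a 1-morphism `A → B'` if `B = B'`. -/
def Hom1.retarget (f : C.Hom1 A B) (h : B = B') : C.Hom1 A B' := ⟨f.1, f.2.1, f.2.2.trans h⟩

section Linear

variable [Field F] [IsLinear C]

instance (f g : C.Hom1 A B) : Add (Hom2 f g) where
  add α β := ⟨C.add α.1 β.1, by simp⟩

instance (f g : C.Hom1 A B) : Zero (Hom2 f g) where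
  zero := ⟨C.zero f.1 g.1, by simp⟩

instance (f g : C.Hom1 A B) : SMul F (Hom2 f g) where
  smul c α := ⟨C.smul c α.1, by simp⟩

instance (f g : C.Hom1 A B) : Neg (Hom2 f g) where
  neg α := (-1 : F) • α

theorem Hom2.add_coe {f g : C.Hom1 A B} (α β : Hom2 f g) : (α + β).1 = C.add α.1 β.1 := rfl
theorem Hom2.smul_coe {f g : C.Hom1 A B} (c : F) (α : Hom2 f g) :
    (c • α).1 = C.smul c α.1 := rfl

theorem Hom2.zero_add' {f g : C.Hom1 A B} (α : Hom2 f g) : 0 + α = α :=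
  Subtype.ext (by
    have := IsLinear.zero_add α.1
    rwa [α.dom_eq, α.cod_eq] at this)

theorem Hom2.add_comm' {f g : C.Hom1 A B} (α β : Hom2 f g) : α + β = β + α :=
  Subtype.ext (IsLinear.add_comm _ _ (by simp) (by simp))

theorem Hom2.zero_smul' {f g : C.Hom1 A B} (α : Hom2 f g) : (0 : F) • α = 0 :=
  Subtype.ext (by
    have := IsLinear.zero_smul α.1
    rwa [α.dom_eq, α.cod_eq] at this)

theorem Hom2.add_smul' {f g : C.Hom1 A B} (c d : F) (α : Hom2 f g) :
    (c + d) • α = c • α + d • α :=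
  Subtype.ext (IsLinear.add_smul _ _ _)

theorem Hom2.one_smul' {f g : C.Hom1 A B} (α : Hom2 f g) : (1 : F) • α = α :=
  Subtype.ext (IsLinear.one_smul _)

theorem Hom2.neg_add' {f g : C.Hom1 A B} (α : Hom2 f g) : -α + α = 0 := by
  have h : (-1 : F) • α + (1 : F) • α = 0 := by
    rw [← Hom2.add_smul', neg_add_cancel, Hom2.zero_smul']
  rwa [Hom2.one_smul'] at h

/-- The vector space `2Hom(f, g)`. -/
instance (f g : C.Hom1 A B) : AddCommGroup (Hom2 f g) where
  add_assoc α β γ := Subtype.ext (IsLinear.add_assoc _ _ _ (by simp) (by simp) (by simp) (by simp))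
  zero_add := Hom2.zero_add'
  add_zero α := (Hom2.add_comm' _ _).trans (Hom2.zero_add' α)
  add_comm := Hom2.add_comm'
  neg_add_cancel := Hom2.neg_add'
  nsmul := nsmulRec
  zsmul := zsmulRec

instance (f g : C.Hom1 A B) : Module F (Hom2 f g) where
  one_smul := Hom2.one_smul'
  mul_smul c d α := Subtype.ext (IsLinear.mul_smul _ _ _)
  smul_add c α β := Subtype.ext (IsLinear.smul_add _ _ _ (by simp) (by simp))
  smul_zero c := by
    have h : c • ((0 : F) • (0 : Hom2 f g)) = (0 : F) • (0 : Hom2 f g) := by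
      rw [show c • ((0 : F) • (0 : Hom2 f g)) = (c * 0) • (0 : Hom2 f g) from
        (Subtype.ext (IsLinear.mul_smul _ _ _)).symm, mul_zero]
    rwa [Hom2.zero_smul'] at h
  add_smul := Hom2.add_smul'
  zero_smul := Hom2.zero_smul'

instance : Preadditive (C.Hom1 A B) where
  homGroup f g := inferInstanceAs (AddCommGroup (Hom2 f g))
  add_comp _ _ _ α α' β := Subtype.ext (IsLinear.add_vcomp _ _ _ (Hom2.dom_parallel α α')
    (Hom2.cod_parallel α α') ((Hom2.cod_eq α).trans (Hom2.dom_eq β).symm))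
  comp_add _ _ _ α β β' := Subtype.ext (IsLinear.vcomp_add _ _ _ (Hom2.dom_parallel β β')
    (Hom2.cod_parallel β β') ((Hom2.cod_eq α).trans (Hom2.dom_eq β).symm))

instance : Linear F (C.Hom1 A B) where
  homModule f g := inferInstanceAs (Module F (Hom2 f g))
  smul_comp _ _ _ _ α β := Subtype.ext (IsLinear.smul_vcomp _ _ _
    ((Hom2.cod_eq α).trans (Hom2.dom_eq β).symm))
  comp_smul _ _ _ α _ β := Subtype.ext (IsLinear.vcomp_smul _ _ _
    ((Hom2.cod_eq α).trans (Hom2.dom_eq β).symm))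

/-- A linear map between spaces of 2-morphisms given by an operation on 2-morphisms. -/
def Hom2.map {f g : C.Hom1 A B} {f' g' : C.Hom1 A' B'} (Φ : C.Cell → C.Cell)
    (hdom : ∀ α : Hom2 f g, C.dom (Φ α.1) = f'.1) (hcod : ∀ α : Hom2 f g, C.cod (Φ α.1) = g'.1)
    (hadd : ∀ α β : Hom2 f g, Φ (C.add α.1 β.1) = C.add (Φ α.1) (Φ β.1))
    (hsmul : ∀ (c : F) (α : Hom2 f g), Φ (C.smul c α.1) = C.smul c (Φ α.1)) :
    Hom2 f g →ₗ[F] Hom2 f' g' where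
  toFun α := ⟨Φ α.1, hdom α, hcod α⟩
  map_add' α β := Subtype.ext (hadd α β)
  map_smul' c α := Subtype.ext (hsmul c α)

/-- Vertical composition as a bilinear map. -/
def Hom2.vcompₗ (f g h : C.Hom1 A B) : Hom2 f g →ₗ[F] Hom2 g h →ₗ[F] Hom2 f h :=
  LinearMap.mk₂ F (fun α β => ⟨α.1 ⊙ᵥ β.1, by simp⟩)
    (fun _ _ _ => Subtype.ext (IsLinear.add_vcomp _ _ _ (by simp) (by simp) (by simp)))
    (fun _ _ _ => Subtype.ext (IsLinear.smul_vcomp _ _ _ (by simp)))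
    (fun _ _ _ => Subtype.ext (IsLinear.vcomp_add _ _ _ (by simp) (by simp) (by simp)))
    (fun _ _ _ => Subtype.ext (IsLinear.vcomp_smul _ _ _ (by simp)))

/-- Horizontal composition as a bilinear map. -/
def Hom2.hcompₗ (f f' : C.Hom1 A B) (g g' : C.Hom1 B D) :
    Hom2 f f' →ₗ[F] Hom2 g g' →ₗ[F] Hom2 (f.comp g) (f'.comp g') :=
  LinearMap.mk₂ F (fun α β => ⟨α.1 ⊙ₕ β.1, by simp [Hom1.comp]⟩)
    (fun _ _ _ => Subtype.ext (IsLinear.add_hcomp _ _ _ (by simp) (by simp) (by simp)))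
    (fun _ _ _ => Subtype.ext (IsLinear.smul_hcomp _ _ _ (by simp)))
    (fun _ _ _ => Subtype.ext (IsLinear.hcomp_add _ _ _ (by simp) (by simp) (by simp)))
    (fun _ _ _ => Subtype.ext (IsLinear.hcomp_smul _ _ _ (by simp)))

end Linear

end Hom

end TwoCatData

/-- An `F`-linear category is a 2-vector space of rank `n` if it is `F`-linearly equivalent to the
`n`-th power of the category of finite-dimensional vector spaces. -/
def IsTwoVectorSpaceOfRank (F : Type u) [Field F] (V : Type v₁) [Category.{v₂} V] [Preadditive V]
    [Linear F V] (n : ℕ) : Prop :=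
  ∃ E : V ⥤ (Fin n → FGModuleCat.{u} F), E.IsEquivalence ∧
    (∀ (X Y : V) (α β : X ⟶ Y) (k : Fin n), E.map (α + β) k = E.map α k + E.map β k) ∧
    ∀ (X Y : V) (c : F) (α : X ⟶ Y) (k : Fin n), E.map (c • α) k = c • E.map α k

namespace TwoCatData

/-! ### `Vect`-linear 2-categories, the pairing and quantum dimensions -/

/-- `Vect`-linear semi-strict monoidal 2-categories such that moreover `End(I)` is equivalent to
`Vect` and `2End(1_I)` is the field `F`. -/
class IsVectLinear {F : Type u} [Field F] (C : TwoCatData.{u, v₀, v₁, v₂} F) : Prop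
    extends IsLinear C where
  twoVectorSpace : ∀ A B : C.Obj, ∃ n : ℕ, IsTwoVectorSpaceOfRank F (C.Hom1 A B) n
  rank_end_one : IsTwoVectorSpaceOfRank F (C.Hom1 C.one C.one) 1
  twoEnd_one : Function.Bijective
    (fun c : F => c • (𝟙 (Hom1.id C C.one) : Hom2 (Hom1.id C C.one) (Hom1.id C C.one)))

section Pairing

open IsStrictTwoCategory IsSemistrictMonoidal HasDuals IsLinear

/-- The 2-morphism `⟨α, β⟩ : 1_I ⇒ 1_I`, for `α : f ⇒ g` and `β : g ⇒ f`. -/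
def pairingCell {F : Type u} (C : TwoCatData.{u, v₀, v₁, v₂} F) (α β : C.Cell) : C.Cell :=
  C.capR (C.dom α) ⊙ᵥ C.trR₂ ((α ⊙ᵥ β) ⊙ₕ 𝟙₂ (C.dom α)⋆₁) ⊙ᵥ C.cupR (C.dom α)

variable {F : Type u} [Field F] {C : TwoCatData.{u, v₀, v₁, v₂} F}

/-- The identification of `F` with `2End(1_I)`. -/
noncomputable def unitEquiv [IsVectLinear C] :
    F ≃ₗ[F] Hom2 (Hom1.id C C.one) (Hom1.id C C.one) :=
  LinearEquiv.ofBijective (LinearMap.toSpanSingleton F _ (𝟙 (Hom1.id C C.one)))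
    IsVectLinear.twoEnd_one

instance finite_hom2 [IsVectLinear C] {A B : C.Obj} (f g : C.Hom1 A B) :
    Module.Finite F (Hom2 f g) := by
  obtain ⟨n, E, hE, hadd, hsmul⟩ := IsVectLinear.twoVectorSpace (C := C) A B
  let L : Hom2 f g →ₗ[F] (∀ k : Fin n, (E.obj f k ⟶ E.obj g k)) :=
    { toFun := fun α k => E.map (X := f) (Y := g) α k
      map_add' := fun α β => funext fun k => hadd f g α β k
      map_smul' := fun c α => funext fun k => hsmul f g c α k }
  exact Module.Finite.of_injective L fun α β h => E.map_injective (X := f) (Y := g)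
    (funext fun k => congrFun h k)

attribute [local simp] Hom1.src_eq Hom1.tgt_eq Hom2.dom_eq Hom2.cod_eq src_cod tgt_cod src_id₁
  tgt_id₁ src_comp tgt_comp dom_id₂ cod_id₂ dom_vcomp cod_vcomp dom_hcomp cod_hcomp
  src_tl tgt_tl dom_tl cod_tl src_tr tgt_tr dom_tr cod_tr dom_add cod_add dom_smul cod_smul
  dom_zero cod_zero comp_assoc src_d₁ tgt_d₁ dom_d₂ cod_d₂ src_i₀ tgt_i₀ src_e₀ tgt_e₀ dom_i₁
  cod_i₁ dom_e₁ cod_e₁ d₀_d₀ d₁_d₁ d₁_comp d₁_tr e₀_d₀ tr_comp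

variable [IsSpherical C] [IsVectLinear C] {A B : C.Obj}

/-- The linear form `α ↦ cap · Tr_R(α ∘ f*) · cup` on `2End(f)`, with values in `2End(1_I)`. -/
def closure (f : C.Hom1 A B) :
    Hom2 f f →ₗ[F] Hom2 (Hom1.id C C.one) (Hom1.id C C.one) :=
  Hom2.map (fun α => C.capR f.1 ⊙ᵥ C.trR₂ (α ⊙ₕ 𝟙₂ f.1⋆₁) ⊙ᵥ C.cupR f.1)
    (fun α => by simp (maxDischargeDepth := 12) [capR, cupR, trR₂, Hom1.id])
    (fun α => by simp (maxDischargeDepth := 12) [capR, cupR, trR₂, Hom1.id])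
    (fun α β => by
      rw [add_hcomp _ _ _ (by simp) (by simp) (by simp)]
      simp (maxDischargeDepth := 12) [capR, cupR, trR₂, tr_add, add_hcomp, hcomp_add, add_vcomp,
        vcomp_add])
    (fun c α => by
      simp (maxDischargeDepth := 12) [capR, cupR, trR₂, tr_smul, smul_hcomp, hcomp_smul,
        smul_vcomp, vcomp_smul])

/-- The pairing `⟨ , ⟩ : 2Hom(f, g) ⊗ 2Hom(g, f) → F = 2End(1_I)`. -/
noncomputable def pairing (f g : C.Hom1 A B) : Hom2 f g →ₗ[F] Hom2 g f →ₗ[F] F :=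
  (Hom2.vcompₗ f g f).compr₂ ((unitEquiv (C := C)).symm.toLinearMap ∘ₗ closure f)

theorem unitEquiv_pairing {f g : C.Hom1 A B} (α : Hom2 f g) (β : Hom2 g f) :
    (unitEquiv (C := C) (pairing f g α β)).1 = C.pairingCell α.1 β.1 := by
  have h : unitEquiv (C := C) (pairing f g α β) = closure f (Hom2.vcompₗ f g f α β) :=
    LinearEquiv.apply_symm_apply _ _
  rw [h, pairingCell, α.dom_eq]
  rfl

/-- Quantum dimensions of 1-morphisms and of objects. -/
noncomputable def dimq (f : C.Hom1 A B) : F :=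
  pairing f f (𝟙 f : Hom2 f f) (𝟙 f : Hom2 f f)

noncomputable def dimqObj (C : TwoCatData.{u, v₀, v₁, v₂} F) [IsSpherical C] [IsVectLinear C]
    (A : C.Obj) : F :=
  dimq (Hom1.id C A)

/-- Non-degeneracy of the pairing. -/
class IsNondegenerate (C : TwoCatData.{u, v₀, v₁, v₂} F) [IsSpherical C] [IsVectLinear C] :
    Prop where
  nondegenerate : ∀ (A B : C.Obj) (f g : C.Hom1 A B), (pairing f g).Nondegenerate

instance isPerfPair_pairing [IsNondegenerate C] (f g : C.Hom1 A B) : (pairing f g).IsPerfPair :=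
  have h := IsNondegenerate.nondegenerate A B f g
  LinearMap.IsPerfPair.of_injective
    (LinearMap.ker_eq_bot.1 (LinearMap.separatingLeft_iff_ker_eq_bot.1 h.1))
    (LinearMap.ker_eq_bot.1 (LinearMap.separatingRight_iff_flip_ker_eq_bot.1 h.2))

end Pairing

/-! ### Bases of simple 1-morphisms and of simple objects -/

section Bases

variable {F : Type u} [Field F] {C : TwoCatData.{u, v₀, v₁, v₂} F} [IsLinear C]

/-- A basis of `Hom(A, B)`: simple 1-morphisms representing each isomorphism class of simple
1-morphisms exactly once. -/
structure IsMorphismBasis {A B : C.Obj} (S : Finset (C.Hom1 A B)) : Prop where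
  simple : ∀ f ∈ S, Simple f
  eq_of_iso : ∀ f ∈ S, ∀ g ∈ S, Nonempty (f ≅ g) → f = g
  exists_iso : ∀ f : C.Hom1 A B, Simple f → ∃ g ∈ S, Nonempty (f ≅ g)

variable (C)

/-- `End(A) ≠ 0`. -/
def IsNonzeroObject (A : C.Obj) : Prop := ∃ (f g : C.Hom1 A A) (α : Hom2 f g), α ≠ 0

/-- `A` and `B` are equivalent in the 2-category. -/
def AreEquivalent (A B : C.Obj) : Prop :=
  ∃ (f : C.Hom1 A B) (g : C.Hom1 B A),
    Nonempty (f.comp g ≅ Hom1.id C A) ∧ Nonempty (g.comp f ≅ Hom1.id C B)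

/-- The composition functors `⨁_{X ∈ E} Hom(A, X) ⊗ Hom(X, B) → Hom(A, B)` are equivalences, where
`E` is a finite set of mutually non-equivalent non-zero objects.  The category on the left is the
additive category generated by the pairs `f ⊗ g` (`f : A → X`, `g : X → B`), the space of morphisms
from `f ⊗ g` to `f' ⊗ g'` being `2Hom(f, f') ⊗ 2Hom(g, g')` if both pairs belong to the same `X`,
and zero otherwise. -/
structure IsObjectBasis (E : Finset C.Obj) : Prop where
  nonzero : ∀ X ∈ E, C.IsNonzeroObject X
  eq_of_equivalent : ∀ X ∈ E, ∀ Y ∈ E, C.AreEquivalent X Y → X = Y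
  /-- full faithfulness on morphisms between pairs with the same middle object -/
  bijective : ∀ X ∈ E, ∀ (A B : C.Obj) (f f' : C.Hom1 A X) (g g' : C.Hom1 X B),
    Function.Bijective (TensorProduct.lift (Hom2.hcompₗ f f' g g'))
  /-- full faithfulness on morphisms between pairs with different middle objects -/
  eq_zero : ∀ X ∈ E, ∀ Y ∈ E, X ≠ Y → ∀ (A B : C.Obj) (f : C.Hom1 A X) (g : C.Hom1 X B)
    (f' : C.Hom1 A Y) (g' : C.Hom1 Y B) (α : Hom2 (f.comp g) (f'.comp g')), α = 0
  /-- essential surjectivity: every 1-morphism is a finite direct sum of composites -/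
  exists_sum : ∀ (A B : C.Obj) (h : C.Hom1 A B), ∃ (n : ℕ) (X : Fin n → C.Obj)
    (f : ∀ k, C.Hom1 A (X k)) (g : ∀ k, C.Hom1 (X k) B)
    (b : Limits.Bicone fun k => (f k).comp (g k)),
    (∀ k, X k ∈ E) ∧ Nonempty b.IsBilimit ∧ Nonempty (b.pt ≅ h)

end Bases

/-! ### State spaces and partition functions -/

section StateSpaces

open IsStrictTwoCategory IsSemistrictMonoidal HasDuals IsLinear

variable {F : Type u} [Field F] {C : TwoCatData.{u, v₀, v₁, v₂} F}

attribute [local simp] Hom1.src_eq Hom1.tgt_eq Hom2.dom_eq Hom2.cod_eq src_cod tgt_cod src_id₁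
  tgt_id₁ src_comp tgt_comp dom_id₂ cod_id₂ dom_vcomp cod_vcomp dom_hcomp cod_hcomp
  src_tl tgt_tl dom_tl cod_tl src_tr tgt_tr dom_tr cod_tr dom_add cod_add dom_smul cod_smul
  dom_zero cod_zero comp_assoc dom_d₂ cod_d₂ dom_tau cod_tau tl_comp tr_comp tl₁_tl₁ tl₁_tr₁
  tr₁_tr₁ tensor_assoc

section Labels

variable [IsSemistrictMonoidal C] {e₁₂ e₁₃ e₁₄ e₂₃ e₂₄ e₃₄ : C.Obj}

/-- `f_{(123)4} = f₁₃₄ (e₃₄ ⊗ f₁₂₃)`, for a labelled tetrahedron with vertices `1 < 2 < 3 < 4`. -/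
def leftMor (f₁₂₃ : C.Hom1 e₁₃ (e₂₃ ⊗₀ e₁₂)) (f₁₃₄ : C.Hom1 e₁₄ (e₃₄ ⊗₀ e₁₃)) :
    C.Hom1 e₁₄ (e₃₄ ⊗₀ e₂₃ ⊗₀ e₁₂) :=
  f₁₃₄.comp (f₁₂₃.tl e₃₄)

/-- `f_{1(234)} = f₁₂₄ (f₂₃₄ ⊗ e₁₂)`. -/
def rightMor (f₁₂₄ : C.Hom1 e₁₄ (e₂₄ ⊗₀ e₁₂)) (f₂₃₄ : C.Hom1 e₂₄ (e₃₄ ⊗₀ e₂₃)) :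
    C.Hom1 e₁₄ (e₃₄ ⊗₀ e₂₃ ⊗₀ e₁₂) :=
  (f₁₂₄.comp (f₂₃₄.tr e₁₂)).retarget (tensor_assoc _ _ _)

/-- The state space `2H(1234) = 2Hom(f_{(123)4}, f_{1(234)})`. -/
abbrev StateSpace (f₁₂₃ : C.Hom1 e₁₃ (e₂₃ ⊗₀ e₁₂)) (f₁₂₄ : C.Hom1 e₁₄ (e₂₄ ⊗₀ e₁₂))
    (f₁₃₄ : C.Hom1 e₁₄ (e₃₄ ⊗₀ e₁₃)) (f₂₃₄ : C.Hom1 e₂₄ (e₃₄ ⊗₀ e₂₃)) : Type v₂ :=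
  Hom2 (leftMor f₁₂₃ f₁₃₄) (rightMor f₁₂₄ f₂₃₄)

/-- The space `2Hom(f_{1(234)}, f_{(123)4})`, dual to `2H(1234)` by means of the pairing. -/
abbrev DualStateSpace (f₁₂₃ : C.Hom1 e₁₃ (e₂₃ ⊗₀ e₁₂)) (f₁₂₄ : C.Hom1 e₁₄ (e₂₄ ⊗₀ e₁₂))
    (f₁₃₄ : C.Hom1 e₁₄ (e₃₄ ⊗₀ e₁₃)) (f₂₃₄ : C.Hom1 e₂₄ (e₃₄ ⊗₀ e₂₃)) : Type v₂ :=
  Hom2 (rightMor f₁₂₄ f₂₃₄) (leftMor f₁₂₃ f₁₃₄)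

end Labels

/-! For a labelled 4-simplex with vertices `0 < 1 < 2 < 3 < 4`: the composites of the labels
corresponding to its triangulated 2-dimensional pictures, and the gluings of 2-morphisms. -/

section FourSimplex

variable {e₀₁ e₀₂ e₀₃ e₀₄ e₁₂ e₁₃ e₁₄ e₂₃ e₂₄ e₃₄ : C.Obj}
  (f₀₁₂ : C.Hom1 e₀₂ (e₁₂ ⊗₀ e₀₁)) (f₀₁₃ : C.Hom1 e₀₃ (e₁₃ ⊗₀ e₀₁))
  (f₀₁₄ : C.Hom1 e₀₄ (e₁₄ ⊗₀ e₀₁)) (f₀₂₃ : C.Hom1 e₀₃ (e₂₃ ⊗₀ e₀₂))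
  (f₀₂₄ : C.Hom1 e₀₄ (e₂₄ ⊗₀ e₀₂)) (f₀₃₄ : C.Hom1 e₀₄ (e₃₄ ⊗₀ e₀₃))
  (f₁₂₃ : C.Hom1 e₁₃ (e₂₃ ⊗₀ e₁₂)) (f₁₂₄ : C.Hom1 e₁₄ (e₂₄ ⊗₀ e₁₂))
  (f₁₃₄ : C.Hom1 e₁₄ (e₃₄ ⊗₀ e₁₃)) (f₂₃₄ : C.Hom1 e₂₄ (e₃₄ ⊗₀ e₂₃))

section Composites

variable [IsSemistrictMonoidal C]

/-- `f_{((012)3)4} = f₀₃₄ (e₃₄ ⊗ f₀₂₃) (e₃₄ ⊗ e₂₃ ⊗ f₀₁₂)` -/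
def leftMor₄ : C.Hom1 e₀₄ (e₃₄ ⊗₀ e₂₃ ⊗₀ e₁₂ ⊗₀ e₀₁) :=
  (leftMor f₀₂₃ f₀₃₄).comp ((f₀₁₂.tl e₂₃).tl e₃₄)

/-- `f_{0(1(234))} = f₀₁₄ (f₁₂₄ ⊗ e₀₁) (f₂₃₄ ⊗ e₁₂ ⊗ e₀₁)` -/
def rightMor₄ : C.Hom1 e₀₄ (e₃₄ ⊗₀ e₂₃ ⊗₀ e₁₂ ⊗₀ e₀₁) :=
  ((rightMor f₀₁₄ f₁₂₄).comp (f₂₃₄.tr (e₁₂ ⊗₀ e₀₁))).retarget (tensor_assoc _ _ _)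

/-- `f₀₂₄ (e₂₄ ⊗ f₀₁₂) (f₂₃₄ ⊗ e₁₂ ⊗ e₀₁)` -/
def midMor : C.Hom1 e₀₄ (e₃₄ ⊗₀ e₂₃ ⊗₀ e₁₂ ⊗₀ e₀₁) :=
  ((leftMor f₀₁₂ f₀₂₄).comp (f₂₃₄.tr (e₁₂ ⊗₀ e₀₁))).retarget (tensor_assoc _ _ _)

/-- `f₀₃₄ (e₃₄ ⊗ f₀₁₃) (e₃₄ ⊗ f₁₂₃ ⊗ e₀₁)` -/
def midMor₁ : C.Hom1 e₀₄ (e₃₄ ⊗₀ e₂₃ ⊗₀ e₁₂ ⊗₀ e₀₁) :=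
  ((leftMor f₀₁₃ f₀₃₄).comp ((f₁₂₃.tr e₀₁).tl e₃₄)).retarget (by rw [tensor_assoc])

/-- `f₀₁₄ (f₁₃₄ ⊗ e₀₁) (e₃₄ ⊗ f₁₂₃ ⊗ e₀₁)` -/
def midMor₂ : C.Hom1 e₀₄ (e₃₄ ⊗₀ e₂₃ ⊗₀ e₁₂ ⊗₀ e₀₁) :=
  ((rightMor f₀₁₄ f₁₃₄).comp ((f₁₂₃.tr e₀₁).tl e₃₄)).retarget (by rw [tensor_assoc])

end Composites

section Glue

variable [IsLinear C]

attribute [local simp] leftMor₄ rightMor₄ midMor midMor₁ midMor₂ leftMor rightMor Hom1.comp Hom1.tl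
  Hom1.tr Hom1.retarget

attribute [local simp] tl_add tr_add add_hcomp hcomp_add add_vcomp vcomp_add tl_smul tr_smul
  smul_hcomp hcomp_smul smul_vcomp vcomp_smul

/-- `β ↦ (β ∘ (e₃₄ ⊗ e₂₃ ⊗ f₀₁₂)) · (f₀₂₄ ∘ ⊗_{f₂₃₄, f₀₁₂})` -/
def glueβ : StateSpace f₀₂₃ f₀₂₄ f₀₃₄ f₂₃₄ →ₗ[F]
    Hom2 (leftMor₄ f₀₁₂ f₀₂₃ f₀₃₄) (midMor f₀₁₂ f₀₂₄ f₂₃₄) :=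
  Hom2.map (fun β => (β ⊙ₕ 𝟙₂ (e₃₄ ⊲₁ e₂₃ ⊲₁ f₀₁₂.1)) ⊙ᵥ (𝟙₂ f₀₂₄.1 ⊙ₕ C.tau f₂₃₄.1 f₀₁₂.1))
    (fun _ => by simp (maxDischargeDepth := 12))
    (fun _ => by simp (maxDischargeDepth := 12))
    (fun _ _ => by simp (maxDischargeDepth := 12))
    (fun _ _ => by simp (maxDischargeDepth := 12))

/-- `δ ↦ δ ∘ (f₂₃₄ ⊗ e₁₂ ⊗ e₀₁)` -/
def glueδ : StateSpace f₀₁₂ f₀₁₄ f₀₂₄ f₁₂₄ →ₗ[F]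
    Hom2 (midMor f₀₁₂ f₀₂₄ f₂₃₄) (rightMor₄ f₀₁₄ f₁₂₄ f₂₃₄) :=
  Hom2.map (fun δ => δ ⊙ₕ 𝟙₂ (f₂₃₄.1 ⊳₁ (e₁₂ ⊗₀ e₀₁)))
    (fun _ => by simp (maxDischargeDepth := 12))
    (fun _ => by simp (maxDischargeDepth := 12))
    (fun _ _ => by simp (maxDischargeDepth := 12))
    (fun _ _ => by simp (maxDischargeDepth := 12))

/-- `ε ↦ f₀₃₄ ∘ (e₃₄ ⊗ ε)` -/
def glueε : StateSpace f₀₁₂ f₀₁₃ f₀₂₃ f₁₂₃ →ₗ[F]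
    Hom2 (leftMor₄ f₀₁₂ f₀₂₃ f₀₃₄) (midMor₁ f₀₁₃ f₀₃₄ f₁₂₃) :=
  Hom2.map (fun ε => 𝟙₂ f₀₃₄.1 ⊙ₕ e₃₄ ⊲₂ ε)
    (fun _ => by simp (maxDischargeDepth := 12))
    (fun _ => by simp (maxDischargeDepth := 12))
    (fun _ _ => by simp (maxDischargeDepth := 12))
    (fun _ _ => by simp (maxDischargeDepth := 12))

/-- `γ ↦ γ ∘ (e₃₄ ⊗ f₁₂₃ ⊗ e₀₁)` -/
def glueγ : StateSpace f₀₁₃ f₀₁₄ f₀₃₄ f₁₃₄ →ₗ[F]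
    Hom2 (midMor₁ f₀₁₃ f₀₃₄ f₁₂₃) (midMor₂ f₀₁₄ f₁₂₃ f₁₃₄) :=
  Hom2.map (fun γ => γ ⊙ₕ 𝟙₂ (e₃₄ ⊲₁ (f₁₂₃.1 ⊳₁ e₀₁)))
    (fun _ => by simp (maxDischargeDepth := 12))
    (fun _ => by simp (maxDischargeDepth := 12))
    (fun _ _ => by simp (maxDischargeDepth := 12))
    (fun _ _ => by simp (maxDischargeDepth := 12))

/-- `α ↦ f₀₁₄ ∘ (α ⊗ e₀₁)` -/
def glueα : StateSpace f₁₂₃ f₁₂₄ f₁₃₄ f₂₃₄ →ₗ[F]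
    Hom2 (midMor₂ f₀₁₄ f₁₂₃ f₁₃₄) (rightMor₄ f₀₁₄ f₁₂₄ f₂₃₄) :=
  Hom2.map (fun α => 𝟙₂ f₀₁₄.1 ⊙ₕ α ⊳₂ e₀₁)
    (fun _ => by simp (maxDischargeDepth := 12))
    (fun _ => by simp (maxDischargeDepth := 12))
    (fun _ _ => by simp (maxDischargeDepth := 12))
    (fun _ _ => by simp (maxDischargeDepth := 12))

/-! The corresponding gluings of 2-morphisms in the opposite directions. -/

/-- `α ↦ f₀₁₄ ∘ (α ⊗ e₀₁)` -/
def glueα' : DualStateSpace f₁₂₃ f₁₂₄ f₁₃₄ f₂₃₄ →ₗ[F]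
    Hom2 (rightMor₄ f₀₁₄ f₁₂₄ f₂₃₄) (midMor₂ f₀₁₄ f₁₂₃ f₁₃₄) :=
  Hom2.map (fun α => 𝟙₂ f₀₁₄.1 ⊙ₕ α ⊳₂ e₀₁)
    (fun _ => by simp (maxDischargeDepth := 12))
    (fun _ => by simp (maxDischargeDepth := 12))
    (fun _ _ => by simp (maxDischargeDepth := 12))
    (fun _ _ => by simp (maxDischargeDepth := 12))

/-- `γ ↦ γ ∘ (e₃₄ ⊗ f₁₂₃ ⊗ e₀₁)` -/
def glueγ' : DualStateSpace f₀₁₃ f₀₁₄ f₀₃₄ f₁₃₄ →ₗ[F]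
    Hom2 (midMor₂ f₀₁₄ f₁₂₃ f₁₃₄) (midMor₁ f₀₁₃ f₀₃₄ f₁₂₃) :=
  Hom2.map (fun γ => γ ⊙ₕ 𝟙₂ (e₃₄ ⊲₁ (f₁₂₃.1 ⊳₁ e₀₁)))
    (fun _ => by simp (maxDischargeDepth := 12))
    (fun _ => by simp (maxDischargeDepth := 12))
    (fun _ _ => by simp (maxDischargeDepth := 12))
    (fun _ _ => by simp (maxDischargeDepth := 12))

/-- `ε ↦ f₀₃₄ ∘ (e₃₄ ⊗ ε)` -/
def glueε' : DualStateSpace f₀₁₂ f₀₁₃ f₀₂₃ f₁₂₃ →ₗ[F]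
    Hom2 (midMor₁ f₀₁₃ f₀₃₄ f₁₂₃) (leftMor₄ f₀₁₂ f₀₂₃ f₀₃₄) :=
  Hom2.map (fun ε => 𝟙₂ f₀₃₄.1 ⊙ₕ e₃₄ ⊲₂ ε)
    (fun _ => by simp (maxDischargeDepth := 12))
    (fun _ => by simp (maxDischargeDepth := 12))
    (fun _ _ => by simp (maxDischargeDepth := 12))
    (fun _ _ => by simp (maxDischargeDepth := 12))

/-- `δ ↦ δ ∘ (f₂₃₄ ⊗ e₁₂ ⊗ e₀₁)` -/
def glueδ' : DualStateSpace f₀₁₂ f₀₁₄ f₀₂₄ f₁₂₄ →ₗ[F]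
    Hom2 (rightMor₄ f₀₁₄ f₁₂₄ f₂₃₄) (midMor f₀₁₂ f₀₂₄ f₂₃₄) :=
  Hom2.map (fun δ => δ ⊙ₕ 𝟙₂ (f₂₃₄.1 ⊳₁ (e₁₂ ⊗₀ e₀₁)))
    (fun _ => by simp (maxDischargeDepth := 12))
    (fun _ => by simp (maxDischargeDepth := 12))
    (fun _ _ => by simp (maxDischargeDepth := 12))
    (fun _ _ => by simp (maxDischargeDepth := 12))

variable [HasDuals C]

/-- `β' ↦ (f₀₂₄ ∘ ⊗_{f₂₃₄, f₀₁₂}⁻¹) · (β' ∘ (e₃₄ ⊗ e₂₃ ⊗ f₀₁₂))` -/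
def glueβ' : DualStateSpace f₀₂₃ f₀₂₄ f₀₃₄ f₂₃₄ →ₗ[F]
    Hom2 (midMor f₀₁₂ f₀₂₄ f₂₃₄) (leftMor₄ f₀₁₂ f₀₂₃ f₀₃₄) :=
  Hom2.map (fun β => (𝟙₂ f₀₂₄.1 ⊙ₕ (C.tau f₂₃₄.1 f₀₁₂.1)⋆₂) ⊙ᵥ (β ⊙ₕ 𝟙₂ (e₃₄ ⊲₁ e₂₃ ⊲₁ f₀₁₂.1)))
    (fun _ => by simp (maxDischargeDepth := 12))
    (fun _ => by simp (maxDischargeDepth := 12))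
    (fun _ _ => by simp (maxDischargeDepth := 12))
    (fun _ _ => by simp (maxDischargeDepth := 12))

end Glue

section Compose

variable [HasDuals C] [IsLinear C]

/-- `β ⊗ δ ↦ βδ` -/
noncomputable def betaDelta :
    StateSpace f₀₂₃ f₀₂₄ f₀₃₄ f₂₃₄ ⊗[F] StateSpace f₀₁₂ f₀₁₄ f₀₂₄ f₁₂₄ →ₗ[F]
    Hom2 (leftMor₄ f₀₁₂ f₀₂₃ f₀₃₄) (rightMor₄ f₀₁₄ f₁₂₄ f₂₃₄) :=
  TensorProduct.lift ((Hom2.vcompₗ _ (midMor f₀₁₂ f₀₂₄ f₂₃₄) _).compl₁₂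
    (glueβ f₀₁₂ f₀₂₃ f₀₂₄ f₀₃₄ f₂₃₄) (glueδ f₀₁₂ f₀₁₄ f₀₂₄ f₁₂₄ f₂₃₄))

/-- `β' ⊗ δ' ↦ δ'β'` -/
noncomputable def deltaBeta :
    DualStateSpace f₀₂₃ f₀₂₄ f₀₃₄ f₂₃₄ ⊗[F] DualStateSpace f₀₁₂ f₀₁₄ f₀₂₄ f₁₂₄ →ₗ[F]
    Hom2 (rightMor₄ f₀₁₄ f₁₂₄ f₂₃₄) (leftMor₄ f₀₁₂ f₀₂₃ f₀₃₄) :=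
  TensorProduct.lift ((Hom2.vcompₗ _ (midMor f₀₁₂ f₀₂₄ f₂₃₄) _).compl₁₂
    (glueδ' f₀₁₂ f₀₁₄ f₀₂₄ f₁₂₄ f₂₃₄) (glueβ' f₀₁₂ f₀₂₃ f₀₂₄ f₀₃₄ f₂₃₄)).flip

/-- `α' ⊗ γ' ⊗ ε' ↦ α'γ'ε'` -/
noncomputable def alphaGammaEps :
    DualStateSpace f₁₂₃ f₁₂₄ f₁₃₄ f₂₃₄ ⊗[F]
      (DualStateSpace f₀₁₃ f₀₁₄ f₀₃₄ f₁₃₄ ⊗[F] DualStateSpace f₀₁₂ f₀₁₃ f₀₂₃ f₁₂₃) →ₗ[F]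
    Hom2 (rightMor₄ f₀₁₄ f₁₂₄ f₂₃₄) (leftMor₄ f₀₁₂ f₀₂₃ f₀₃₄) :=
  TensorProduct.lift ((Hom2.vcompₗ _ (midMor₂ f₀₁₄ f₁₂₃ f₁₃₄) _).compl₁₂
    (glueα' f₀₁₄ f₁₂₃ f₁₂₄ f₁₃₄ f₂₃₄)
    (TensorProduct.lift ((Hom2.vcompₗ _ (midMor₁ f₀₁₃ f₀₃₄ f₁₂₃) _).compl₁₂
      (glueγ' f₀₁₃ f₀₁₄ f₀₃₄ f₁₂₃ f₁₃₄) (glueε' f₀₁₂ f₀₁₃ f₀₂₃ f₀₃₄ f₁₂₃))))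

/-- `α ⊗ γ ⊗ ε ↦ εγα` -/
noncomputable def epsGammaAlpha :
    StateSpace f₁₂₃ f₁₂₄ f₁₃₄ f₂₃₄ ⊗[F]
      (StateSpace f₀₁₃ f₀₁₄ f₀₃₄ f₁₃₄ ⊗[F] StateSpace f₀₁₂ f₀₁₃ f₀₂₃ f₁₂₃) →ₗ[F]
    Hom2 (leftMor₄ f₀₁₂ f₀₂₃ f₀₃₄) (rightMor₄ f₀₁₄ f₁₂₄ f₂₃₄) :=
  TensorProduct.lift ((Hom2.vcompₗ _ (midMor₂ f₀₁₄ f₁₂₃ f₁₃₄) _).compl₁₂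
    (TensorProduct.lift ((Hom2.vcompₗ _ (midMor₁ f₀₁₃ f₀₃₄ f₁₂₃) _).compl₁₂
      (glueε f₀₁₂ f₀₁₃ f₀₂₃ f₀₃₄ f₁₂₃) (glueγ f₀₁₃ f₀₁₄ f₀₃₄ f₁₂₃ f₁₃₄)).flip)
    (glueα f₀₁₄ f₁₂₃ f₁₂₄ f₁₃₄ f₂₃₄)).flip

end Compose

section PartitionFunctions

variable [IsSpherical C] [IsVectLinear C] [IsNondegenerate C]

/-- `2Hom(f, g) = 2Hom(g, f)*`, by means of the pairing. -/
noncomputable def pairingEquiv {A B : C.Obj} (f g : C.Hom1 A B) :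
    Hom2 f g ≃ₗ[F] Module.Dual F (Hom2 g f) :=
  (pairing f g).toPerfPair

/-- The partition function `Z(+(01234))`, characterised by
`⟨βδ, α'γ'ε'⟩ = (⟨ , ⟩ ⊗ ⟨ , ⟩ ⊗ ⟨ , ⟩) (Z(+(01234)) (β ⊗ δ), α' ⊗ γ' ⊗ ε')`. -/
noncomputable def Zplus : StateSpace f₀₂₃ f₀₂₄ f₀₃₄ f₂₃₄ ⊗[F] StateSpace f₀₁₂ f₀₁₄ f₀₂₄ f₁₂₄ →ₗ[F]
    StateSpace f₁₂₃ f₁₂₄ f₁₃₄ f₂₃₄ ⊗[F]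
      (StateSpace f₀₁₃ f₀₁₄ f₀₃₄ f₁₃₄ ⊗[F] StateSpace f₀₁₂ f₀₁₃ f₀₂₃ f₁₂₃) :=
  (TensorProduct.congr (pairingEquiv _ _)
        (TensorProduct.congr (pairingEquiv _ _) (pairingEquiv _ _) ≪≫ₗ
          TensorProduct.dualDistribEquiv F _ _) ≪≫ₗ
      TensorProduct.dualDistribEquiv F _ _).symm.toLinearMap ∘ₗ
    (alphaGammaEps f₀₁₂ f₀₁₃ f₀₁₄ f₀₂₃ f₀₃₄ f₁₂₃ f₁₂₄ f₁₃₄ f₂₃₄).dualMap ∘ₗ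
    pairing _ _ ∘ₗ betaDelta f₀₁₂ f₀₁₄ f₀₂₃ f₀₂₄ f₀₃₄ f₁₂₄ f₂₃₄

/-- The partition function `Z(-(01234))`, characterised by
`⟨δ'β', εγα⟩ = (⟨ , ⟩ ⊗ ⟨ , ⟩) (Z(-(01234)) (α ⊗ γ ⊗ ε), β' ⊗ δ')`. -/
noncomputable def Zminus :
    StateSpace f₁₂₃ f₁₂₄ f₁₃₄ f₂₃₄ ⊗[F]
      (StateSpace f₀₁₃ f₀₁₄ f₀₃₄ f₁₃₄ ⊗[F] StateSpace f₀₁₂ f₀₁₃ f₀₂₃ f₁₂₃) →ₗ[F]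
    StateSpace f₀₂₃ f₀₂₄ f₀₃₄ f₂₃₄ ⊗[F] StateSpace f₀₁₂ f₀₁₄ f₀₂₄ f₁₂₄ :=
  (TensorProduct.congr (pairingEquiv _ _) (pairingEquiv _ _) ≪≫ₗ
      TensorProduct.dualDistribEquiv F _ _).symm.toLinearMap ∘ₗ
    (deltaBeta f₀₁₂ f₀₁₄ f₀₂₃ f₀₂₄ f₀₃₄ f₁₂₄ f₂₃₄).dualMap ∘ₗ
    (pairing _ _).flip ∘ₗ epsGammaAlpha f₀₁₂ f₀₁₃ f₀₁₄ f₀₂₃ f₀₃₄ f₁₂₃ f₁₂₄ f₁₃₄ f₂₃₄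

end PartitionFunctions

end FourSimplex

end StateSpaces

end TwoCatData

/-! Let `H` be the space of 2-morphisms from `leftMor₄` to `rightMor₄`, the two extreme composites
of the labelled 4-simplex, paired with the space of 2-morphisms in the opposite direction. Gluing
gives two families of maps into `H`: `betaDelta`, indexed by the label `f₀₂₄`, and `epsGammaAlpha`,
indexed by `(e₁₃, f₀₁₃, f₁₂₃, f₁₃₄)`. Each family exhibits `H` as an orthogonal direct sum of tensor
products of state spaces. The pairing on `H` restricts to zero between blocks with different labels,
and on one block it is the product of the pairings of the state spaces divided by the weight of the
label: `dimq f₀₂₄` in one case, `dim(e₁₃)⁻¹ dim(f₀₁₃) dim(f₁₂₃) dim(f₁₃₄)` in the other. The blocks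
together span `H`. Let `componentMinus` and `componentPlus` be the adjoints of the opposite gluings
with respect to the pairings. Then `Z(+)` is `betaDelta` followed by `componentPlus`, and `Z(-)` is
`epsGammaAlpha` followed by `componentMinus`. Each orthogonality relation inserts the resolution of
the identity of `H` for one decomposition between gluing and component for the other. The linear
algebra is `sum_comp_dualComponent` and `smul_dualComponent_comp`. The evaluation of the pairings
rests on two facts. First, the trace is cyclic (`loop_cyclic`) and may be taken in stages
(`closureCell_ptr`), and partial traces pass through the tensorator (`ptr_tau`); this needs only the
duality structure. Second, there is a Schur lemma one level up. For a simple object `X`, every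
1-endomorphism of `X` is generated by `1_X` (`IsObjectBasis.generatedBy_id`). Hence, for basis
1-morphisms `p, q : X → D`, the composite `p q*` vanishes when `p ≠ q`, and the identity of `p p*`
is a multiple of counit followed by unit (`id_comp_dual_self`). Consequently a 2-morphism between
composites ending in `L ⊗ p ⊗ R` is a whiskering (`exists_whiskering`), so such composites are again
simple and their traces factor. Spanning is obtained by writing identities as sums of 2-morphisms
through simple 1-morphisms: for `βδ` after bending `f₂₃₄` around by duality, for `εγα` at the source
and at the target of the given 2-morphism. -/

set_option linter.unusedSimpArgs false
set_option linter.unusedSectionVars false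

/-! ### Semisimplicity of 2-vector spaces -/

section Generation

variable (F : Type u) [Field F] {V : Type v₁} [Category.{v₂} V] [Preadditive V] [Linear F V]

/-- The identity of `h` is a linear combination of 2-morphisms factoring through objects of `S`. -/
def GeneratedBy (S : Set V) (h : V) : Prop :=
  𝟙 h ∈ Submodule.span F {φ : h ⟶ h | ∃ s ∈ S, ∃ (a : h ⟶ s) (b : s ⟶ h), φ = a ≫ b}

variable {F}

theorem GeneratedBy.mono {S T : Set V} {h : V} (H : GeneratedBy F S h) (hST : S ⊆ T) :
    GeneratedBy F T h :=
  Submodule.span_mono (by rintro φ ⟨s, hs, hφ⟩; exact ⟨s, hST hs, hφ⟩) H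

theorem GeneratedBy.mem_span {S : Set V} {h : V} (H : GeneratedBy F S h) {x y : V}
    (α : x ⟶ h) (β : h ⟶ y) :
    α ≫ β ∈ Submodule.span F {φ : x ⟶ y | ∃ s ∈ S, ∃ (a : x ⟶ s) (b : s ⟶ y), φ = a ≫ b} := by
  let L : (h ⟶ h) →ₗ[F] (x ⟶ y) := Linear.leftComp F y α ∘ₗ Linear.rightComp F h β
  have hL : ∀ φ, L φ = α ≫ φ ≫ β := fun φ => rfl
  have h1 := Submodule.mem_map_of_mem (f := L) H
  rw [hL, Category.id_comp] at h1
  refine Submodule.span_mono ?_ (Submodule.map_span L _ ▸ h1)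
  rintro _ ⟨_, ⟨s, hs, a, b, rfl⟩, rfl⟩
  exact ⟨s, hs, α ≫ a, b ≫ β, by simp [hL]⟩

/-- Inserting the decomposition of each `s` in the middle of a factorization through `s` refines it
to factorizations through `T`. -/
theorem GeneratedBy.trans {S T : Set V} {h : V} (H : GeneratedBy F S h)
    (hST : ∀ s ∈ S, GeneratedBy F T s) : GeneratedBy F T h := by
  unfold GeneratedBy at H
  refine Submodule.span_le.2 ?_ H
  rintro _ ⟨s, hs, a, b, rfl⟩
  exact (hST s hs).mem_span a b

/-- If `h` is generated by `S`, a non-zero `h ⟶ y` remains non-zero after precomposition with some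
`s ⟶ h`. -/
theorem GeneratedBy.exists_comp_ne_zero {S : Set V} {h y : V} (H : GeneratedBy F S h)
    {α : h ⟶ y} (hα : α ≠ 0) : ∃ s ∈ S, ∃ (_ : h ⟶ s) (b : s ⟶ h), b ≫ α ≠ 0 := by
  by_contra! hc
  apply hα
  have : ∀ φ ∈ Submodule.span F
      {φ : h ⟶ h | ∃ s ∈ S, ∃ (a : h ⟶ s) (b : s ⟶ h), φ = a ≫ b}, φ ≫ α = 0 := by
    intro φ hφ
    induction hφ using Submodule.span_induction with
    | mem φ hφ =>
      obtain ⟨s, hs, a, b, rfl⟩ := hφ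
      rw [Category.assoc, hc s hs a b, Limits.comp_zero]
    | zero => simp
    | add φ ψ _ _ h1 h2 => simp [h1, h2]
    | smul c φ _ h1 => simp [h1]
  simpa using this _ H

variable (F) in
/-- A family of mutually non-isomorphic objects with endomorphism field `F` which generates. -/
structure IsSimpleFamily {ι : Type*} (s : ι → V) : Prop where
  scalar : ∀ k (α : s k ⟶ s k), ∃ c : F, α = c • 𝟙 (s k)
  id_ne_zero : ∀ k, 𝟙 (s k) ≠ 0
  eq_zero : ∀ k l, k ≠ l → ∀ α : s k ⟶ s l, α = 0
  generates : ∀ h, GeneratedBy F (Set.range s) h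

namespace IsSimpleFamily

variable {ι : Type*} {s : ι → V} (hs : IsSimpleFamily F s)

include hs

/-- A non-zero mono `m` into `s k` stays non-zero after some `s l ⟶ t`. Then `l = k` and the
composite is an invertible scalar, so `m` is a split epimorphism as well as a mono. -/
theorem simple (k : ι) : Simple (s k) where
  mono_isIso_iff_nonzero {t} m _ := by
    refine ⟨fun hm h0 => hs.id_ne_zero k ?_, fun hm => ?_⟩
    · rw [← IsIso.inv_hom_id m]
      exact (congrArg (inv m ≫ ·) h0).trans Limits.comp_zero
    · obtain ⟨_, ⟨l, rfl⟩, -, b, hb⟩ := (hs.generates t).exists_comp_ne_zero hm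
      obtain rfl : l = k := by
        by_contra hne
        exact hb (hs.eq_zero l k hne _)
      obtain ⟨c, hc⟩ := hs.scalar l (b ≫ m)
      have hc0 : c ≠ 0 := by
        rintro rfl
        exact hb (by rw [hc, zero_smul])
      have : IsSplitEpi m := ⟨⟨⟨c⁻¹ • b, by
        rw [Linear.smul_comp, hc, smul_smul, inv_mul_cancel₀ hc0, one_smul]⟩⟩⟩
      exact isIso_of_mono_of_isSplitEpi m

/-- Some `b : s k ⟶ f` is non-zero because `𝟙 f` is. It is mono: a non-zero `x` with `x ≫ b = 0`
could be tested on some `s l`, which would give a non-zero scalar annihilating `b`. Simplicity of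
`f` makes `b` invertible. -/
theorem iso_of_simple (f : V) [Simple f] : ∃ k, Nonempty (s k ≅ f) := by
  obtain ⟨_, ⟨k, rfl⟩, -, b, hb⟩ := (hs.generates f).exists_comp_ne_zero (id_nonzero f)
  rw [Category.comp_id] at hb
  have : Mono b := Preadditive.mono_of_cancel_zero _ fun {t} x hx => by
    by_contra hx0
    obtain ⟨_, ⟨l, rfl⟩, -, b', hbx⟩ := (hs.generates t).exists_comp_ne_zero hx0
    obtain rfl : l = k := by
      by_contra hne
      exact hbx (hs.eq_zero l k hne _)
    obtain ⟨c, hc⟩ := hs.scalar l (b' ≫ x)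
    have h0 : c • b = 0 := by
      have : (b' ≫ x) ≫ b = 0 := by rw [Category.assoc, hx, Limits.comp_zero]
      rwa [hc, Linear.smul_comp, Category.id_comp] at this
    rcases smul_eq_zero.1 h0 with rfl | h
    · exact hbx (by rw [hc, zero_smul])
    · exact hb h
  have := (Simple.mono_isIso_iff_nonzero b).2 hb
  exact ⟨k, ⟨asIso b⟩⟩

/-- Schur's lemma over an arbitrary field: scalarity is inherited from the isomorphic member of the
family, so no algebraic closure is needed. -/
theorem exists_scalar (f : V) [Simple f] (α : f ⟶ f) : ∃ c : F, α = c • 𝟙 f := by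
  obtain ⟨k, ⟨e⟩⟩ := hs.iso_of_simple f
  obtain ⟨c, hc⟩ := hs.scalar k (e.hom ≫ α ≫ e.inv)
  refine ⟨c, ?_⟩
  have : e.inv ≫ (e.hom ≫ α ≫ e.inv) ≫ e.hom = α := by simp
  rw [← this, hc]
  simp

theorem nonempty_iso (f g : V) [Simple f] [Simple g] {α : f ⟶ g} (hα : α ≠ 0) :
    Nonempty (f ≅ g) := by
  obtain ⟨k, ⟨e⟩⟩ := hs.iso_of_simple f
  obtain ⟨l, ⟨e'⟩⟩ := hs.iso_of_simple g
  obtain rfl : k = l := by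
    by_contra hne
    have h := hs.eq_zero k l hne (e.hom ≫ α ≫ e'.inv)
    apply hα
    have h' : e.inv ≫ (e.hom ≫ α ≫ e'.inv) ≫ e'.hom = α := by simp
    rw [← h', h]
    simp
  exact ⟨e.symm ≪≫ e'⟩

theorem generatedBy {S : Set V} (hS : ∀ f : V, Simple f → ∃ g ∈ S, Nonempty (f ≅ g)) (h : V) :
    GeneratedBy F S h := by
  refine (hs.generates h).trans ?_
  rintro _ ⟨k, rfl⟩
  obtain ⟨g, hg, ⟨e⟩⟩ := hS _ (hs.simple k)
  exact Submodule.subset_span ⟨g, hg, e.hom, e.inv, by simp⟩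

end IsSimpleFamily

end Generation

/-! ### Simple families in `2`-vector spaces -/

section TwoVectorSpace

variable {F : Type u} [Field F] {n : ℕ}

variable (F) in
/-- The `k`-th simple object of `Vectⁿ`. -/
def vectSimple (k : Fin n) : Fin n → FGModuleCat.{u} F :=
  fun j => FGModuleCat.of F (PLift (j = k) → F)

open Classical in
/-- The map `M ⟶ vectSimple F k` given by a linear form on `M k`. -/
noncomputable def toVectSimple (k : Fin n) (M : Fin n → FGModuleCat.{u} F)
    (φ : ∀ j, M j →ₗ[F] F) : M ⟶ vectSimple F k :=
  fun j => FGModuleCat.ofHom (LinearMap.pi fun _ : PLift (j = k) => φ j)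

open Classical in
/-- The map `vectSimple F k ⟶ M` given by an element of `M k`. -/
noncomputable def ofVectSimple (k : Fin n) (M : Fin n → FGModuleCat.{u} F)
    (v : ∀ j, M j) : vectSimple F k ⟶ M :=
  fun j => FGModuleCat.ofHom
    (∑ h : PLift (j = k), (LinearMap.toSpanSingleton F (M j) (v j)) ∘ₗ LinearMap.proj h)

/-- The space of functions on the proposition `j = k` is a line or zero according to whether it
holds; only the coordinate `k` contributes, by a rank-one map. -/
theorem toVectSimple_ofVectSimple_apply (k : Fin n) (M : Fin n → FGModuleCat.{u} F)
    (φ : ∀ j, M j →ₗ[F] F) (v : ∀ j, M j) (j : Fin n) (x : M j) :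
    ((toVectSimple k M φ ≫ ofVectSimple k M v) j).hom.hom x = if j = k then φ j x • v j else 0 := by
  classical
  have h1 : ((toVectSimple k M φ ≫ ofVectSimple k M v) j).hom.hom x =
    (∑ h : PLift (j = k), (LinearMap.toSpanSingleton F (M j) (v j)) ∘ₗ LinearMap.proj h :
      (PLift (j = k) → F) →ₗ[F] M j) (fun _ => φ j x) := rfl
  rw [h1, LinearMap.sum_apply]
  split_ifs with h
  · have : Unique (PLift (j = k)) := ⟨⟨⟨h⟩⟩, fun _ => rfl⟩
    simp
  · have : IsEmpty (PLift (j = k)) := ⟨fun t => h t.down⟩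
    simp

theorem vectSimple_scalar (k : Fin n) (α : vectSimple F k ⟶ vectSimple F k) :
    ∃ c : F, ∀ j, α j = c • 𝟙 (vectSimple F k j) := by
  let φ : ∀ j, (PLift (j = k) → F) →ₗ[F] (PLift (j = k) → F) := fun j => (α j).hom.hom
  refine ⟨φ k (fun _ => 1) ⟨rfl⟩, fun j => ?_⟩
  apply FGModuleCat.hom_ext
  apply LinearMap.ext
  intro x
  change φ j x = φ k (fun _ => 1) ⟨rfl⟩ • x
  by_cases h : j = k
  · subst h
    have hx : x = x ⟨rfl⟩ • (fun _ : PLift (j = j) => (1 : F)) := by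
      funext t
      exact (mul_one (x ⟨rfl⟩)).symm
    conv_lhs => rw [hx, map_smul]
    funext t
    change x ⟨rfl⟩ * φ j (fun _ => 1) ⟨rfl⟩ = φ j (fun _ => 1) ⟨rfl⟩ * x ⟨rfl⟩
    ring
  · funext t
    exact absurd t.down h

/-- In each coordinate `j` the source or the target is zero, since `j` cannot equal both `k` and
`l`. -/
theorem vectSimple_eq_zero {k l : Fin n} (hkl : k ≠ l) (α β : vectSimple F k ⟶ vectSimple F l) :
    α = β := by
  funext j
  apply FGModuleCat.hom_ext
  apply LinearMap.ext
  intro x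
  by_cases h : j = l
  · have h' : j ≠ k := fun t => hkl (t.symm.trans h)
    have : x = 0 := by
      funext t
      exact absurd t.down h'
    rw [this, map_zero, map_zero]
  · change PLift (j = k) → F at x
    funext t
    exact absurd t.down h

/-- Every object of `Vectⁿ` is a finite direct sum of simple ones. -/
theorem exists_sum_vectSimple (M : Fin n → FGModuleCat.{u} F) :
    ∃ (ι : Type) (_ : Fintype ι) (k : ι → Fin n) (a : ∀ i, M ⟶ vectSimple F (k i))
      (b : ∀ i, vectSimple F (k i) ⟶ M), ∀ j, ∑ i, (a i ≫ b i) j = 𝟙 (M j) := by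
  classical
  let d : Fin n → ℕ := fun j => Module.finrank F (M j)
  let B : ∀ j, Module.Basis (Fin (d j)) F (M j) := fun j => Module.finBasis F (M j)
  let φ : (Σ k, Fin (d k)) → ∀ j, M j →ₗ[F] F := fun i j =>
    if h : j = i.1 then (B j).coord (Fin.cast (by rw [h]) i.2) else 0
  let v : (Σ k, Fin (d k)) → ∀ j, M j := fun i j =>
    if h : j = i.1 then B j (Fin.cast (by rw [h]) i.2) else 0
  refine ⟨Σ k, Fin (d k), inferInstance, fun i => i.1, fun i => toVectSimple i.1 M (φ i),
    fun i => ofVectSimple i.1 M (v i), fun j => ?_⟩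
  apply FGModuleCat.hom_ext
  apply LinearMap.ext
  intro x
  have hsum : (∑ i, (toVectSimple i.1 M (φ i) ≫ ofVectSimple i.1 M (v i)) j).hom.hom x =
      ∑ i, ((toVectSimple i.1 M (φ i) ≫ ofVectSimple i.1 M (v i)) j).hom.hom x := by
    let L : (M j ⟶ M j) →+ M j :=
      { toFun := fun f => f.hom.hom x
        map_zero' := rfl
        map_add' := fun _ _ => rfl }
    exact map_sum L _ _
  rw [hsum]
  simp_rw [toVectSimple_ofVectSimple_apply]
  rw [Fintype.sum_sigma, Finset.sum_eq_single j]
  · refine Eq.trans ?_ ((B j).sum_repr x)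
    refine Finset.sum_congr rfl fun i _ => ?_
    simp [φ, v]
  · intro k _ hk
    exact Finset.sum_eq_zero fun i _ => if_neg (Ne.symm hk)
  · simp

/-- The family consists of preimages of the coordinate lines under the equivalence. Its properties
are pulled back along a faithful, full and linear functor. -/
theorem IsTwoVectorSpaceOfRank.exists_isSimpleFamily {V : Type v₁} [Category.{v₂} V]
    [Preadditive V] [Linear F V] (hV : IsTwoVectorSpaceOfRank F V n) :
    ∃ s : Fin n → V, IsSimpleFamily F s := by
  obtain ⟨E, hE, hadd, hsmul⟩ := hV
  have key : ∀ {X Y : V} {α β : X ⟶ Y}, (∀ k, E.map α k = E.map β k) → α = β :=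
    fun h => E.map_injective (funext h)
  let s : Fin n → V := fun k => E.objPreimage (vectSimple F k)
  let e : ∀ k, E.obj (s k) ≅ vectSimple F k := fun k => E.objObjPreimageIso _
  have conj : ∀ (k l) (α : s k ⟶ s l), E.map α = (e k).hom ≫ ((e k).inv ≫ E.map α ≫ (e l).hom) ≫
      (e l).inv := fun k l α => by simp
  have hzero : ∀ (X Y : V) (k : Fin n), E.map (0 : X ⟶ Y) k = 0 := fun X Y k => by
    have := hsmul X Y 0 0 k
    rwa [zero_smul, zero_smul] at this
  refine ⟨s, ⟨fun k α => ?_, fun k h0 => ?_, fun k l hkl α => ?_, fun h => ?_⟩⟩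
  · obtain ⟨c, hc⟩ := vectSimple_scalar k ((e k).inv ≫ E.map α ≫ (e k).hom)
    refine ⟨c, key fun j => ?_⟩
    rw [hsmul, conj k k α, E.map_id, Pi.comp_apply, Pi.comp_apply, hc j, Linear.smul_comp,
      Linear.comp_smul, Category.id_comp, ← Pi.comp_apply, (e k).hom_inv_id]
  · have h1 : E.map (𝟙 (s k)) k = 0 := by rw [h0, hzero]
    rw [E.map_id] at h1
    have h2 : 𝟙 (vectSimple F k) k = 0 := by
      rw [← (e k).inv_hom_id, Pi.comp_apply, ← Category.id_comp ((e k).hom k),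
        show 𝟙 (E.obj (s k) k) = 0 from h1, Limits.zero_comp, Limits.comp_zero]
    have h3 : (𝟙 (vectSimple F k) k).hom.hom (fun _ => (1 : F)) =
      (0 : vectSimple F k k ⟶ vectSimple F k k).hom.hom (fun _ => (1 : F)) := by rw [h2]
    exact one_ne_zero (congrFun h3 ⟨rfl⟩)
  · refine key fun j => ?_
    rw [hzero, conj k l α, vectSimple_eq_zero hkl (_ ≫ _ ≫ _) (fun _ => 0), Pi.comp_apply,
      Pi.comp_apply, Limits.zero_comp, Limits.comp_zero]
  -- Fullness lifts the inclusions and projections of the decomposition of `E.obj h`; faithfulness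
  -- shows that the lifted sum is `𝟙 h`.
  · obtain ⟨ι, _, k, a, b, hab⟩ := exists_sum_vectSimple (E.obj h)
    have : 𝟙 h = ∑ i, E.preimage (a i ≫ (e (k i)).inv) ≫ E.preimage ((e (k i)).hom ≫ b i) := by
      refine key fun j => ?_
      let L : (h ⟶ h) →+ (E.obj h j ⟶ E.obj h j) :=
        { toFun := fun f => E.map f j
          map_zero' := hzero _ _ _
          map_add' := fun _ _ => hadd _ _ _ _ _ }
      have hL := map_sum L
        (fun i => E.preimage (a i ≫ (e (k i)).inv) ≫ E.preimage ((e (k i)).hom ≫ b i)) Finset.univ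
      refine Eq.trans ?_ hL.symm
      rw [E.map_id, Pi.id_apply, ← hab j]
      refine Finset.sum_congr rfl fun i _ => ?_
      change _ = E.map _ j
      simp
    unfold GeneratedBy
    rw [this]
    exact Submodule.sum_mem _ fun i _ => Submodule.subset_span ⟨s (k i), ⟨_, rfl⟩, _, _, rfl⟩

end TwoVectorSpace

namespace TwoCatData

open IsStrictTwoCategory IsSemistrictMonoidal HasDuals IsLinear

/-! ### Calculus of 2-morphisms -/

section Whiskering

variable {F : Type u} {C : TwoCatData.{u, v₀, v₁, v₂} F} [IsStrictTwoCategory C]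

attribute [local simp] src_cod tgt_cod src_id₁ tgt_id₁ src_comp tgt_comp dom_id₂ cod_id₂ dom_vcomp
  cod_vcomp dom_hcomp cod_hcomp comp_assoc

theorem id_hcomp_vcomp {f : C.Mor} {α β : C.Cell} (h : C.cod α = C.dom β)
    (hf : C.tgt f = C.src (C.dom α)) :
    𝟙₂ f ⊙ₕ (α ⊙ᵥ β) = (𝟙₂ f ⊙ₕ α) ⊙ᵥ (𝟙₂ f ⊙ₕ β) := by
  have h1 : 𝟙₂ f ⊙ᵥ 𝟙₂ f = 𝟙₂ f := by simpa using id_vcomp (𝟙₂ f)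
  rw [← interchange _ _ _ _ (by simp) h (by simpa using hf), h1]

theorem vcomp_hcomp_id {g : C.Mor} {α β : C.Cell} (h : C.cod α = C.dom β)
    (hg : C.tgt (C.dom α) = C.src g) :
    (α ⊙ᵥ β) ⊙ₕ 𝟙₂ g = (α ⊙ₕ 𝟙₂ g) ⊙ᵥ (β ⊙ₕ 𝟙₂ g) := by
  have h1 : 𝟙₂ g ⊙ᵥ 𝟙₂ g = 𝟙₂ g := by simpa using id_vcomp (𝟙₂ g)
  rw [← interchange _ _ _ _ h (by simp) (by simpa using hg), h1]

/-- The exchange law of whiskerings. -/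
theorem exchange {α β : C.Cell} {f f' g g' : C.Mor} (hf : C.dom α = f) (hf' : C.cod α = f')
    (hg : C.dom β = g) (hg' : C.cod β = g') (h : C.tgt f = C.src g) :
    (α ⊙ₕ 𝟙₂ g) ⊙ᵥ (𝟙₂ f' ⊙ₕ β) = (𝟙₂ f ⊙ₕ β) ⊙ᵥ (α ⊙ₕ 𝟙₂ g') := by
  subst hf hf' hg hg'
  rw [← interchange _ _ _ _ (by simp) (by simp) (by simpa using h),
    ← interchange _ _ _ _ (by simp) (by simp) (by simpa using h), id_vcomp, id_vcomp, vcomp_id,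
    vcomp_id]

theorem id_hcomp_id_hcomp {f g : C.Mor} {α : C.Cell} (h : C.tgt f = C.src g)
    (h' : C.tgt g = C.src (C.dom α)) : 𝟙₂ f ⊙ₕ (𝟙₂ g ⊙ₕ α) = 𝟙₂ (f ≫₁ g) ⊙ₕ α := by
  rw [← hcomp_assoc _ _ _ (by simpa using h) (by simpa using h'), id₂_hcomp_id₂ _ _ h]

/-- The reassociated form of an equation of two-step composites, for rewriting inside composites
kept associated to the right. -/
theorem vcomp_vcomp_of_eq {α β γ δ ε : C.Cell} (h : α ⊙ᵥ β = γ ⊙ᵥ δ) (h1 : C.cod α = C.dom β)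
    (h2 : C.cod β = C.dom ε) (h3 : C.cod γ = C.dom δ) (h4 : C.cod δ = C.dom ε) :
    α ⊙ᵥ (β ⊙ᵥ ε) = γ ⊙ᵥ (δ ⊙ᵥ ε) := by
  rw [← vcomp_assoc _ _ _ h1 h2, h, vcomp_assoc _ _ _ h3 h4]

theorem vcomp_of_eq_id {α : C.Cell} {f : C.Mor} {β γ : C.Cell} (h : α ⊙ᵥ β = 𝟙₂ f)
    (h1 : C.cod α = C.dom β) (h2 : C.cod β = C.dom γ) (h3 : C.dom γ = f) :
    α ⊙ᵥ (β ⊙ᵥ γ) = γ := by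
  subst h3
  rw [← vcomp_assoc _ _ _ h1 h2, h, id_vcomp]

theorem id_vcomp_of {α : C.Cell} {f : C.Mor} (h : C.dom α = f) : 𝟙₂ f ⊙ᵥ α = α := by
  rw [← h, id_vcomp]

theorem id_hcomp_of {α : C.Cell} {A : C.Obj} (h : C.src (C.dom α) = A) :
    𝟙₂ (C.id₁ A) ⊙ₕ α = α := by
  rw [← h, id_hcomp]

theorem hcomp_id_of {α : C.Cell} {A : C.Obj} (h : C.tgt (C.dom α) = A) :
    α ⊙ₕ 𝟙₂ (C.id₁ A) = α := by
  rw [← h, hcomp_id]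

theorem vcomp_id_of {α : C.Cell} {f : C.Mor} (h : C.cod α = f) : α ⊙ᵥ 𝟙₂ f = α := by
  rw [← h, vcomp_id]

theorem comp_id_of {f : C.Mor} {A : C.Obj} (h : C.tgt f = A) : f ≫₁ C.id₁ A = f := by
  rw [← h, comp_id]

theorem id_comp_of {f : C.Mor} {A : C.Obj} (h : C.src f = A) : C.id₁ A ≫₁ f = f := by
  rw [← h, id_comp]

end Whiskering

/-! ### Traces in stages and cyclicity -/

section Loop

variable {F : Type u} {C : TwoCatData.{u, v₀, v₁, v₂} F}

/-- The trace of a 2-endomorphism of `1_A`. -/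
def objTrace (C : TwoCatData.{u, v₀, v₁, v₂} F) (A : C.Obj) (z : C.Cell) : C.Cell :=
  C.i₁ (C.i₀ A) ⊙ᵥ (𝟙₂ (C.i₀ A) ⊙ₕ z ⊳₂ A⋆₀ ⊙ₕ 𝟙₂ (C.i₀ A)⋆₁) ⊙ᵥ (C.i₁ (C.i₀ A))⋆₂

/-- The 2-endomorphism of `1_A` obtained by closing a 2-endomorphism of `f : A → B`. -/
def loop (C : TwoCatData.{u, v₀, v₁, v₂} F) (f : C.Mor) (χ : C.Cell) : C.Cell :=
  C.i₁ f ⊙ᵥ (χ ⊙ₕ 𝟙₂ f⋆₁) ⊙ᵥ (C.i₁ f)⋆₂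

/-- The partial trace `f ⇒ g` of a 2-morphism `fv ⇒ gv`. -/
def ptr (C : TwoCatData.{u, v₀, v₁, v₂} F) (f g v : C.Mor) (χ : C.Cell) : C.Cell :=
  (𝟙₂ f ⊙ₕ C.i₁ v) ⊙ᵥ (χ ⊙ₕ 𝟙₂ v⋆₁) ⊙ᵥ (𝟙₂ g ⊙ₕ (C.i₁ v)⋆₂)

/-- The trace of a 2-endomorphism. -/
def closureCell (C : TwoCatData.{u, v₀, v₁, v₂} F) (χ : C.Cell) : C.Cell :=
  C.capR (C.dom χ) ⊙ᵥ C.trR₂ (χ ⊙ₕ 𝟙₂ (C.dom χ)⋆₁) ⊙ᵥ C.cupR (C.dom χ)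

variable [HasDuals C]

attribute [local simp] src_cod tgt_cod src_id₁ tgt_id₁ src_comp tgt_comp dom_id₂ cod_id₂ dom_vcomp
  cod_vcomp dom_hcomp cod_hcomp comp_assoc
  src_tl tgt_tl dom_tl cod_tl src_tr tgt_tr dom_tr cod_tr
  src_d₁ tgt_d₁ dom_d₂ cod_d₂ src_i₀ tgt_i₀ src_e₀ tgt_e₀ dom_i₁
  cod_i₁ dom_e₁ cod_e₁ d₀_d₀ d₁_d₁ d₂_d₂ d₁_comp d₁_tr d₁_tl d₁_id₁ d₂_id₂ e₀_d₀ tr_comp tl_comp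
  dom_tau cod_tau i₁_d₁ e₁_d₁ tl_id₁ tr_id₁ tensor_assoc tl₁_tl₁ tl₁_tr₁ tr₁_tr₁ one_tensor
  tensor_one

attribute [local simp] hcomp_assoc vcomp_assoc id_hcomp_vcomp vcomp_hcomp_id id₂_hcomp_id₂
  id_hcomp_id_hcomp tl_id₂ tr_id₂ id_vcomp_of vcomp_id_of id_hcomp_of
  hcomp_id_of

attribute [local simp] comp_id_of id_comp_of

/-- The cap of `f` is the unit of the composite `i_A (f ⊗ A*)`. Expanding it as the unit of `i_A`
followed by that of `f` separates the closing of `f` from the closing of the object `A`. -/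
theorem closureCell_eq {f : C.Mor} {χ : C.Cell} (hd : C.dom χ = f) (hc : C.cod χ = f) :
    C.closureCell χ = C.objTrace (C.src f) (C.loop f χ) := by
  subst hd
  have h : C.capR (C.dom χ) = C.i₁ (C.i₀ (C.src (C.dom χ))) ⊙ᵥ
      (𝟙₂ (C.i₀ (C.src (C.dom χ))) ⊙ₕ C.i₁ (C.dom χ) ⊳₂ (C.src (C.dom χ))⋆₀ ⊙ₕ
        𝟙₂ (C.i₀ (C.src (C.dom χ)))⋆₁) := by
    rw [capR, i₁_comp _ _ (by simp), i₁_tr]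
  simp (maxDischargeDepth := 12) [closureCell, cupR, h, objTrace, loop, trR₂, hc, d₂_vcomp,
    d₂_hcomp, tr_vcomp, tr_hcomp, d₂_tr]

theorem dom_ptr {f g v : C.Mor} {χ : C.Cell} (hd : C.dom χ = f ≫₁ v) (hc : C.cod χ = g ≫₁ v)
    (hf : C.tgt f = C.src v) (hg : C.tgt g = C.src v) : C.dom (C.ptr f g v χ) = f := by
  simp (maxDischargeDepth := 12) [ptr, hd, hc, hf, hg]

theorem cod_ptr {f g v : C.Mor} {χ : C.Cell} (hd : C.dom χ = f ≫₁ v) (hc : C.cod χ = g ≫₁ v)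
    (hf : C.tgt f = C.src v) (hg : C.tgt g = C.src v) : C.cod (C.ptr f g v χ) = g := by
  simp (maxDischargeDepth := 12) [ptr, hd, hc, hf, hg]

/-- The unit of `f v` is the unit of `f` followed by that of `v` inside, so closing `f v` means
closing `v` first and then `f`. -/
theorem loop_comp {f v : C.Mor} {χ : C.Cell} (hd : C.dom χ = f ≫₁ v) (hc : C.cod χ = f ≫₁ v)
    (hf : C.tgt f = C.src v) : C.loop (f ≫₁ v) χ = C.loop f (C.ptr f f v χ) := by
  simp (maxDischargeDepth := 12) [ptr, loop, hd, hc, hf, i₁_comp, d₂_vcomp, d₂_hcomp]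

theorem closureCell_ptr {f v : C.Mor} {χ : C.Cell} (hd : C.dom χ = f ≫₁ v)
    (hc : C.cod χ = f ≫₁ v) (hf : C.tgt f = C.src v) :
    C.closureCell (C.ptr f f v χ) = C.closureCell χ := by
  rw [closureCell_eq hd hc, closureCell_eq (dom_ptr hd hc hf hf) (cod_ptr hd hc hf hf),
    loop_comp hd hc hf, src_comp _ _ hf]

/-- 2-morphisms whiskered by `v` commute with the unit and counit that close `v`, by the exchange
law, and can be pulled out of the partial trace. -/
theorem ptr_whisker {f g v h : C.Mor} {β β' χ : C.Cell} (hβ : C.dom β = h) (hβ' : C.cod β = f)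
    (hd : C.dom χ = f ≫₁ v) (hc : C.cod χ = g ≫₁ v) (hδ : C.dom β' = g) (hδ' : C.cod β' = h)
    (hf : C.tgt f = C.src v) (hg : C.tgt g = C.src v) (hh : C.tgt h = C.src v) :
    C.ptr h h v ((β ⊙ₕ 𝟙₂ v) ⊙ᵥ χ ⊙ᵥ (β' ⊙ₕ 𝟙₂ v)) = β ⊙ᵥ C.ptr f g v χ ⊙ᵥ β' := by
  have e1 := exchange (β := C.i₁ v) hβ hβ' (dom_i₁ v) (cod_i₁ v) (by simpa using hh)
  have e2 := exchange (β := (C.i₁ v)⋆₂) hδ hδ' (by simp; rfl) (by simp; rfl) (by simp [hg])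
  simp (maxDischargeDepth := 12) [hβ, hβ', hd, hc, hδ, hδ', hf, hg, hh] at e1 e2
  simp (maxDischargeDepth := 12) [ptr, hβ, hβ', hd, hc, hδ, hδ', hf, hg, hh, e2]
  refine (vcomp_vcomp_of_eq e1 ?_ ?_ ?_ ?_).symm <;>
  simp (maxDischargeDepth := 12) [hβ, hβ', hd, hc, hδ, hδ', hf, hg, hh]

/-- Sliding `α : f ⇒ g` along the unit of the duality. -/
theorem unit_slide {f g : C.Mor} {α : C.Cell} (hα : C.dom α = f) (hα' : C.cod α = g) :
    C.i₁ f ⊙ᵥ (α ⊙ₕ 𝟙₂ f⋆₁) = C.i₁ g ⊙ᵥ (𝟙₂ g ⊙ₕ C.adj α) := by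
  have hs : C.src f = C.src g := by rw [← hα, ← hα', src_cod]
  have ht : C.tgt f = C.tgt g := by rw [← hα, ← hα', tgt_cod]
  have e1 := exchange (α := C.i₁ g) (β := C.i₁ f ⊙ᵥ (α ⊙ₕ 𝟙₂ f⋆₁)) (dom_i₁ g) (cod_i₁ g)
    (by simp [hα]; rfl) (by simp [hα, hα']; rfl) (by simp [hs])
  have e2 : (C.i₁ g ⊙ₕ 𝟙₂ g) ⊙ᵥ (𝟙₂ g ⊙ₕ C.e₁ g) = 𝟙₂ g := triangle_left g
  have e3 := congrArg (· ⊙ₕ 𝟙₂ f⋆₁) e2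
  simp (maxDischargeDepth := 12) [hα, hα', hs, ht] at e1 e3
  have e4 := congrArg (· ⊙ᵥ (𝟙₂ g ⊙ₕ C.e₁ g ⊙ₕ 𝟙₂ f⋆₁)) e1
  simp (maxDischargeDepth := 12) [hα, hα', hs, ht, e3] at e4
  simp (maxDischargeDepth := 12) [adj, hα, hα', hs, ht, e4]

theorem dom_adj {f g : C.Mor} {α : C.Cell} (hα : C.dom α = f) (hα' : C.cod α = g) :
    C.dom (C.adj α) = g⋆₁ := by
  have hs : C.src f = C.src g := by rw [← hα, ← hα', src_cod]
  have ht : C.tgt f = C.tgt g := by rw [← hα, ← hα', tgt_cod]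
  simp (maxDischargeDepth := 12) [adj, hα, hα', hs, ht]

theorem cod_adj {f g : C.Mor} {α : C.Cell} (hα : C.dom α = f) (hα' : C.cod α = g) :
    C.cod (C.adj α) = f⋆₁ := by
  have hs : C.src f = C.src g := by rw [← hα, ← hα', src_cod]
  have ht : C.tgt f = C.tgt g := by rw [← hα, ← hα', tgt_cod]
  simp (maxDischargeDepth := 12) [adj, hα, hα', hs, ht]

/-- The dual of `unit_slide` applied to `α*`; the axiom `(α†)* = (α*)†` identifies the adjoint that
appears. -/
theorem counit_slide {f g : C.Mor} {α : C.Cell} (hα : C.dom α = f) (hα' : C.cod α = g) :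
    (𝟙₂ f ⊙ₕ C.adj α) ⊙ᵥ (C.i₁ f)⋆₂ = (α ⊙ₕ 𝟙₂ g⋆₁) ⊙ᵥ (C.i₁ g)⋆₂ := by
  have hs : C.src f = C.src g := by rw [← hα, ← hα', src_cod]
  have ht : C.tgt f = C.tgt g := by rw [← hα, ← hα', tgt_cod]
  have h := congrArg (·⋆₂) (unit_slide (α := α⋆₂) ((dom_d₂ α).trans hα') ((cod_d₂ α).trans hα))
  simp (maxDischargeDepth := 12) [d₂_vcomp, d₂_hcomp, dom_adj hα hα', cod_adj hα hα',
    ← adj_d₂, hα, hα', hs,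
    ht] at h
  exact h.symm

/-- Slide `α` across the unit as `α†`, exchange `α†` with `β`, and slide it back across the counit.
Cyclicity thus holds already for 2-endomorphisms of `1_A`, before the object is closed. -/
theorem loop_cyclic {f g : C.Mor} {α β : C.Cell} (hα : C.dom α = f) (hα' : C.cod α = g)
    (hβ : C.dom β = g) (hβ' : C.cod β = f) : C.loop f (α ⊙ᵥ β) = C.loop g (β ⊙ᵥ α) := by
  have hs : C.src f = C.src g := by rw [← hα, ← hα', src_cod]
  have ht : C.tgt f = C.tgt g := by rw [← hα, ← hα', tgt_cod]
  have e1 := unit_slide hα hα'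
  have e2 := counit_slide hα hα'
  have e3 := exchange hβ hβ' (dom_adj hα hα') (cod_adj hα hα') (by simp [ht])
  have e4 := congrArg (· ⊙ᵥ (β ⊙ₕ 𝟙₂ f⋆₁) ⊙ᵥ (C.i₁ f)⋆₂) e1
  have e5 := congrArg (fun x => C.i₁ g ⊙ᵥ x ⊙ᵥ (C.i₁ f)⋆₂) e3
  have e6 := congrArg (fun x => C.i₁ g ⊙ᵥ (β ⊙ₕ 𝟙₂ g⋆₁) ⊙ᵥ x) e2
  simp (maxDischargeDepth := 12) [hα, hα', hβ, hβ', hs, ht, dom_adj hα hα', cod_adj hα hα']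
    at e4 e5 e6
  simp (maxDischargeDepth := 12) [loop, hα, hα', hβ, hβ', hs, ht, e4, ← e5, e6]

theorem closureCell_cyclic {f g : C.Mor} {α β : C.Cell} (hα : C.dom α = f) (hα' : C.cod α = g)
    (hβ : C.dom β = g) (hβ' : C.cod β = f) :
    C.closureCell (α ⊙ᵥ β) = C.closureCell (β ⊙ᵥ α) := by
  have hs : C.src f = C.src g := by rw [← hα, ← hα', src_cod]
  rw [closureCell_eq (f := f) (by simp [hα, hα', hβ]) (by simp [hα', hβ, hβ']),
    closureCell_eq (f := g) (by simp [hα, hβ', hβ]) (by simp [hα', hα, hβ']),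
    loop_cyclic hα hα' hβ hβ', hs]

end Loop
-- Duality and the tensorator
section Tensorator

variable {F : Type u} {C : TwoCatData.{u, v₀, v₁, v₂} F} [HasDuals C]

attribute [local simp] src_cod tgt_cod src_id₁ tgt_id₁ src_comp tgt_comp dom_id₂ cod_id₂ dom_vcomp
  cod_vcomp dom_hcomp cod_hcomp comp_assoc
  src_tl tgt_tl dom_tl cod_tl src_tr tgt_tr dom_tr cod_tr
  src_d₁ tgt_d₁ dom_d₂ cod_d₂ src_i₀ tgt_i₀ src_e₀ tgt_e₀ dom_i₁
  cod_i₁ dom_e₁ cod_e₁ d₀_d₀ d₁_d₁ d₂_d₂ d₁_comp d₁_tr d₁_tl d₁_id₁ d₂_id₂ e₀_d₀ tr_comp tl_comp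
  dom_tau cod_tau i₁_d₁ e₁_d₁ tl_id₁ tr_id₁ tensor_assoc tl₁_tl₁ tl₁_tr₁ tr₁_tr₁ one_tensor
  tensor_one

attribute [local simp] hcomp_assoc vcomp_assoc id_hcomp_vcomp vcomp_hcomp_id id₂_hcomp_id₂
  id_hcomp_id_hcomp tl_id₂ tr_id₂ id_vcomp_of vcomp_id_of id_hcomp_of
  hcomp_id_of

attribute [local simp] comp_id_of id_comp_of i₁_tl i₁_tr e₁_tl e₁_tr tl_vcomp tr_vcomp tl_hcomp
  tr_hcomp d₂_tl d₂_tr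

/-- Pulling the unit of a duality through the tensorator. -/
theorem tau_unit (p q : C.Mor) :
    (𝟙₂ (p ⊳₁ C.src q) ⊙ₕ C.tgt p ⊲₂ C.i₁ q) ⊙ᵥ (C.tau p q ⊙ₕ 𝟙₂ (C.tgt p ⊲₁ q⋆₁)) =
      (C.src p ⊲₂ C.i₁ q ⊙ₕ 𝟙₂ (p ⊳₁ C.src q)) ⊙ᵥ (𝟙₂ (C.src p ⊲₁ q) ⊙ₕ (C.tau p q⋆₁)⋆₂) := by
  have h1 := tau_natural_right p (C.i₁ q)
  have h2 := congrArg (𝟙₂ (C.src p ⊲₁ q) ⊙ₕ ·) (tau_unitary p q⋆₁).1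
  have h3 := congrArg (· ⊙ᵥ (𝟙₂ (C.src p ⊲₁ q) ⊙ₕ (C.tau p q⋆₁)⋆₂)) h1
  simp (maxDischargeDepth := 12) [tau_comp_right, tau_id_right] at h2 h3
  simp (maxDischargeDepth := 12) [h2] at h3
  exact h3

theorem tau_counit (p q : C.Mor) :
    ((C.tau p q)⋆₂ ⊙ₕ 𝟙₂ (C.tgt p ⊲₁ q⋆₁)) ⊙ᵥ (𝟙₂ (p ⊳₁ C.src q) ⊙ₕ C.tgt p ⊲₂ (C.i₁ q)⋆₂) =
      (𝟙₂ (C.src p ⊲₁ q) ⊙ₕ C.tau p q⋆₁) ⊙ᵥ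
        (C.src p ⊲₂ (C.i₁ q)⋆₂ ⊙ₕ 𝟙₂ (p ⊳₁ C.src q)) := by
  have h := congrArg (·⋆₂) (tau_unit p q)
  simpa (maxDischargeDepth := 12) [d₂_vcomp, d₂_hcomp] using h

/-- The unit of `q` passes through the tensorator and turns it into the inverse of `⊗_{p,q*}`; the
counit on the other side produces `⊗_{p,q*}`. Both commute past `χ` and cancel, which leaves the
partial trace of `χ` whiskered by `p`. -/
theorem ptr_tau {f f' p q : C.Mor} {χ : C.Cell} (hd : C.dom χ = f ≫₁ C.src p ⊲₁ q)
    (hc : C.cod χ = f' ≫₁ C.src p ⊲₁ q) (hf : C.tgt f = C.src p ⊗₀ C.src q)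
    (hf' : C.tgt f' = C.src p ⊗₀ C.src q) :
    C.ptr (f ≫₁ p ⊳₁ C.src q) (f' ≫₁ p ⊳₁ C.src q) (C.tgt p ⊲₁ q)
        ((𝟙₂ f ⊙ₕ C.tau p q) ⊙ᵥ (χ ⊙ₕ 𝟙₂ (p ⊳₁ C.tgt q)) ⊙ᵥ (𝟙₂ f' ⊙ₕ (C.tau p q)⋆₂)) =
      C.ptr f f' (C.src p ⊲₁ q) χ ⊙ₕ 𝟙₂ (p ⊳₁ C.src q) := by
  have h1 := congrArg (𝟙₂ f ⊙ₕ ·) (tau_unit p q)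
  have h2 := congrArg (𝟙₂ f' ⊙ₕ ·) (tau_counit p q)
  have h3 := exchange (β := (C.tau p q⋆₁)⋆₂) hd hc (by simp; rfl) (by simp; rfl) (by simp [hf])
  have h4 := congrArg (𝟙₂ (f' ≫₁ C.src p ⊲₁ q) ⊙ₕ ·) (tau_unitary p q⋆₁).2
  have h5 := congrArg (fun x => x ⊙ᵥ (χ ⊙ₕ 𝟙₂ (p ⊳₁ C.tgt q ≫₁ C.tgt p ⊲₁ q⋆₁)) ⊙ᵥ
    (𝟙₂ f' ⊙ₕ (C.tau p q)⋆₂ ⊙ₕ 𝟙₂ (C.tgt p ⊲₁ q⋆₁)) ⊙ᵥ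
    (𝟙₂ (f' ≫₁ p ⊳₁ C.src q) ⊙ₕ C.tgt p ⊲₂ (C.i₁ q)⋆₂)) h1
  simp (maxDischargeDepth := 12) [hd, hc, hf, hf'] at h2 h3 h4 h5
  simp (maxDischargeDepth := 12) [ptr, hd, hc, hf, hf']
  rw [h5, h2, vcomp_vcomp_of_eq h3.symm, vcomp_of_eq_id h4] <;>
    simp (maxDischargeDepth := 12) [hd, hc, hf, hf']

/-- The trace of a composite of 2-morphisms intertwined by the tensorator. -/
theorem closureCell_tau {f f' h p q : C.Mor} {β β' χ : C.Cell}
    (hβ : C.dom β = h) (hβ' : C.cod β = f ≫₁ p ⊳₁ C.src q)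
    (hd : C.dom χ = f ≫₁ C.src p ⊲₁ q) (hc : C.cod χ = f' ≫₁ C.src p ⊲₁ q)
    (hδ : C.dom β' = f' ≫₁ p ⊳₁ C.src q) (hδ' : C.cod β' = h)
    (hf : C.tgt f = C.src p ⊗₀ C.src q) (hf' : C.tgt f' = C.src p ⊗₀ C.src q)
    (hh : C.tgt h = C.tgt p ⊗₀ C.src q) :
    C.closureCell ((β ⊙ₕ 𝟙₂ (C.tgt p ⊲₁ q)) ⊙ᵥ
        ((𝟙₂ f ⊙ₕ C.tau p q) ⊙ᵥ (χ ⊙ₕ 𝟙₂ (p ⊳₁ C.tgt q)) ⊙ᵥ (𝟙₂ f' ⊙ₕ (C.tau p q)⋆₂)) ⊙ᵥ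
        (β' ⊙ₕ 𝟙₂ (C.tgt p ⊲₁ q))) =
      C.closureCell (β ⊙ᵥ (C.ptr f f' (C.src p ⊲₁ q) χ ⊙ₕ 𝟙₂ (p ⊳₁ C.src q)) ⊙ᵥ β') := by
  rw [← ptr_tau hd hc hf hf', ← ptr_whisker (v := C.tgt p ⊲₁ q) hβ hβ' ?_ ?_ hδ hδ',
    closureCell_ptr] <;>
  simp (maxDischargeDepth := 12) [hβ, hβ', hd, hc, hδ, hδ', hf, hf', hh]

/-- The adjoint `h p* ⇒ k` of a 2-morphism `h ⇒ k p`, intertwined with the tensorator. -/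
def tauMate (C : TwoCatData.{u, v₀, v₁, v₂} F) (h k p q : C.Mor) (Φ : C.Cell) : C.Cell :=
  (𝟙₂ h ⊙ₕ C.tau p⋆₁ q) ⊙ᵥ (Φ ⊙ₕ 𝟙₂ (p⋆₁ ⊳₁ C.tgt q)) ⊙ᵥ (𝟙₂ k ⊙ₕ (C.i₁ p)⋆₂ ⊳₂ C.tgt q)

/-- Naturality of the tensorator in its first argument for `1 ⇒ p* p`, with the tensorator of the
composite `p* p` split in two. -/
theorem tau_unit_left (p q : C.Mor) :
    ((C.e₁ p)⋆₂ ⊳₂ C.src q ⊙ₕ 𝟙₂ (C.tgt p ⊲₁ q)) ⊙ᵥ (𝟙₂ (p⋆₁ ⊳₁ C.src q) ⊙ₕ C.tau p q) ⊙ᵥ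
        (C.tau p⋆₁ q ⊙ₕ 𝟙₂ (p ⊳₁ C.tgt q)) =
      𝟙₂ (C.tgt p ⊲₁ q) ⊙ₕ (C.e₁ p)⋆₂ ⊳₂ C.tgt q := by
  have h1 := tau_natural_left (C.e₁ p)⋆₂ q
  simp (maxDischargeDepth := 12) [tau_comp_left, tau_id_left] at h1
  exact h1

/-- Bending `p` around loses no information: the tensorators disappear by `tau_unit_left`, and the
remaining zigzag by a triangle identity. -/
theorem tauMate_spec {h k p q : C.Mor} {Φ : C.Cell} (hd : C.dom Φ = h ≫₁ C.tgt p ⊲₁ q)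
    (hc : C.cod Φ = k ≫₁ p ⊳₁ C.tgt q) (hh : C.tgt h = C.tgt p ⊗₀ C.src q)
    (hk : C.tgt k = C.src p ⊗₀ C.tgt q) :
    (𝟙₂ h ⊙ₕ (C.e₁ p)⋆₂ ⊳₂ C.src q ⊙ₕ 𝟙₂ (C.tgt p ⊲₁ q)) ⊙ᵥ
        (𝟙₂ (h ≫₁ p⋆₁ ⊳₁ C.src q) ⊙ₕ C.tau p q) ⊙ᵥ
        (C.tauMate h k p q Φ ⊙ₕ 𝟙₂ (p ⊳₁ C.tgt q)) = Φ := by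
  have h1 := congrArg (fun x => (𝟙₂ h ⊙ₕ x) ⊙ᵥ
    (Φ ⊙ₕ 𝟙₂ (p⋆₁ ⊳₁ C.tgt q) ⊙ₕ 𝟙₂ (p ⊳₁ C.tgt q)) ⊙ᵥ
      (𝟙₂ k ⊙ₕ (C.i₁ p)⋆₂ ⊳₂ C.tgt q ⊙ₕ 𝟙₂ (p ⊳₁ C.tgt q))) (tau_unit_left p q)
  have h2 := exchange (β := (C.e₁ p)⋆₂ ⊳₂ C.tgt q) hd hc (by simp; rfl) (by simp; rfl)
    (by simp [hh])
  have h3 := congrArg (fun x => 𝟙₂ k ⊙ₕ x ⊳₂ C.tgt q) (triangle_right p⋆₁)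
  simp (maxDischargeDepth := 12) [hd, hc, hh, hk] at h1 h2 h3
  simp (maxDischargeDepth := 12) [tauMate, hd, hc, hh, hk]
  rw [h1, vcomp_vcomp_of_eq h2.symm, h3] <;>
    simp (maxDischargeDepth := 12) [hd, hc, hh, hk]

/-- When the inserted 2-endomorphism factors as `a · b` through `f`, undoing the bending leaves a
product of two pieces meeting at `f`, with the tensorator between them. This is exactly the shape of
a gluing `βδ`. -/
theorem tauMate_factor {h f p q : C.Mor} {a b Ψ : C.Cell}
    (ha : C.dom a = h ≫₁ p⋆₁ ⊳₁ C.src q) (ha' : C.cod a = f)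
    (hb : C.dom b = f) (hb' : C.cod b = h ≫₁ p⋆₁ ⊳₁ C.src q)
    (hΨ : C.dom Ψ = h ≫₁ p⋆₁ ⊳₁ C.src q ≫₁ C.src p ⊲₁ q)
    (hh : C.tgt h = C.tgt p ⊗₀ C.src q) (hf : C.tgt f = C.src p ⊗₀ C.src q) :
    (𝟙₂ h ⊙ₕ (C.e₁ p)⋆₂ ⊳₂ C.src q ⊙ₕ 𝟙₂ (C.tgt p ⊲₁ q)) ⊙ᵥ
        (𝟙₂ (h ≫₁ p⋆₁ ⊳₁ C.src q) ⊙ₕ C.tau p q) ⊙ᵥ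
        ((((a ⊙ᵥ b) ⊙ₕ 𝟙₂ (C.src p ⊲₁ q)) ⊙ᵥ Ψ) ⊙ₕ 𝟙₂ (p ⊳₁ C.tgt q)) =
      ((((𝟙₂ h ⊙ₕ (C.e₁ p)⋆₂ ⊳₂ C.src q) ⊙ᵥ (a ⊙ₕ 𝟙₂ (p ⊳₁ C.src q))) ⊙ₕ 𝟙₂ (C.tgt p ⊲₁ q)) ⊙ᵥ
        (𝟙₂ f ⊙ₕ C.tau p q)) ⊙ᵥ (((b ⊙ₕ 𝟙₂ (C.src p ⊲₁ q)) ⊙ᵥ Ψ) ⊙ₕ 𝟙₂ (p ⊳₁ C.tgt q)) := by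
  have h1 := exchange (β := C.tau p q) ha ha' (by simp; rfl) (by simp; rfl) (by simp [hh])
  simp (maxDischargeDepth := 12) [ha, ha', hb, hb', hΨ, hh, hf]
  rw [vcomp_vcomp_of_eq h1.symm] <;>
    simp (maxDischargeDepth := 12) [ha, ha', hb, hb', hΨ, hh, hf]

end Tensorator

/-! ### Adjoints of 2-morphisms -/

section Mates

variable {F : Type u} {C : TwoCatData.{u, v₀, v₁, v₂} F} [HasDuals C]

attribute [local simp] src_cod tgt_cod src_id₁ tgt_id₁ src_comp tgt_comp dom_id₂ cod_id₂ dom_vcomp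
  cod_vcomp dom_hcomp cod_hcomp comp_assoc
  src_tl tgt_tl dom_tl cod_tl src_tr tgt_tr dom_tr cod_tr
  src_d₁ tgt_d₁ dom_d₂ cod_d₂ src_i₀ tgt_i₀ src_e₀ tgt_e₀ dom_i₁
  cod_i₁ dom_e₁ cod_e₁ d₀_d₀ d₁_d₁ d₂_d₂ d₁_comp d₁_tr d₁_tl d₁_id₁ d₂_id₂ e₀_d₀ tr_comp tl_comp
  dom_tau cod_tau i₁_d₁ e₁_d₁ tl_id₁ tr_id₁ tensor_assoc tl₁_tl₁ tl₁_tr₁ tr₁_tr₁ one_tensor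
  tensor_one

attribute [local simp] hcomp_assoc vcomp_assoc id_hcomp_vcomp vcomp_hcomp_id id₂_hcomp_id₂
  id_hcomp_id_hcomp tl_id₂ tr_id₂ id_vcomp_of vcomp_id_of id_hcomp_of
  hcomp_id_of

attribute [local simp] comp_id_of id_comp_of i₁_tl i₁_tr e₁_tl e₁_tr tl_vcomp tr_vcomp tl_hcomp
  tr_hcomp d₂_tl d₂_tr

/-- The adjoint `h w* ⇒ k` of a 2-morphism `h ⇒ k w`. -/
def mate (C : TwoCatData.{u, v₀, v₁, v₂} F) (k w : C.Mor) (Φ : C.Cell) : C.Cell :=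
  (Φ ⊙ₕ 𝟙₂ w⋆₁) ⊙ᵥ (𝟙₂ k ⊙ₕ (C.i₁ w)⋆₂)

theorem dom_mate {h k w : C.Mor} {Φ : C.Cell} (hd : C.dom Φ = h) (hc : C.cod Φ = k ≫₁ w)
    (hh : C.tgt h = C.tgt w) (hk : C.tgt k = C.src w) : C.dom (C.mate k w Φ) = h ≫₁ w⋆₁ := by
  simp (maxDischargeDepth := 12) [mate, hd, hc, hh, hk]

theorem cod_mate {h k w : C.Mor} {Φ : C.Cell} (hd : C.dom Φ = h) (hc : C.cod Φ = k ≫₁ w)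
    (hh : C.tgt h = C.tgt w) (hk : C.tgt k = C.src w) : C.cod (C.mate k w Φ) = k := by
  simp (maxDischargeDepth := 12) [mate, hd, hc, hh, hk]

theorem mate_spec {h k w : C.Mor} {Φ : C.Cell} (hd : C.dom Φ = h) (hc : C.cod Φ = k ≫₁ w)
    (hh : C.tgt h = C.tgt w) (hk : C.tgt k = C.src w) :
    (𝟙₂ h ⊙ₕ (C.e₁ w)⋆₂) ⊙ᵥ (C.mate k w Φ ⊙ₕ 𝟙₂ w) = Φ := by
  have h2 := exchange (β := (C.e₁ w)⋆₂) hd hc (by simp; rfl) (by simp; rfl) (by simp [hh])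
  have h3 := congrArg (fun x => 𝟙₂ k ⊙ₕ x) (triangle_right w⋆₁)
  simp (maxDischargeDepth := 12) [hd, hc, hh, hk] at h2 h3
  simp (maxDischargeDepth := 12) [mate, hd, hc, hh, hk]
  rw [vcomp_vcomp_of_eq h2.symm, h3] <;>
    simp (maxDischargeDepth := 12) [hd, hc, hh, hk]

/-- A 2-morphism `uv ⇒ kv` whose adjoint factors through the counit is a whiskering. -/
theorem mate_factor {u v : C.Mor} {Ψ : C.Cell} (hd : C.dom Ψ = u ≫₁ v ≫₁ v⋆₁)
    (hu : C.tgt u = C.src v) :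
    (𝟙₂ (u ≫₁ v) ⊙ₕ (C.e₁ v)⋆₂) ⊙ᵥ (((𝟙₂ u ⊙ₕ ((C.i₁ v)⋆₂ ⊙ᵥ C.i₁ v)) ⊙ᵥ Ψ) ⊙ₕ 𝟙₂ v) =
      ((𝟙₂ u ⊙ₕ C.i₁ v) ⊙ᵥ Ψ) ⊙ₕ 𝟙₂ v := by
  have h3 := congrArg (fun x => 𝟙₂ u ⊙ₕ x) (triangle_right v⋆₁)
  simp (maxDischargeDepth := 12) [hd, hu] at h3
  simp (maxDischargeDepth := 12) [hd, hu]
  rw [vcomp_of_eq_id h3] <;>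
    simp (maxDischargeDepth := 12) [hd, hu]

end Mates

section Identities

variable {F : Type u} [Field F] {C : TwoCatData.{u, v₀, v₁, v₂} F} [IsLinear C] {A B : C.Obj}

/-- The identity 2-morphism. -/
def Hom2.id (f : C.Hom1 A B) : Hom2 f f := ⟨𝟙₂ f.1, dom_id₂ _, cod_id₂ _⟩

theorem Hom2.vcompₗ_id {f g : C.Hom1 A B} (α : Hom2 f g) : Hom2.vcompₗ f g g α (Hom2.id g) = α :=
  Subtype.ext (vcomp_id_of α.cod_eq)

theorem Hom2.id_vcompₗ {f g : C.Hom1 A B} (α : Hom2 f g) : Hom2.vcompₗ f f g (Hom2.id f) α = α :=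
  Subtype.ext (id_vcomp_of α.dom_eq)

end Identities

/-! ### Traces -/

section Trace

variable {F : Type u} [Field F] {C : TwoCatData.{u, v₀, v₁, v₂} F} [IsSpherical C]
  [IsVectLinear C] {A B A' B' D : C.Obj}

attribute [local simp] src_cod tgt_cod src_id₁ tgt_id₁ src_comp tgt_comp dom_id₂ cod_id₂ dom_vcomp
  cod_vcomp dom_hcomp cod_hcomp comp_assoc
  src_tl tgt_tl dom_tl cod_tl src_tr tgt_tr dom_tr cod_tr
  src_d₁ tgt_d₁ dom_d₂ cod_d₂ src_i₀ tgt_i₀ src_e₀ tgt_e₀ dom_i₁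
  cod_i₁ dom_e₁ cod_e₁ d₀_d₀ d₁_d₁ d₂_d₂ d₁_comp d₁_tr d₁_tl d₁_id₁ d₂_id₂ e₀_d₀ tr_comp tl_comp
  dom_tau cod_tau i₁_d₁ e₁_d₁ tl_id₁ tr_id₁ tensor_assoc tl₁_tl₁ tl₁_tr₁ tr₁_tr₁ one_tensor
  tensor_one

attribute [local simp] hcomp_assoc vcomp_assoc id_hcomp_vcomp vcomp_hcomp_id id₂_hcomp_id₂
  id_hcomp_id_hcomp tl_id₂ tr_id₂ id_vcomp_of vcomp_id_of id_hcomp_of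
  hcomp_id_of

attribute [local simp] comp_id_of id_comp_of i₁_tl i₁_tr e₁_tl e₁_tr tl_vcomp tr_vcomp tl_hcomp
  tr_hcomp d₂_tl d₂_tr

attribute [local simp] Hom1.src_eq Hom1.tgt_eq Hom2.dom_eq Hom2.cod_eq

attribute [local simp] dom_smul cod_smul tl_smul tr_smul smul_hcomp hcomp_smul smul_vcomp vcomp_smul

/-- The trace of a 2-endomorphism, as a scalar. -/
noncomputable def tr (f : C.Hom1 A B) : Hom2 f f →ₗ[F] F :=
  (unitEquiv (C := C)).symm.toLinearMap ∘ₗ closure f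

theorem pairing_eq_tr {f g : C.Hom1 A B} (α : Hom2 f g) (β : Hom2 g f) :
    pairing f g α β = tr f (Hom2.vcompₗ f g f α β) := rfl

/-- Traces on 1-morphisms between different objects are compared as cells, since all closures are
2-endomorphisms of `1_I`. -/
theorem tr_eq_of_closureCell {f : C.Hom1 A B} {g : C.Hom1 A' B'} {χ : Hom2 f f} {ψ : Hom2 g g}
    (h : C.closureCell χ.1 = C.closureCell ψ.1) : tr f χ = tr g ψ := by
  have h1 : ∀ {A B : C.Obj} (f : C.Hom1 A B) (χ : Hom2 f f),
      (closure f χ).1 = C.closureCell χ.1 := fun f χ => by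
    rw [closureCell, χ.dom_eq]
    rfl
  have h2 : closure f χ = closure g ψ := Subtype.ext (by rw [h1, h1, h])
  simp [tr, h2]

theorem tr_cyclic {f g : C.Hom1 A B} (α : Hom2 f g) (β : Hom2 g f) :
    tr f (Hom2.vcompₗ f g f α β) = tr g (Hom2.vcompₗ g f g β α) :=
  tr_eq_of_closureCell (closureCell_cyclic α.dom_eq α.cod_eq β.dom_eq β.cod_eq)

theorem pairing_comm {f g : C.Hom1 A B} (α : Hom2 f g) (β : Hom2 g f) :
    pairing f g α β = pairing g f β α := tr_cyclic α β

theorem dimq_eq_tr (f : C.Hom1 A B) : dimq f = tr f (Hom2.id f) :=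
  congrArg (tr f) (Hom2.vcompₗ_id (Hom2.id f))

theorem tr_smul_id (f : C.Hom1 A B) (c : F) : tr f (c • Hom2.id f) = c * dimq f := by
  rw [map_smul, dimq_eq_tr, smul_eq_mul]

end Trace

/-! ### Simple 1-morphisms and simple objects -/

section Simple

variable {F : Type u} [Field F] {C : TwoCatData.{u, v₀, v₁, v₂} F} [IsVectLinear C]
  {A B D : C.Obj}

attribute [local simp] src_cod tgt_cod src_id₁ tgt_id₁ src_comp tgt_comp dom_id₂ cod_id₂ dom_vcomp
  cod_vcomp dom_hcomp cod_hcomp comp_assoc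
  src_tl tgt_tl dom_tl cod_tl src_tr tgt_tr dom_tr cod_tr
  src_d₁ tgt_d₁ dom_d₂ cod_d₂ src_i₀ tgt_i₀ src_e₀ tgt_e₀ dom_i₁
  cod_i₁ dom_e₁ cod_e₁ d₀_d₀ d₁_d₁ d₂_d₂ d₁_comp d₁_tr d₁_tl d₁_id₁ d₂_id₂ e₀_d₀ tr_comp tl_comp
  dom_tau cod_tau i₁_d₁ e₁_d₁ tl_id₁ tr_id₁ tensor_assoc tl₁_tl₁ tl₁_tr₁ tr₁_tr₁ one_tensor
  tensor_one

attribute [local simp] hcomp_assoc vcomp_assoc id_hcomp_vcomp vcomp_hcomp_id id₂_hcomp_id₂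
  id_hcomp_id_hcomp tl_id₂ tr_id₂ id_vcomp_of vcomp_id_of id_hcomp_of
  hcomp_id_of

attribute [local simp] comp_id_of id_comp_of i₁_tl i₁_tr e₁_tl e₁_tr tl_vcomp tr_vcomp tl_hcomp
  tr_hcomp d₂_tl d₂_tr

attribute [local simp] Hom1.src_eq Hom1.tgt_eq Hom2.dom_eq Hom2.cod_eq

attribute [local simp] dom_smul cod_smul tl_smul tr_smul smul_hcomp hcomp_smul smul_vcomp vcomp_smul

theorem exists_isSimpleFamily (A B : C.Obj) :
    ∃ (n : ℕ) (s : Fin n → C.Hom1 A B), IsSimpleFamily F s :=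
  let ⟨n, hn⟩ := IsVectLinear.twoVectorSpace A B
  ⟨n, hn.exists_isSimpleFamily⟩

namespace IsMorphismBasis

variable {S : Finset (C.Hom1 A B)} (hS : IsMorphismBasis S)

include hS

theorem exists_scalar {f : C.Hom1 A B} (hf : f ∈ S) (α : Hom2 f f) :
    ∃ c : F, α = c • Hom2.id f := by
  obtain ⟨n, s, hs⟩ := exists_isSimpleFamily A B
  have := hS.simple f hf
  exact hs.exists_scalar f α

theorem eq_zero {f g : C.Hom1 A B} (hf : f ∈ S) (hg : g ∈ S) (h : f ≠ g) (α : Hom2 f g) :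
    α = 0 := by
  obtain ⟨n, s, hs⟩ := exists_isSimpleFamily A B
  have := hS.simple f hf
  have := hS.simple g hg
  by_contra hα
  exact h (hS.eq_of_iso f hf g hg (hs.nonempty_iso f g hα))

theorem generatedBy (h : C.Hom1 A B) : GeneratedBy F (S : Set (C.Hom1 A B)) h := by
  obtain ⟨n, s, hs⟩ := exists_isSimpleFamily A B
  exact hs.generatedBy (fun f hf => hS.exists_iso f hf) h

theorem id_ne_zero {f : C.Hom1 A B} (hf : f ∈ S) : Hom2.id f ≠ 0 :=
  have := hS.simple f hf
  id_nonzero f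

end IsMorphismBasis

theorem Hom2.hcompₗ_id_left {f g : C.Hom1 A B} (α : Hom2 f g) :
    (Hom2.hcompₗ _ _ f g (Hom2.id (Hom1.id C A)) α).1 = α.1 :=
  id_hcomp_of (by simp)

namespace IsObjectBasis

variable {E : Finset C.Obj} (hE : C.IsObjectBasis E)

include hE

/-- Horizontal composition with the identity of `1_X` fixes every 2-morphism, so its vanishing would
force `End(X) = 0`. -/
theorem id_ne_zero {X : C.Obj} (hX : X ∈ E) : Hom2.id (Hom1.id C X) ≠ 0 := by
  intro h
  obtain ⟨f, g, α, hα⟩ := hE.nonzero X hX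
  apply hα
  have h1 := Hom2.hcompₗ_id_left α
  rw [h, map_zero, LinearMap.zero_apply] at h1
  refine Subtype.ext (h1.symm.trans ?_)
  change C.zero (C.id₁ X ≫₁ f.1) (C.id₁ X ≫₁ g.1) = C.zero f.1 g.1
  rw [id_comp_of f.src_eq, id_comp_of g.src_eq]

/-- With `d` the dimension of `2End(1_X)`, full faithfulness of the composition functor gives `d · d
= d`, because `1_X 1_X = 1_X`. As `d ≠ 0`, it is `1`. -/
theorem exists_scalar {X : C.Obj} (hX : X ∈ E) (z : Hom2 (Hom1.id C X) (Hom1.id C X)) :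
    ∃ c : F, z = c • Hom2.id (Hom1.id C X) := by
  have hid : (Hom1.id C X).comp (Hom1.id C X) = Hom1.id C X :=
    Subtype.ext (id_comp_of (by simp [Hom1.id]))
  have hb := hE.bijective X hX X X (Hom1.id C X) (Hom1.id C X) (Hom1.id C X) (Hom1.id C X)
  have h1 := (LinearEquiv.ofBijective _ hb).finrank_eq
  rw [hid, Module.finrank_tensorProduct] at h1
  have h2 : Module.finrank F (Hom2 (Hom1.id C X) (Hom1.id C X)) ≠ 0 := fun h0 => by
    have := Module.finrank_zero_iff.1 h0
    exact hE.id_ne_zero hX (Subsingleton.elim _ _)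
  have h3 : Module.finrank F (Hom2 (Hom1.id C X) (Hom1.id C X)) = 1 := by
    exact Nat.eq_of_mul_eq_mul_left (Nat.pos_of_ne_zero h2) (h1.trans (mul_one _).symm)
  obtain ⟨c, hc⟩ := (finrank_eq_one_iff_of_nonzero' _ (hE.id_ne_zero hX)).1 h3 z
  exact ⟨c, hc.symm⟩

/-- The identity of `h`, read as a 2-morphism `1_X h ⇒ h 1_Y`, joins pairs with different middle
objects and hence is zero. -/
theorem id_eq_zero {X Y : C.Obj} (hX : X ∈ E) (hY : Y ∈ E) (hXY : X ≠ Y) (h : C.Hom1 X Y) :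
    Hom2.id h = 0 := by
  have h1 := hE.eq_zero X hX Y hY hXY X Y (Hom1.id C X) h h (Hom1.id C Y)
    ⟨𝟙₂ h.1, by
      change C.dom _ = C.id₁ X ≫₁ h.1 ∧ C.cod _ = h.1 ≫₁ C.id₁ Y
      rw [id_comp_of h.src_eq, comp_id_of h.tgt_eq]
      simp⟩
  refine Subtype.ext ((congrArg Subtype.val h1).trans ?_)
  change C.zero (C.id₁ X ≫₁ h.1) (h.1 ≫₁ C.id₁ Y) = C.zero h.1 h.1
  rw [id_comp_of h.src_eq, comp_id_of h.tgt_eq]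

/-- The identity of `h`, read as a 2-morphism `1_X h ⇒ h 1_X`, is a sum of horizontal composites `a
∘ b` with `a : 1_X ⇒ h` and `b : h ⇒ 1_X`. By interchange `a ∘ b = b · a`, which factors through
`1_X`. -/
theorem generatedBy_id {X : C.Obj} (hX : X ∈ E) (h : C.Hom1 X X) :
    GeneratedBy F {Hom1.id C X} h := by
  have hd : ((Hom1.id C X).comp h).1 = h.1 := id_comp_of h.src_eq
  have hc : (h.comp (Hom1.id C X)).1 = h.1 := comp_id_of h.tgt_eq
  let L : Hom2 ((Hom1.id C X).comp h) (h.comp (Hom1.id C X)) →ₗ[F] (h ⟶ h) :=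
    Hom2.map (fun α => α) (fun α => α.dom_eq.trans hd) (fun α => α.cod_eq.trans hc)
      (fun _ _ => rfl) (fun _ _ => rfl)
  obtain ⟨t, ht⟩ := (hE.bijective X hX X X (Hom1.id C X) h h (Hom1.id C X)).2
    ⟨𝟙₂ h.1, by rw [hd, hc]; simp⟩
  have h1 : 𝟙 h = L (TensorProduct.lift (Hom2.hcompₗ (Hom1.id C X) h h (Hom1.id C X)) t) := by
    rw [ht]
    rfl
  unfold GeneratedBy
  rw [h1]
  clear h1 ht
  induction t using TensorProduct.induction_on with
  | zero => simp
  | add x y hx hy =>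
    rw [map_add, map_add]
    exact Submodule.add_mem _ hx hy
  | tmul a b =>
    refine Submodule.subset_span ⟨_, rfl, b, a, Subtype.ext ?_⟩
    change a.1 ⊙ₕ b.1 = b.1 ⊙ᵥ a.1
    have h1 := interchange (𝟙₂ (C.id₁ X)) a.1 b.1 (𝟙₂ (C.id₁ X)) (by simp [Hom1.id])
      (by simp [Hom1.id]) (by simp)
    rw [id_vcomp_of (show C.dom a.1 = C.id₁ X from a.dom_eq),
      vcomp_id_of (show C.cod b.1 = C.id₁ X from b.cod_eq)] at h1
    rw [h1, id_hcomp_of (by simp), hcomp_id_of (by simp)]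

end IsObjectBasis

end Simple

/-! ### Composites with simple 1-morphisms out of simple objects -/

section Composites

variable {F : Type u} [Field F] {C : TwoCatData.{u, v₀, v₁, v₂} F} [IsSpherical C]
  [IsVectLinear C] {A B D X Y Z : C.Obj}

attribute [local simp] src_cod tgt_cod src_id₁ tgt_id₁ src_comp tgt_comp dom_id₂ cod_id₂ dom_vcomp
  cod_vcomp dom_hcomp cod_hcomp comp_assoc
  src_tl tgt_tl dom_tl cod_tl src_tr tgt_tr dom_tr cod_tr
  src_d₁ tgt_d₁ dom_d₂ cod_d₂ src_i₀ tgt_i₀ src_e₀ tgt_e₀ dom_i₁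
  cod_i₁ dom_e₁ cod_e₁ d₀_d₀ d₁_d₁ d₂_d₂ d₁_comp d₁_tr d₁_tl d₁_id₁ d₂_id₂ e₀_d₀ tr_comp tl_comp
  dom_tau cod_tau i₁_d₁ e₁_d₁ tl_id₁ tr_id₁ tensor_assoc tl₁_tl₁ tl₁_tr₁ tr₁_tr₁ one_tensor
  tensor_one

attribute [local simp] hcomp_assoc vcomp_assoc id_hcomp_vcomp vcomp_hcomp_id id₂_hcomp_id₂
  id_hcomp_id_hcomp tl_id₂ tr_id₂ id_vcomp_of vcomp_id_of id_hcomp_of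
  hcomp_id_of

attribute [local simp] comp_id_of id_comp_of i₁_tl i₁_tr e₁_tl e₁_tr tl_vcomp tr_vcomp tl_hcomp
  tr_hcomp d₂_tl d₂_tr

attribute [local simp] Hom1.src_eq Hom1.tgt_eq Hom2.dom_eq Hom2.cod_eq

attribute [local simp] dom_smul cod_smul tl_smul tr_smul smul_hcomp hcomp_smul smul_vcomp vcomp_smul

/-- The dual 1-morphism. -/
def Hom1.dual (f : C.Hom1 A B) : C.Hom1 B A := ⟨f.1⋆₁, by simp⟩

/-- The unit of the duality of `f`. -/
def Hom1.unit (f : C.Hom1 A B) : Hom2 (Hom1.id C A) (f.comp f.dual) :=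
  ⟨C.i₁ f.1, by simp [Hom1.id], by simp [Hom1.comp, Hom1.dual]⟩

/-- Maps `1_A ⇒ p q*` correspond by duality to maps `q ⇒ p`, which simplicity of 1-morphisms
controls. -/
theorem exists_mate (p : C.Hom1 A B) (q : C.Hom1 A B) (b : Hom2 (Hom1.id C A) (p.comp q.dual)) :
    ∃ m : Hom2 q p, b.1 = C.i₁ q.1 ⊙ᵥ (m.1 ⊙ₕ 𝟙₂ q.1⋆₁) := by
  have hd : C.dom b.1 = C.id₁ A := b.dom_eq
  have hc : C.cod b.1 = p.1 ≫₁ q.1⋆₁ := b.cod_eq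
  refine ⟨⟨C.mate p.1 q.1⋆₁ b.1, ?_, ?_⟩, ?_⟩
  · rw [dom_mate hd hc] <;> simp
  · rw [cod_mate hd hc] <;> simp
  · have h := mate_spec hd hc (by simp) (by simp)
    simp (maxDischargeDepth := 12) [dom_mate hd hc] at h
    exact h.symm

/-- Otherwise the identity would pair to zero with all of `2End(f)`, which consists of scalars,
against non-degeneracy. -/
theorem dimq_ne_zero [IsNondegenerate C] {f : C.Hom1 A B}
    (h : ∀ α : Hom2 f f, ∃ c : F, α = c • Hom2.id f) (h0 : Hom2.id f ≠ 0) : dimq f ≠ 0 := by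
  intro hf
  refine h0 ((IsNondegenerate.nondegenerate A B f f).1 _ fun α => ?_)
  obtain ⟨c, rfl⟩ := h α
  rw [pairing_eq_tr, Hom2.id_vcompₗ, tr_smul_id, hf, mul_zero]

theorem IsMorphismBasis.dimq_ne_zero [IsNondegenerate C] {S : Finset (C.Hom1 A B)}
    (hS : IsMorphismBasis S) {f : C.Hom1 A B} (hf : f ∈ S) : dimq f ≠ 0 :=
  TwoCatData.dimq_ne_zero (hS.exists_scalar hf) (hS.id_ne_zero hf)

namespace IsObjectBasis

variable {E : Finset C.Obj} (hE : C.IsObjectBasis E)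

include hE

theorem dimqObj_ne_zero [IsNondegenerate C] (hX : X ∈ E) : C.dimqObj X ≠ 0 :=
  dimq_ne_zero (hE.exists_scalar hX) (hE.id_ne_zero hX)

/-- Closing a 1-morphism out of a simple object. -/
theorem unit_counit [IsNondegenerate C] (hX : X ∈ E) (p : C.Hom1 X D) :
    C.i₁ p.1 ⊙ᵥ (C.i₁ p.1)⋆₂ = C.smul (dimq p / C.dimqObj X) (𝟙₂ (C.id₁ X)) := by
  -- The closed loop is a scalar `c` because `2End(1_X)` is one-dimensional. Being the partial trace
  -- of the identity of `p`, it has trace `dimq p`, and this determines `c`.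
  obtain ⟨c, hc⟩ := hE.exists_scalar hX
    ⟨C.i₁ p.1 ⊙ᵥ (C.i₁ p.1)⋆₂, by simp [Hom1.id], by simp [Hom1.id]⟩
  have h1 : tr p (Hom2.id p) = tr (Hom1.id C X)
      ⟨C.i₁ p.1 ⊙ᵥ (C.i₁ p.1)⋆₂, by simp [Hom1.id], by simp [Hom1.id]⟩ := by
    apply tr_eq_of_closureCell
    change C.closureCell (𝟙₂ p.1) = C.closureCell (C.i₁ p.1 ⊙ᵥ (C.i₁ p.1)⋆₂)
    rw [← closureCell_ptr (f := C.id₁ X) (v := p.1) (by simp) (by simp) (by simp)]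
    congr 1
    simp (maxDischargeDepth := 12) [ptr]
  rw [hc, tr_smul_id, ← dimq_eq_tr] at h1
  rw [h1, show dimq (Hom1.id C X) = C.dimqObj X from rfl,
    mul_div_cancel_right₀ _ (hE.dimqObj_ne_zero hX)]
  exact congrArg Subtype.val hc

/-- Equality with its own multiple by `0` is how vanishing is stated for bare cells; this form
survives tensoring and composition. -/
theorem id_comp_dual_of_ne_obj (hX : X ∈ E) (hY : Y ∈ E) (hXY : X ≠ Y) (p : C.Hom1 X D)
    (q : C.Hom1 Y D) : 𝟙₂ (p.1 ≫₁ q.1⋆₁) = C.smul 0 (𝟙₂ (p.1 ≫₁ q.1⋆₁)) := by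
  have h := hE.id_eq_zero hX hY hXY (p.comp q.dual)
  rw [← zero_smul F (Hom2.id (p.comp q.dual))] at h
  exact congrArg Subtype.val h

/-- The identity of `p q*` is a sum of terms `a_i · b_i` through `1_X`. If all `b_i` are multiples
of one `b`, the scalars can be moved into the first factors and the sum becomes a single `a · b`. -/
theorem exists_id_comp_dual (hX : X ∈ E) (p q : C.Hom1 X D)
    (b : Hom2 (Hom1.id C X) (p.comp q.dual)) (hb : ∀ b', ∃ c : F, b' = c • b) :
    ∃ a : Hom2 (p.comp q.dual) (Hom1.id C X), Hom2.id (p.comp q.dual) = Hom2.vcompₗ _ _ _ a b := by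
  have h := hE.generatedBy_id hX (p.comp q.dual)
  have hle : Submodule.span F {φ : p.comp q.dual ⟶ p.comp q.dual | ∃ s ∈ ({Hom1.id C X} : Set _),
      ∃ (a : p.comp q.dual ⟶ s) (b : s ⟶ p.comp q.dual), φ = a ≫ b} ≤
      LinearMap.range ((Hom2.vcompₗ (p.comp q.dual) _ (p.comp q.dual)).flip b) := by
    refine Submodule.span_le.2 ?_
    rintro _ ⟨_, rfl, a, b', rfl⟩
    obtain ⟨c, rfl⟩ := hb b'
    refine ⟨c • a, ?_⟩
    rw [map_smul]
    exact (Linear.comp_smul _ _ _ a c b).symm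
  obtain ⟨a, ha⟩ := hle h
  exact ⟨a, ha.symm⟩

/-- Every `1_X ⇒ p q*` is the mate of a 2-morphism `q ⇒ p`, which is zero for distinct basis
elements; so `b = 0` may be taken in the factorization. -/
theorem id_comp_dual_of_ne (hX : X ∈ E) {S : Finset (C.Hom1 X D)} (hS : IsMorphismBasis S)
    {p q : C.Hom1 X D} (hp : p ∈ S) (hq : q ∈ S) (hpq : p ≠ q) :
    𝟙₂ (p.1 ≫₁ q.1⋆₁) = C.smul 0 (𝟙₂ (p.1 ≫₁ q.1⋆₁)) := by
  obtain ⟨a, ha⟩ := hE.exists_id_comp_dual hX p q 0 fun b => by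
    refine ⟨0, ?_⟩
    obtain ⟨m, hm⟩ := exists_mate p q b
    have h0 : m = (0 : F) • m := by rw [hS.eq_zero hq hp hpq.symm m, smul_zero]
    have h1 : b.1 = C.smul 0 b.1 := by
      conv_lhs => rw [hm, show m.1 = C.smul 0 m.1 from congrArg Subtype.val h0]
      rw [hm]
      simp
    rw [smul_zero]
    exact (Subtype.ext h1 : b = (0 : F) • b).trans (zero_smul F b)
  rw [map_zero, ← zero_smul F (Hom2.id (p.comp q.dual))] at ha
  exact congrArg Subtype.val ha

/-- Maps `1_X ⇒ p p*` are mates of scalars, hence multiples of the unit, so the identity is `a ·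
i_p` for some `a`. Composing with the dual of `i_p` and evaluating the loop by `unit_counit`
identifies `a`. -/
theorem id_comp_dual_self [IsNondegenerate C] (hX : X ∈ E) {S : Finset (C.Hom1 X D)}
    (hS : IsMorphismBasis S) {p : C.Hom1 X D} (hp : p ∈ S) :
    𝟙₂ (p.1 ≫₁ p.1⋆₁) = C.smul (C.dimqObj X / dimq p) ((C.i₁ p.1)⋆₂ ⊙ᵥ C.i₁ p.1) := by
  obtain ⟨a, ha⟩ := hE.exists_id_comp_dual hX p p p.unit fun b => by
    obtain ⟨m, hm⟩ := exists_mate p p b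
    obtain ⟨c, rfl⟩ := hS.exists_scalar hp m
    refine ⟨c, Subtype.ext (hm.trans ?_)⟩
    change C.i₁ p.1 ⊙ᵥ (C.smul c (𝟙₂ p.1) ⊙ₕ 𝟙₂ p.1⋆₁) = C.smul c (C.i₁ p.1)
    simp
  replace ha : 𝟙₂ (p.1 ≫₁ p.1⋆₁) = a.1 ⊙ᵥ C.i₁ p.1 := congrArg Subtype.val ha
  have ha1 : C.dom a.1 = p.1 ≫₁ p.1⋆₁ := a.dom_eq
  have ha2 : C.cod a.1 = C.id₁ X := a.cod_eq
  have h1 := congrArg (· ⊙ᵥ (C.i₁ p.1)⋆₂) ha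
  have hX0 := hE.dimqObj_ne_zero hX
  have hp0 := hS.dimq_ne_zero hp
  simp [ha2, hE.unit_counit hX p] at h1
  rw [h1, smul_vcomp _ _ _ (by simp [ha2]), ← ha, ← IsLinear.mul_smul,
    div_mul_div_cancel₀ hp0, div_self hX0, IsLinear.one_smul]

end IsObjectBasis

end Composites

/-! ### 2-morphisms between composites with whiskered simple 1-morphisms -/

section Whisk

variable {F : Type u} {C : TwoCatData.{u, v₀, v₁, v₂} F} [IsSemistrictMonoidal C]

/-- `L ⊗ p ⊗ R` -/
def whisk {F : Type u} (C : TwoCatData.{u, v₀, v₁, v₂} F) (L R : C.Obj) (p : C.Mor) : C.Mor :=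
  L ⊲₁ (p ⊳₁ R)

theorem src_whisk (L R : C.Obj) (p : C.Mor) : C.src (C.whisk L R p) = L ⊗₀ C.src p ⊗₀ R := by
  rw [whisk, src_tl, src_tr]

theorem tgt_whisk (L R : C.Obj) (p : C.Mor) : C.tgt (C.whisk L R p) = L ⊗₀ C.tgt p ⊗₀ R := by
  rw [whisk, tgt_tl, tgt_tr]

end Whisk

section Whiskered

variable {F : Type u} [Field F] {C : TwoCatData.{u, v₀, v₁, v₂} F} [HasDuals C] [IsLinear C]

attribute [local simp] src_cod tgt_cod src_id₁ tgt_id₁ src_comp tgt_comp dom_id₂ cod_id₂ dom_vcomp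
  cod_vcomp dom_hcomp cod_hcomp comp_assoc
  src_tl tgt_tl dom_tl cod_tl src_tr tgt_tr dom_tr cod_tr
  src_d₁ tgt_d₁ dom_d₂ cod_d₂ src_i₀ tgt_i₀ src_e₀ tgt_e₀ dom_i₁
  cod_i₁ dom_e₁ cod_e₁ d₀_d₀ d₁_d₁ d₂_d₂ d₁_comp d₁_tr d₁_tl d₁_id₁ d₂_id₂ e₀_d₀ tr_comp tl_comp
  dom_tau cod_tau i₁_d₁ e₁_d₁ tl_id₁ tr_id₁ tensor_assoc tl₁_tl₁ tl₁_tr₁ tr₁_tr₁ one_tensor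
  tensor_one

attribute [local simp] hcomp_assoc vcomp_assoc id_hcomp_vcomp vcomp_hcomp_id id₂_hcomp_id₂
  id_hcomp_id_hcomp tl_id₂ tr_id₂ id_vcomp_of vcomp_id_of id_hcomp_of
  hcomp_id_of

attribute [local simp] comp_id_of id_comp_of i₁_tl i₁_tr e₁_tl e₁_tr tl_vcomp tr_vcomp tl_hcomp
  tr_hcomp d₂_tl d₂_tr

attribute [local simp] Hom1.src_eq Hom1.tgt_eq Hom2.dom_eq Hom2.cod_eq

attribute [local simp] dom_smul cod_smul tl_smul tr_smul smul_hcomp hcomp_smul smul_vcomp vcomp_smul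

attribute [local simp] tl₂_tl₂ tl₂_tr₂ tr₂_tr₂

/-- The adjoint of `Φ` starts at `u v w*`, where the identity already vanishes, and `Φ` is recovered
from its adjoint. -/
theorem eq_zero_smul_of_comp_dual {u u' v w : C.Mor}
    (hvw : 𝟙₂ (v ≫₁ w⋆₁) = C.smul 0 (𝟙₂ (v ≫₁ w⋆₁))) {Φ : C.Cell} (hd : C.dom Φ = u ≫₁ v)
    (hc : C.cod Φ = u' ≫₁ w) (hu : C.tgt u = C.src v) (hu' : C.tgt u' = C.src w)
    (ht : C.tgt v = C.tgt w) : Φ = C.smul 0 Φ := by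
  have h1 := mate_spec hd hc (by simp [hu, ht]) hu'
  have hm := dom_mate hd hc (by simp [hu, ht]) hu'
  have h2 := congrArg (𝟙₂ u ⊙ₕ ·) hvw
  simp (maxDischargeDepth := 12) [hu, hu', ht] at h2 hm
  set Ψ := C.mate u' w Φ
  have h3 : Ψ = C.smul 0 Ψ := by
    conv_lhs => rw [← id_vcomp Ψ, hm, h2]
    simp (maxDischargeDepth := 12) [hm, hu, hu', ht]
  conv_lhs => rw [← h1, h3]
  conv_rhs => rw [← h1]
  simp (maxDischargeDepth := 12) [hm, hu, hu', ht]

/-- Inserting the formula for the identity of `v v*` in front of the adjoint of `Φ` and undoing the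
adjunction leaves a zigzag, which a triangle identity removes; `v` then runs straight through. -/
theorem eq_whiskering_of_comp_dual {u u' v : C.Mor} {c : F}
    (hv : 𝟙₂ (v ≫₁ v⋆₁) = C.smul c ((C.i₁ v)⋆₂ ⊙ᵥ C.i₁ v)) {Φ : C.Cell} (hd : C.dom Φ = u ≫₁ v)
    (hc : C.cod Φ = u' ≫₁ v) (hu : C.tgt u = C.src v) (hu' : C.tgt u' = C.src v) :
    ∃ γ, C.dom γ = u ∧ C.cod γ = u' ∧ Φ = γ ⊙ₕ 𝟙₂ v := by
  have h1 := mate_spec hd hc (by simp [hu]) hu'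
  have hm := dom_mate hd hc (by simp [hu]) hu'
  have hm' := cod_mate hd hc (by simp [hu]) hu'
  have h2 := congrArg (𝟙₂ u ⊙ₕ ·) hv
  simp (maxDischargeDepth := 12) [hu, hu', - vcomp_assoc] at h2 hm
  set Ψ := C.mate u' v Φ
  have h3 : Ψ = C.smul c ((𝟙₂ u ⊙ₕ ((C.i₁ v)⋆₂ ⊙ᵥ C.i₁ v)) ⊙ᵥ Ψ) := by
    conv_lhs => rw [← id_vcomp Ψ, hm, h2]
    simp (maxDischargeDepth := 12) [hm, hu, hu']
  have h4 := mate_factor (u := u) (v := v) (Ψ := Ψ) hm hu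
  refine ⟨C.smul c ((𝟙₂ u ⊙ₕ C.i₁ v) ⊙ᵥ Ψ), ?_, ?_, ?_⟩
  · simp (maxDischargeDepth := 12) [hm, hu, hu']
  · simp (maxDischargeDepth := 12) [hm, hm', hu, hu']
  · rw [smul_hcomp _ _ _ (by simp (maxDischargeDepth := 12) [hm, hu]), ← h4,
      ← vcomp_smul _ _ _ (by simp (maxDischargeDepth := 12) [hm, hu]),
      ← smul_hcomp _ _ _ (by simp (maxDischargeDepth := 12) [hm, hu]), ← h3, h1]

/-- `χ` slides away from the closed loop of `v`, which evaluates to `c`. -/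
theorem ptr_whiskering {u v : C.Mor} {c : F}
    (hv : C.i₁ v ⊙ᵥ (C.i₁ v)⋆₂ = C.smul c (𝟙₂ (C.id₁ (C.src v)))) {χ : C.Cell} (hd : C.dom χ = u)
    (hc : C.cod χ = u) (hu : C.tgt u = C.src v) :
    C.ptr u u v (χ ⊙ₕ 𝟙₂ v) = C.smul c χ := by
  have h1 := exchange (β := C.i₁ v) hd hc (dom_i₁ v) (cod_i₁ v) (by simpa using hu)
  have h2 := congrArg (𝟙₂ u ⊙ₕ ·) hv
  simp (maxDischargeDepth := 12) [hd, hc, hu] at h1 h2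
  simp (maxDischargeDepth := 12) [ptr, hd, hc, hu]
  rw [vcomp_vcomp_of_eq h1.symm, h2] <;> simp (maxDischargeDepth := 12) [hd, hc, hu]

theorem whisk_comp_dual_zero {p q : C.Mor} (L R : C.Obj) (ht : C.tgt p = C.tgt q)
    (h : 𝟙₂ (p ≫₁ q⋆₁) = C.smul 0 (𝟙₂ (p ≫₁ q⋆₁))) :
    𝟙₂ (C.whisk L R p ≫₁ (C.whisk L R q)⋆₁) =
      C.smul 0 (𝟙₂ (C.whisk L R p ≫₁ (C.whisk L R q)⋆₁)) := by
  have h1 := congrArg (fun x => L ⊲₂ (x ⊳₂ R)) h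
  simp (maxDischargeDepth := 12) [ht] at h1
  simpa (maxDischargeDepth := 12) [whisk, ht] using h1

theorem whisk_comp_dual_self {p : C.Mor} (L R : C.Obj) {c : F}
    (h : 𝟙₂ (p ≫₁ p⋆₁) = C.smul c ((C.i₁ p)⋆₂ ⊙ᵥ C.i₁ p)) :
    𝟙₂ (C.whisk L R p ≫₁ (C.whisk L R p)⋆₁) =
      C.smul c ((C.i₁ (C.whisk L R p))⋆₂ ⊙ᵥ C.i₁ (C.whisk L R p)) := by
  have h1 := congrArg (fun x => L ⊲₂ (x ⊳₂ R)) h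
  simp (maxDischargeDepth := 12) at h1
  simpa (maxDischargeDepth := 12) [whisk] using h1

theorem whisk_unit_counit {p : C.Mor} (L R : C.Obj) {c : F}
    (h : C.i₁ p ⊙ᵥ (C.i₁ p)⋆₂ = C.smul c (𝟙₂ (C.id₁ (C.src p)))) :
    C.i₁ (C.whisk L R p) ⊙ᵥ (C.i₁ (C.whisk L R p))⋆₂ =
      C.smul c (𝟙₂ (C.id₁ (C.src (C.whisk L R p)))) := by
  have h1 := congrArg (fun x => L ⊲₂ (x ⊳₂ R)) h
  simp (maxDischargeDepth := 12) at h1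
  simpa (maxDischargeDepth := 12) [whisk] using h1

end Whiskered

section Whiskered

variable {F : Type u} [Field F] {C : TwoCatData.{u, v₀, v₁, v₂} F} [IsSpherical C]
  [IsVectLinear C] {A D D' X Y Z Z' L R : C.Obj} {E : Finset C.Obj}

/-- If `p q*` vanishes, so does every 2-morphism `u (L ⊗ p ⊗ R) ⇒ u' (L ⊗ q ⊗ R)`. -/
theorem eq_zero_of_id_comp_dual {p : C.Hom1 X D} {q : C.Hom1 Y D}
    (hpq : 𝟙₂ (p.1 ≫₁ q.1⋆₁) = C.smul 0 (𝟙₂ (p.1 ≫₁ q.1⋆₁)))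
    (u : C.Hom1 A Z) (u' : C.Hom1 A Z') (hZ : Z = L ⊗₀ X ⊗₀ R) (hZ' : Z' = L ⊗₀ Y ⊗₀ R)
    {w w' : C.Hom1 A D'} (hw : w.1 = u.1 ≫₁ C.whisk L R p.1) (hw' : w'.1 = u'.1 ≫₁ C.whisk L R q.1)
    (Φ : Hom2 w w') : Φ = 0 := by
  have h := eq_zero_smul_of_comp_dual
    (whisk_comp_dual_zero L R (p.tgt_eq.trans q.tgt_eq.symm) hpq) (Φ.dom_eq.trans hw)
    (Φ.cod_eq.trans hw') (by rw [u.tgt_eq, src_whisk, p.src_eq, hZ])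
    (by rw [u'.tgt_eq, src_whisk, q.src_eq, hZ'])
    (by rw [tgt_whisk, tgt_whisk, p.tgt_eq, q.tgt_eq])
  exact (Subtype.ext h : Φ = (0 : F) • Φ).trans (zero_smul F Φ)

variable [IsNondegenerate C]

/-- Every 2-morphism `u (L ⊗ p ⊗ R) ⇒ u' (L ⊗ p ⊗ R)` is a whiskering. -/
theorem IsObjectBasis.exists_whiskering (hE : C.IsObjectBasis E) (hX : X ∈ E)
    {S : Finset (C.Hom1 X D)} (hS : IsMorphismBasis S) {p : C.Hom1 X D} (hp : p ∈ S)
    (u u' : C.Hom1 A Z) (hZ : Z = L ⊗₀ X ⊗₀ R)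
    {w w' : C.Hom1 A D'} (hw : w.1 = u.1 ≫₁ C.whisk L R p.1) (hw' : w'.1 = u'.1 ≫₁ C.whisk L R p.1)
    (Φ : Hom2 w w') : ∃ γ : Hom2 u u', Φ.1 = γ.1 ⊙ₕ 𝟙₂ (C.whisk L R p.1) := by
  obtain ⟨γ, h1, h2, h3⟩ := eq_whiskering_of_comp_dual
    (whisk_comp_dual_self L R (hE.id_comp_dual_self hX hS hp)) (Φ.dom_eq.trans hw)
    (Φ.cod_eq.trans hw') (by rw [u.tgt_eq, src_whisk, p.src_eq, hZ])
    (by rw [u'.tgt_eq, src_whisk, p.src_eq, hZ])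
  exact ⟨⟨γ, h1, h2⟩, h3⟩

/-- The trace of a whiskering. -/
theorem IsObjectBasis.tr_whiskering (hE : C.IsObjectBasis E) (hX : X ∈ E) (p : C.Hom1 X D)
    {u : C.Hom1 A Z} (hZ : Z = L ⊗₀ X ⊗₀ R) {w : C.Hom1 A D'}
    (hw : w.1 = u.1 ≫₁ C.whisk L R p.1) (χ : Hom2 u u) (ψ : Hom2 w w)
    (hψ : ψ.1 = χ.1 ⊙ₕ 𝟙₂ (C.whisk L R p.1)) :
    tr w ψ = dimq p / C.dimqObj X * tr u χ := by
  have hu : C.tgt u.1 = C.src (C.whisk L R p.1) := by rw [u.tgt_eq, src_whisk, p.src_eq, hZ]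
  have h1 : tr w ψ = tr u ((dimq p / C.dimqObj X) • χ) := by
    apply tr_eq_of_closureCell
    rw [← closureCell_ptr (f := u.1) (v := C.whisk L R p.1) (ψ.dom_eq.trans hw)
      (ψ.cod_eq.trans hw) hu, hψ]
    congr 1
    refine ptr_whiskering (whisk_unit_counit L R ?_) χ.dom_eq χ.cod_eq hu
    rw [hE.unit_counit hX p, p.src_eq]
  rw [h1, map_smul, smul_eq_mul]

/-- `u (L ⊗ p ⊗ R)` is simple if `u` and `p` belong to bases and `p` starts at a simple object. -/
theorem IsObjectBasis.exists_scalar_of_comp (hE : C.IsObjectBasis E) (hX : X ∈ E)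
    {S : Finset (C.Hom1 X D)} (hS : IsMorphismBasis S) {p : C.Hom1 X D} (hp : p ∈ S)
    {T : Finset (C.Hom1 A Z)} (hT : IsMorphismBasis T) {u : C.Hom1 A Z} (hu : u ∈ T)
    (hZ : Z = L ⊗₀ X ⊗₀ R) {w : C.Hom1 A D'} (hw : w.1 = u.1 ≫₁ C.whisk L R p.1) (Φ : Hom2 w w) :
    ∃ c : F, Φ = c • Hom2.id w := by
  obtain ⟨γ, hγ⟩ := hE.exists_whiskering hX hS hp u u hZ hw hw Φ
  obtain ⟨c, rfl⟩ := hT.exists_scalar hu γ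
  have h : C.tgt u.1 = C.src (C.whisk L R p.1) := by rw [u.tgt_eq, src_whisk, p.src_eq, hZ]
  refine ⟨c, Subtype.ext (hγ.trans ?_)⟩
  change C.smul c (𝟙₂ u.1) ⊙ₕ 𝟙₂ (C.whisk L R p.1) = C.smul c (𝟙₂ w.1)
  rw [smul_hcomp _ _ _ (by rw [dom_id₂, dom_id₂, h]), id₂_hcomp_id₂ _ _ h, hw]

/-- Such a 2-morphism is the whiskering of a 2-morphism `u ⇒ u'`, and there are none but zero
between distinct basis elements. -/
theorem IsObjectBasis.eq_zero_of_comp_ne (hE : C.IsObjectBasis E) (hX : X ∈ E)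
    {S : Finset (C.Hom1 X D)} (hS : IsMorphismBasis S) {p : C.Hom1 X D} (hp : p ∈ S)
    {T : Finset (C.Hom1 A Z)} (hT : IsMorphismBasis T) {u u' : C.Hom1 A Z} (hu : u ∈ T)
    (hu' : u' ∈ T) (huu' : u ≠ u') (hZ : Z = L ⊗₀ X ⊗₀ R) {w w' : C.Hom1 A D'}
    (hw : w.1 = u.1 ≫₁ C.whisk L R p.1) (hw' : w'.1 = u'.1 ≫₁ C.whisk L R p.1) (Φ : Hom2 w w') :
    Φ = 0 := by
  obtain ⟨γ, hγ⟩ := hE.exists_whiskering hX hS hp u u' hZ hw hw' Φ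
  have h : C.tgt u.1 = C.src (C.whisk L R p.1) := by rw [u.tgt_eq, src_whisk, p.src_eq, hZ]
  have h0 : γ = (0 : F) • γ := by rw [hT.eq_zero hu hu' huu' γ, smul_zero]
  have h1 : Φ.1 = C.smul 0 Φ.1 := by
    conv_lhs => rw [hγ, show γ.1 = C.smul 0 γ.1 from congrArg Subtype.val h0]
    rw [hγ, smul_hcomp _ _ _ (by rw [γ.dom_eq, dom_id₂, h])]
  exact (Subtype.ext h1 : Φ = (0 : F) • Φ).trans (zero_smul F Φ)

theorem IsObjectBasis.dimq_comp (hE : C.IsObjectBasis E) (hX : X ∈ E) (p : C.Hom1 X D)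
    {u : C.Hom1 A Z} (hZ : Z = L ⊗₀ X ⊗₀ R) {w : C.Hom1 A D'}
    (hw : w.1 = u.1 ≫₁ C.whisk L R p.1) : dimq w = dimq p / C.dimqObj X * dimq u := by
  have h : C.tgt u.1 = C.src (C.whisk L R p.1) := by rw [u.tgt_eq, src_whisk, p.src_eq, hZ]
  rw [dimq_eq_tr, dimq_eq_tr u, hE.tr_whiskering hX p hZ hw (Hom2.id u)]
  change 𝟙₂ w.1 = 𝟙₂ u.1 ⊙ₕ 𝟙₂ (C.whisk L R p.1)
  rw [id₂_hcomp_id₂ _ _ h, hw]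

end Whiskered

/-! ### Decomposition of identities -/

section Decomposition

variable {F : Type u} [Field F] {C : TwoCatData.{u, v₀, v₁, v₂} F} [IsVectLinear C]
  {A A' B B' D D' X Z L R : C.Obj}

/-- Generation is preserved by functors. -/
theorem _root_.GeneratedBy.map {S : Set (C.Hom1 A B)} {h : C.Hom1 A B} (H : GeneratedBy F S h)
    (G : C.Hom1 A B → C.Hom1 A' B') (m : ∀ f g : C.Hom1 A B, (f ⟶ g) →ₗ[F] (G f ⟶ G g))
    (hid : ∀ f, m f f (𝟙 f) = 𝟙 (G f))
    (hcomp : ∀ f g k (α : f ⟶ g) (β : g ⟶ k), m f k (α ≫ β) = m f g α ≫ m g k β) :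
    GeneratedBy F (G '' S) (G h) := by
  have h1 := Submodule.mem_map_of_mem (f := m h h) H
  rw [hid h, Submodule.map_span] at h1
  refine Submodule.span_mono ?_ h1
  rintro _ ⟨_, ⟨s, hs, a, b, rfl⟩, rfl⟩
  exact ⟨G s, ⟨s, hs, rfl⟩, m _ _ a, m _ _ b, hcomp _ _ _ a b⟩

attribute [local simp] src_cod tgt_cod src_id₁ tgt_id₁ src_comp tgt_comp dom_id₂ cod_id₂ dom_vcomp
  cod_vcomp dom_hcomp cod_hcomp src_tl tgt_tl dom_tl cod_tl src_tr tgt_tr dom_tr cod_tr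
  Hom1.src_eq Hom1.tgt_eq Hom2.dom_eq Hom2.cod_eq tl_add tr_add tl_smul tr_smul hcomp_add
  hcomp_smul

theorem _root_.GeneratedBy.precomp {S : Set (C.Hom1 A B)} {h : C.Hom1 A B} (H : GeneratedBy F S h)
    (f : C.Hom1 D A) : GeneratedBy F (f.comp '' S) (f.comp h) :=
  H.map _ (fun g k => Hom2.hcompₗ f f g k (Hom2.id f))
    (fun g => Subtype.ext (id₂_hcomp_id₂ _ _ (by simp)))
    (fun g k l α β => Subtype.ext (id_hcomp_vcomp (by simp) (by simp)))

theorem _root_.GeneratedBy.postcomp {S : Set (C.Hom1 A B)} {h : C.Hom1 A B} (H : GeneratedBy F S h)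
    (f : C.Hom1 B D) : GeneratedBy F ((·.comp f) '' S) (h.comp f) :=
  H.map _ (fun g k => (Hom2.hcompₗ g k f f).flip (Hom2.id f))
    (fun g => Subtype.ext (id₂_hcomp_id₂ _ _ (by simp)))
    (fun g k l α β => Subtype.ext (vcomp_hcomp_id (by simp) (by simp)))

/-- `P (L ⊗ f ⊗ R)` -/
def Hom1.compWhisk (P : C.Hom1 A Z) (hZ : Z = L ⊗₀ B ⊗₀ R) (f : C.Hom1 B D) :
    C.Hom1 A (L ⊗₀ D ⊗₀ R) :=
  ⟨P.1 ≫₁ C.whisk L R f.1, by simp [src_whisk, hZ], by simp [src_whisk, tgt_whisk, hZ]⟩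

theorem _root_.GeneratedBy.compWhisk {S : Set (C.Hom1 B D)} {h : C.Hom1 B D} (H : GeneratedBy F S h)
    (P : C.Hom1 A Z) (hZ : Z = L ⊗₀ B ⊗₀ R) :
    GeneratedBy F (P.compWhisk hZ '' S) (P.compWhisk hZ h) :=
  H.map _ (fun g k => Hom2.map (fun α => 𝟙₂ P.1 ⊙ₕ L ⊲₂ (α ⊳₂ R))
      (fun α => by simp [hZ, Hom1.compWhisk, whisk]) (fun α => by simp [hZ, Hom1.compWhisk, whisk])
      (fun α β => by simp [hZ])
      (fun c α => by simp [hZ]))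
    (fun g => Subtype.ext (by
      change 𝟙₂ P.1 ⊙ₕ L ⊲₂ (𝟙₂ g.1 ⊳₂ R) = 𝟙₂ (P.1 ≫₁ L ⊲₁ (g.1 ⊳₁ R))
      rw [tr_id₂, tl_id₂, id₂_hcomp_id₂ _ _ (by simp [hZ])]))
    (fun g k l α β => Subtype.ext (by
      change 𝟙₂ P.1 ⊙ₕ L ⊲₂ ((α.1 ⊙ᵥ β.1) ⊳₂ R) = _
      rw [tr_vcomp _ _ _ (by simp), tl_vcomp _ _ _ (by simp),
        id_hcomp_vcomp (by simp) (by simp [hZ])]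
      rfl))

/-- Every 1-morphism `A → L ⊗ D ⊗ R` is generated by the composites `u (L ⊗ p ⊗ R)`, with `p` in
the basis of `Hom(X, D)` and `u` in the basis of `Hom(A, L ⊗ X ⊗ R)`. -/
theorem IsObjectBasis.generatedBy_whisk {E : Finset C.Obj} (hE : C.IsObjectBasis E)
    {S : ∀ A A' : C.Obj, Finset (C.Hom1 A A')} (hS : ∀ A A' : C.Obj, IsMorphismBasis (S A A'))
    (ζ : C.Obj → C.Obj) (hζ : ∀ X, ζ X = L ⊗₀ X ⊗₀ R) (P : C.Hom1 A D')
    (hD : D' = L ⊗₀ D ⊗₀ R) :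
    GeneratedBy F {w : C.Hom1 A D' | ∃ X ∈ E, ∃ p ∈ S X D, ∃ u ∈ S A (ζ X),
      w.1 = u.1 ≫₁ C.whisk L R p.1} P := by
  subst hD
  -- The object `D` itself is resolved first: `1_D` is a direct sum of composites through simple
  -- objects `X`, and the second factors `X → D` are then resolved into basis elements.
  have h1 : GeneratedBy F {w : C.Hom1 D D | ∃ X ∈ E, ∃ (f : C.Hom1 D X), ∃ p ∈ S X D,
      w = f.comp p} (Hom1.id C D) := by
    obtain ⟨n, X, f, g, b, hX, ⟨hb⟩, ⟨e⟩⟩ := hE.exists_sum D D (Hom1.id C D)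
    have h2 : GeneratedBy F {w : C.Hom1 D D | ∃ X ∈ E, ∃ (f : C.Hom1 D X) (g : C.Hom1 X D),
        w = f.comp g} (Hom1.id C D) := by
      have h3 : 𝟙 (Hom1.id C D) = ∑ k, (e.inv ≫ b.π k) ≫ b.ι k ≫ e.hom := by
        have h4 := Limits.IsBilimit.total hb
        calc 𝟙 (Hom1.id C D) = e.inv ≫ 𝟙 b.pt ≫ e.hom := by simp
          _ = _ := by
            rw [← h4, Preadditive.sum_comp, Preadditive.comp_sum]
            simp
      unfold GeneratedBy
      rw [h3]
      exact Submodule.sum_mem _ fun k _ => Submodule.subset_span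
        ⟨_, ⟨X k, hX k, f k, g k, rfl⟩, _, _, rfl⟩
    refine h2.trans ?_
    rintro _ ⟨X, hX, f, g, rfl⟩
    refine GeneratedBy.mono (((hS X D).generatedBy g).precomp f) ?_
    rintro _ ⟨p, hp, rfl⟩
    exact ⟨X, hX, f, p, hp, rfl⟩
  have h2 := h1.compWhisk P rfl
  have hP : P.compWhisk rfl (Hom1.id C D) = P := Subtype.ext (by
    change P.1 ≫₁ L ⊲₁ (C.id₁ D ⊳₁ R) = P.1
    rw [tr_id₁, tl_id₁, comp_id_of P.tgt_eq])
  rw [hP] at h2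
  refine h2.trans ?_
  rintro _ ⟨_, ⟨X, hX, f, p, hp, rfl⟩, rfl⟩
  -- What remains in front of `L ⊗ p ⊗ R`, namely `P (L ⊗ f ⊗ R)`, is decomposed in turn into basis
  -- elements.
  have h3 := ((hS A (L ⊗₀ X ⊗₀ R)).generatedBy (P.compWhisk rfl f)).postcomp
    ((p.tr R).tl L)
  have h4 : (P.compWhisk rfl f).comp ((p.tr R).tl L) = P.compWhisk rfl (f.comp p) :=
    Subtype.ext (by
      change (P.1 ≫₁ L ⊲₁ (f.1 ⊳₁ R)) ≫₁ L ⊲₁ (p.1 ⊳₁ R) = P.1 ≫₁ L ⊲₁ ((f.1 ≫₁ p.1) ⊳₁ R)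
      rw [tr_comp _ _ _ (by simp), tl_comp _ _ _ (by simp), comp_assoc _ _ _ (by simp) (by simp)])
  rw [h4] at h3
  refine h3.mono ?_
  rintro _ ⟨u, hu, rfl⟩
  -- `ζ X` equals `L ⊗ X ⊗ R` only propositionally (one of `L`, `R` may be the unit), so the basis
  -- element is transported along that equality.
  obtain ⟨u', hu', h5⟩ : ∃ u' ∈ S A (ζ X), u'.1 = u.1 := by
    generalize ζ X = Z, hζ X = hZ
    subst hZ
    exact ⟨u, hu, rfl⟩
  exact ⟨X, hX, p, hp, u', hu', by rw [h5]; rfl⟩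

end Decomposition

/-! ### Pairings of glued 2-morphisms, and spanning -/

section Orthogonality

variable {F : Type u} [Field F] {C : TwoCatData.{u, v₀, v₁, v₂} F} [IsSpherical C]
  [IsVectLinear C] {e₀₁ e₀₂ e₀₃ e₀₄ e₁₂ e₁₃ e₁₃' e₁₄ e₂₃ e₂₄ e₃₄ : C.Obj}
  {f₀₁₂ : C.Hom1 e₀₂ (e₁₂ ⊗₀ e₀₁)} {f₀₁₃ : C.Hom1 e₀₃ (e₁₃ ⊗₀ e₀₁)}
  {f₀₁₃' : C.Hom1 e₀₃ (e₁₃' ⊗₀ e₀₁)}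
  {f₀₁₄ : C.Hom1 e₀₄ (e₁₄ ⊗₀ e₀₁)} {f₀₂₃ : C.Hom1 e₀₃ (e₂₃ ⊗₀ e₀₂)}
  {f₀₂₄ f₀₂₄' : C.Hom1 e₀₄ (e₂₄ ⊗₀ e₀₂)} {f₀₃₄ : C.Hom1 e₀₄ (e₃₄ ⊗₀ e₀₃)}
  {f₁₂₃ : C.Hom1 e₁₃ (e₂₃ ⊗₀ e₁₂)} {f₁₂₃' : C.Hom1 e₁₃' (e₂₃ ⊗₀ e₁₂)}
  {f₁₂₄ : C.Hom1 e₁₄ (e₂₄ ⊗₀ e₁₂)}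
  {f₁₃₄ : C.Hom1 e₁₄ (e₃₄ ⊗₀ e₁₃)} {f₁₃₄' : C.Hom1 e₁₄ (e₃₄ ⊗₀ e₁₃')}
  {f₂₃₄ : C.Hom1 e₂₄ (e₃₄ ⊗₀ e₂₃)}

attribute [local simp] src_cod tgt_cod src_id₁ tgt_id₁ src_comp tgt_comp dom_id₂ cod_id₂ dom_vcomp
  cod_vcomp dom_hcomp cod_hcomp comp_assoc
  src_tl tgt_tl dom_tl cod_tl src_tr tgt_tr dom_tr cod_tr
  src_d₁ tgt_d₁ dom_d₂ cod_d₂ src_i₀ tgt_i₀ src_e₀ tgt_e₀ dom_i₁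
  cod_i₁ dom_e₁ cod_e₁ d₀_d₀ d₁_d₁ d₂_d₂ d₁_comp d₁_tr d₁_tl d₁_id₁ d₂_id₂ e₀_d₀ tr_comp tl_comp
  dom_tau cod_tau i₁_d₁ e₁_d₁ tl_id₁ tr_id₁ tensor_assoc tl₁_tl₁ tl₁_tr₁ tr₁_tr₁ one_tensor
  tensor_one

attribute [local simp] hcomp_assoc vcomp_assoc id_hcomp_vcomp vcomp_hcomp_id id₂_hcomp_id₂
  id_hcomp_id_hcomp tl_id₂ tr_id₂ id_vcomp_of vcomp_id_of id_hcomp_of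
  hcomp_id_of

attribute [local simp] comp_id_of id_comp_of i₁_tl i₁_tr e₁_tl e₁_tr tl_vcomp tr_vcomp tl_hcomp
  tr_hcomp d₂_tl d₂_tr

attribute [local simp] Hom1.src_eq Hom1.tgt_eq Hom2.dom_eq Hom2.cod_eq

attribute [local simp] dom_smul cod_smul tl_smul tr_smul smul_hcomp hcomp_smul smul_vcomp vcomp_smul

attribute [local simp] tl₂_tl₂ tl₂_tr₂ tr₂_tr₂

attribute [local simp] leftMor₄ rightMor₄ midMor midMor₁ midMor₂ leftMor rightMor Hom1.comp Hom1.tl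
  Hom1.tr Hom1.retarget

/-- `μ ↦ μ ∘ (f₂₃₄ ⊗ e₀₂)` -/
def whiskerRightMor (f₀₂₄ f₀₂₄' : C.Hom1 e₀₄ (e₂₄ ⊗₀ e₀₂)) (f₂₃₄ : C.Hom1 e₂₄ (e₃₄ ⊗₀ e₂₃)) :
    Hom2 f₀₂₄ f₀₂₄' →ₗ[F] Hom2 (rightMor f₀₂₄ f₂₃₄) (rightMor f₀₂₄' f₂₃₄) :=
  Hom2.map (fun μ => μ ⊙ₕ 𝟙₂ (f₂₃₄.1 ⊳₁ e₀₂)) (fun _ => by simp) (fun _ => by simp)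
    (fun _ _ => by simp [add_hcomp]) (fun _ _ => by simp [smul_hcomp])

theorem whiskerRightMor_id (f₀₂₄ : C.Hom1 e₀₄ (e₂₄ ⊗₀ e₀₂)) (f₂₃₄ : C.Hom1 e₂₄ (e₃₄ ⊗₀ e₂₃)) :
    whiskerRightMor f₀₂₄ f₀₂₄ f₂₃₄ (Hom2.id f₀₂₄) = Hom2.id (rightMor f₀₂₄ f₂₃₄) :=
  Subtype.ext (id₂_hcomp_id₂ _ _ (by simp))

/-- The partial trace of a 2-morphism `f_{(012)4} ⇒ f'_{(012)4}`. -/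
def ptrLeftMor (χ : Hom2 (leftMor f₀₁₂ f₀₂₄) (leftMor f₀₁₂ f₀₂₄')) : Hom2 f₀₂₄ f₀₂₄' :=
  ⟨C.ptr f₀₂₄.1 f₀₂₄'.1 (e₂₄ ⊲₁ f₀₁₂.1) χ.1,
    dom_ptr χ.dom_eq χ.cod_eq (by simp) (by simp), cod_ptr χ.dom_eq χ.cod_eq (by simp) (by simp)⟩

theorem tr_ptrLeftMor (χ : Hom2 (leftMor f₀₁₂ f₀₂₄) (leftMor f₀₁₂ f₀₂₄)) :
    tr f₀₂₄ (ptrLeftMor χ) = tr _ χ :=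
  tr_eq_of_closureCell (closureCell_ptr χ.dom_eq χ.cod_eq (by simp))

/-- The tensorators in `βδ` and `δ'β'` conjugate `δδ'`; by `closureCell_tau`, closing `f₀₁₂` cancels
them. Only the partial trace `f₀₂₄ ⇒ f₀₂₄'` of `δδ'` survives between `β` and `β'`. -/
theorem pairing_betaDelta_eq_tr
    (β : StateSpace f₀₂₃ f₀₂₄ f₀₃₄ f₂₃₄) (δ : StateSpace f₀₁₂ f₀₁₄ f₀₂₄ f₁₂₄)
    (β' : DualStateSpace f₀₂₃ f₀₂₄' f₀₃₄ f₂₃₄) (δ' : DualStateSpace f₀₁₂ f₀₁₄ f₀₂₄' f₁₂₄) :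
    pairing _ _ (betaDelta f₀₁₂ f₀₁₄ f₀₂₃ f₀₂₄ f₀₃₄ f₁₂₄ f₂₃₄ (β ⊗ₜ δ))
      (deltaBeta f₀₁₂ f₀₁₄ f₀₂₃ f₀₂₄' f₀₃₄ f₁₂₄ f₂₃₄ (β' ⊗ₜ δ')) =
    tr _ (Hom2.vcompₗ _ _ _ β (Hom2.vcompₗ _ _ _
      (whiskerRightMor f₀₂₄ f₀₂₄' f₂₃₄ (ptrLeftMor (Hom2.vcompₗ _ _ _ δ δ'))) β')) := by
  rw [pairing_eq_tr]
  apply tr_eq_of_closureCell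
  have h := closureCell_tau (h := (leftMor f₀₂₃ f₀₃₄).1) (f := f₀₂₄.1) (f' := f₀₂₄'.1)
    (p := f₂₃₄.1) (q := f₀₁₂.1) (β := β.1) (β' := β'.1) (χ := δ.1 ⊙ᵥ δ'.1)
    β.dom_eq (β.cod_eq.trans (by simp)) (by simp) (by simp) (β'.dom_eq.trans (by simp)) β'.cod_eq
    (by simp) (by simp) (by simp)
  refine Eq.trans ?_ (h.trans ?_)
  · congr 1
    change (((β.1 ⊙ₕ 𝟙₂ (e₃₄ ⊲₁ e₂₃ ⊲₁ f₀₁₂.1)) ⊙ᵥ (𝟙₂ f₀₂₄.1 ⊙ₕ C.tau f₂₃₄.1 f₀₁₂.1)) ⊙ᵥ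
      (δ.1 ⊙ₕ 𝟙₂ (f₂₃₄.1 ⊳₁ (e₁₂ ⊗₀ e₀₁)))) ⊙ᵥ ((δ'.1 ⊙ₕ 𝟙₂ (f₂₃₄.1 ⊳₁ (e₁₂ ⊗₀ e₀₁))) ⊙ᵥ
      (𝟙₂ f₀₂₄'.1 ⊙ₕ (C.tau f₂₃₄.1 f₀₁₂.1)⋆₂) ⊙ᵥ (β'.1 ⊙ₕ 𝟙₂ (e₃₄ ⊲₁ e₂₃ ⊲₁ f₀₁₂.1))) = _
    simp (maxDischargeDepth := 12)
  · congr 1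
    change _ = β.1 ⊙ᵥ (C.ptr f₀₂₄.1 f₀₂₄'.1 (e₂₄ ⊲₁ f₀₁₂.1) (δ.1 ⊙ᵥ δ'.1) ⊙ₕ
      𝟙₂ (f₂₃₄.1 ⊳₁ e₀₂)) ⊙ᵥ β'.1
    rw [f₂₃₄.src_eq, f₀₁₂.src_eq]

section Whiskering

variable {A D D' Z L R : C.Obj}

theorem Hom2.vcompₗ_assoc {f g h k : C.Hom1 A D} (α : Hom2 f g) (β : Hom2 g h) (γ : Hom2 h k) :
    Hom2.vcompₗ _ _ _ (Hom2.vcompₗ _ _ _ α β) γ = Hom2.vcompₗ _ _ _ α (Hom2.vcompₗ _ _ _ β γ) :=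
  Subtype.ext (vcomp_assoc _ _ _ (by simp) (by simp))

/-- `φ ↦ f ∘ (L ⊗ φ)` -/
def whiskerTl (f : C.Hom1 A (L ⊗₀ Z)) {g g' : C.Hom1 Z D} {k k' : C.Hom1 A D'}
    (hk : k.1 = f.1 ≫₁ L ⊲₁ g.1) (hk' : k'.1 = f.1 ≫₁ L ⊲₁ g'.1) : Hom2 g g' →ₗ[F] Hom2 k k' :=
  Hom2.map (fun φ => 𝟙₂ f.1 ⊙ₕ L ⊲₂ φ) (fun _ => by simp [hk]) (fun _ => by simp [hk'])
    (fun _ _ => by simp [tl_add, hcomp_add]) (fun _ _ => by simp)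

/-- `φ ↦ f ∘ (φ ⊗ R)` -/
def whiskerTr (f : C.Hom1 A (Z ⊗₀ R)) {g g' : C.Hom1 Z D} {k k' : C.Hom1 A D'}
    (hk : k.1 = f.1 ≫₁ g.1 ⊳₁ R) (hk' : k'.1 = f.1 ≫₁ g'.1 ⊳₁ R) : Hom2 g g' →ₗ[F] Hom2 k k' :=
  Hom2.map (fun φ => 𝟙₂ f.1 ⊙ₕ φ ⊳₂ R) (fun _ => by simp [hk]) (fun _ => by simp [hk'])
    (fun _ _ => by simp [tr_add, hcomp_add]) (fun _ _ => by simp)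

theorem whiskerTl_vcompₗ (f : C.Hom1 A (L ⊗₀ Z)) {g g' g'' : C.Hom1 Z D} {k k' k'' : C.Hom1 A D'}
    (hk : k.1 = f.1 ≫₁ L ⊲₁ g.1) (hk' : k'.1 = f.1 ≫₁ L ⊲₁ g'.1) (hk'' : k''.1 = f.1 ≫₁ L ⊲₁ g''.1)
    (α : Hom2 g g') (β : Hom2 g' g'') :
    Hom2.vcompₗ _ _ _ (whiskerTl f hk hk' α) (whiskerTl f hk' hk'' β) =
      whiskerTl f hk hk'' (Hom2.vcompₗ _ _ _ α β) :=
  Subtype.ext (by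
    change (𝟙₂ f.1 ⊙ₕ L ⊲₂ α.1) ⊙ᵥ (𝟙₂ f.1 ⊙ₕ L ⊲₂ β.1) = 𝟙₂ f.1 ⊙ₕ L ⊲₂ (α.1 ⊙ᵥ β.1)
    simp)

theorem whiskerTr_vcompₗ (f : C.Hom1 A (Z ⊗₀ R)) {g g' g'' : C.Hom1 Z D} {k k' k'' : C.Hom1 A D'}
    (hk : k.1 = f.1 ≫₁ g.1 ⊳₁ R) (hk' : k'.1 = f.1 ≫₁ g'.1 ⊳₁ R) (hk'' : k''.1 = f.1 ≫₁ g''.1 ⊳₁ R)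
    (α : Hom2 g g') (β : Hom2 g' g'') :
    Hom2.vcompₗ _ _ _ (whiskerTr f hk hk' α) (whiskerTr f hk' hk'' β) =
      whiskerTr f hk hk'' (Hom2.vcompₗ _ _ _ α β) :=
  Subtype.ext (by
    change (𝟙₂ f.1 ⊙ₕ α.1 ⊳₂ R) ⊙ᵥ (𝟙₂ f.1 ⊙ₕ β.1 ⊳₂ R) = 𝟙₂ f.1 ⊙ₕ (α.1 ⊙ᵥ β.1) ⊳₂ R
    simp)

theorem whiskerTl_id (f : C.Hom1 A (L ⊗₀ Z)) {g : C.Hom1 Z D} {k : C.Hom1 A D'}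
    (hk : k.1 = f.1 ≫₁ L ⊲₁ g.1) : whiskerTl f hk hk (Hom2.id g) = Hom2.id k :=
  Subtype.ext (by
    change 𝟙₂ f.1 ⊙ₕ L ⊲₂ 𝟙₂ g.1 = 𝟙₂ k.1
    simp [hk])

theorem whiskerTr_id (f : C.Hom1 A (Z ⊗₀ R)) {g : C.Hom1 Z D} {k : C.Hom1 A D'}
    (hk : k.1 = f.1 ≫₁ g.1 ⊳₁ R) : whiskerTr f hk hk (Hom2.id g) = Hom2.id k :=
  Subtype.ext (by
    change 𝟙₂ f.1 ⊙ₕ 𝟙₂ g.1 ⊳₂ R = 𝟙₂ k.1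
    simp [hk])

end Whiskering

/-- With the unit object on one side, both kinds of composite take the uniform form `u (L ⊗ p ⊗ R)`
of the whiskering lemmas. -/
theorem leftMor_eq_whisk (f₁₂₃ : C.Hom1 e₁₃ (e₂₃ ⊗₀ e₁₂)) (f₁₃₄ : C.Hom1 e₁₄ (e₃₄ ⊗₀ e₁₃)) :
    (TwoCatData.leftMor f₁₂₃ f₁₃₄).1 = f₁₃₄.1 ≫₁ C.whisk e₃₄ C.one f₁₂₃.1 := by
  simp [whisk, tr₁_one]

theorem rightMor_eq_whisk (f₁₂₄ : C.Hom1 e₁₄ (e₂₄ ⊗₀ e₁₂)) (f₂₃₄ : C.Hom1 e₂₄ (e₃₄ ⊗₀ e₂₃)) :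
    (TwoCatData.rightMor f₁₂₄ f₂₃₄).1 = f₁₂₄.1 ≫₁ C.whisk C.one e₁₂ f₂₃₄.1 := by
  simp [whisk, one_tl₁]

/-- The composite is bracketed so that its last two factors form a face of a tetrahedron, on which
`ε` or `α` acts; likewise for the next three. -/
theorem midMor₁_eq_tl : (midMor₁ f₀₁₃ f₀₃₄ f₁₂₃).1 = f₀₃₄.1 ≫₁ e₃₄ ⊲₁ (rightMor f₀₁₃ f₁₂₃).1 := by
  simp

theorem midMor₂_eq_tr : (midMor₂ f₀₁₄ f₁₂₃ f₁₃₄).1 = f₀₁₄.1 ≫₁ (leftMor f₁₂₃ f₁₃₄).1 ⊳₁ e₀₁ := by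
  simp

theorem leftMor₄_eq_tl : (leftMor₄ f₀₁₂ f₀₂₃ f₀₃₄).1 = f₀₃₄.1 ≫₁ e₃₄ ⊲₁ (leftMor f₀₁₂ f₀₂₃).1 := by
  simp

theorem rightMor₄_eq_tr : (rightMor₄ f₀₁₄ f₁₂₄ f₂₃₄).1 =
    f₀₁₄.1 ≫₁ (rightMor f₁₂₄ f₂₃₄).1 ⊳₁ e₀₁ := by
  simp

/-- In the trace of `ε γ α α' γ' ε'`, cyclicity moves `ε` to the end. The 2-morphism `αα'` and, by
rotation, `ε'ε` then become adjacent pairs. -/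
theorem pairing_epsGammaAlpha_eq_tr
    (α : StateSpace f₁₂₃ f₁₂₄ f₁₃₄ f₂₃₄) (γ : StateSpace f₀₁₃ f₀₁₄ f₀₃₄ f₁₃₄)
    (ε : StateSpace f₀₁₂ f₀₁₃ f₀₂₃ f₁₂₃) (α' : DualStateSpace f₁₂₃' f₁₂₄ f₁₃₄' f₂₃₄)
    (γ' : DualStateSpace f₀₁₃' f₀₁₄ f₀₃₄ f₁₃₄') (ε' : DualStateSpace f₀₁₂ f₀₁₃' f₀₂₃ f₁₂₃') :
    pairing _ _ (epsGammaAlpha f₀₁₂ f₀₁₃ f₀₁₄ f₀₂₃ f₀₃₄ f₁₂₃ f₁₂₄ f₁₃₄ f₂₃₄ (α ⊗ₜ (γ ⊗ₜ ε)))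
      (alphaGammaEps f₀₁₂ f₀₁₃' f₀₁₄ f₀₂₃ f₀₃₄ f₁₂₃' f₁₂₄ f₁₃₄' f₂₃₄ (α' ⊗ₜ (γ' ⊗ₜ ε'))) =
    tr _ (Hom2.vcompₗ _ _ _ (glueγ f₀₁₃ f₀₁₄ f₀₃₄ f₁₂₃ f₁₃₄ γ) (Hom2.vcompₗ _ _ _
      (whiskerTr f₀₁₄ midMor₂_eq_tr midMor₂_eq_tr (Hom2.vcompₗ _ _ _ α α')) (Hom2.vcompₗ _ _ _
        (glueγ' f₀₁₃' f₀₁₄ f₀₃₄ f₁₂₃' f₁₃₄' γ')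
        (whiskerTl f₀₃₄ midMor₁_eq_tl midMor₁_eq_tl (Hom2.vcompₗ _ _ _ ε' ε))))) := by
  rw [← whiskerTl_vcompₗ f₀₃₄ midMor₁_eq_tl leftMor₄_eq_tl midMor₁_eq_tl,
    ← whiskerTr_vcompₗ f₀₁₄ midMor₂_eq_tr rightMor₄_eq_tr midMor₂_eq_tr]
  simp only [← Hom2.vcompₗ_assoc]
  rw [tr_cyclic]
  simp only [Hom2.vcompₗ_assoc]
  rw [pairing_eq_tr]
  change tr _ (Hom2.vcompₗ _ _ _ (Hom2.vcompₗ _ _ _ (Hom2.vcompₗ _ _ _ _ _) _) (Hom2.vcompₗ _ _ _ _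
    (Hom2.vcompₗ _ _ _ _ _))) = _
  simp only [Hom2.vcompₗ_assoc]
  rfl

theorem pairing_betaDelta_deltaBeta_of_ne {S : Finset (C.Hom1 e₀₄ (e₂₄ ⊗₀ e₀₂))}
    (hS : IsMorphismBasis S) (hf : f₀₂₄ ∈ S) (hf' : f₀₂₄' ∈ S) (hne : f₀₂₄ ≠ f₀₂₄')
    (β : StateSpace f₀₂₃ f₀₂₄ f₀₃₄ f₂₃₄) (δ : StateSpace f₀₁₂ f₀₁₄ f₀₂₄ f₁₂₄)
    (β' : DualStateSpace f₀₂₃ f₀₂₄' f₀₃₄ f₂₃₄) (δ' : DualStateSpace f₀₁₂ f₀₁₄ f₀₂₄' f₁₂₄) :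
    pairing _ _ (betaDelta f₀₁₂ f₀₁₄ f₀₂₃ f₀₂₄ f₀₃₄ f₁₂₄ f₂₃₄ (β ⊗ₜ δ))
      (deltaBeta f₀₁₂ f₀₁₄ f₀₂₃ f₀₂₄' f₀₃₄ f₁₂₄ f₂₃₄ (β' ⊗ₜ δ')) = 0 := by
  rw [pairing_betaDelta_eq_tr, hS.eq_zero hf hf' hne (ptrLeftMor _)]
  simp only [map_zero, LinearMap.zero_apply]

/-- The partial trace of `δδ'` is a scalar `c` on the simple `f₀₂₄`. The left pairing is `c⟨β, β'⟩`,
while `⟨δ, δ'⟩ = c dimq f₀₂₄`. -/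
theorem pairing_betaDelta_deltaBeta {S : Finset (C.Hom1 e₀₄ (e₂₄ ⊗₀ e₀₂))}
    (hS : IsMorphismBasis S) (hf : f₀₂₄ ∈ S)
    (β : StateSpace f₀₂₃ f₀₂₄ f₀₃₄ f₂₃₄) (δ : StateSpace f₀₁₂ f₀₁₄ f₀₂₄ f₁₂₄)
    (β' : DualStateSpace f₀₂₃ f₀₂₄ f₀₃₄ f₂₃₄) (δ' : DualStateSpace f₀₁₂ f₀₁₄ f₀₂₄ f₁₂₄) :
    dimq f₀₂₄ * pairing _ _ (betaDelta f₀₁₂ f₀₁₄ f₀₂₃ f₀₂₄ f₀₃₄ f₁₂₄ f₂₃₄ (β ⊗ₜ δ))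
      (deltaBeta f₀₁₂ f₀₁₄ f₀₂₃ f₀₂₄ f₀₃₄ f₁₂₄ f₂₃₄ (β' ⊗ₜ δ')) =
      pairing _ _ β β' * pairing _ _ δ δ' := by
  obtain ⟨c, hc⟩ := hS.exists_scalar hf (ptrLeftMor (Hom2.vcompₗ _ _ _ δ δ'))
  rw [pairing_betaDelta_eq_tr, pairing_eq_tr δ, ← tr_ptrLeftMor (Hom2.vcompₗ _ _ _ δ δ'), hc,
    tr_smul_id, map_smul,
    whiskerRightMor_id, map_smul, LinearMap.smul_apply, Hom2.id_vcompₗ, map_smul, map_smul,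
    ← pairing_eq_tr, smul_eq_mul]
  ring

/-- Bending `f₂₃₄` around turns `Φ` into a 2-morphism out of `h (e₂₄ ⊗ f₀₁₂)` with `h : e₀₄ → e₂₄ ⊗
e₀₂`. The identity of `h` is a sum through basis elements `f₀₂₄`, and each summand, bent back, is
some `βδ`. -/
theorem eq_top_of_betaDelta_mem {S : Finset (C.Hom1 e₀₄ (e₂₄ ⊗₀ e₀₂))}
    (hS : IsMorphismBasis S)
    (N : Submodule F (Hom2 (leftMor₄ f₀₁₂ f₀₂₃ f₀₃₄) (rightMor₄ f₀₁₄ f₁₂₄ f₂₃₄)))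
    (hN : ∀ f₀₂₄ ∈ S, ∀ w, betaDelta f₀₁₂ f₀₁₄ f₀₂₃ f₀₂₄ f₀₃₄ f₁₂₄ f₂₃₄ w ∈ N) : N = ⊤ := by
  refine eq_top_iff.2 fun Φ _ => ?_
  have hd : C.dom Φ.1 = (leftMor f₀₂₃ f₀₃₄).1 ≫₁ C.tgt f₂₃₄.1 ⊲₁ f₀₁₂.1 :=
    Φ.dom_eq.trans (by simp)
  have hc : C.cod Φ.1 = (rightMor f₀₁₄ f₁₂₄).1 ≫₁ f₂₃₄.1 ⊳₁ C.tgt f₀₁₂.1 :=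
    Φ.cod_eq.trans (by simp)
  let h : C.Hom1 e₀₄ (e₂₄ ⊗₀ e₀₂) :=
    ⟨(leftMor f₀₂₃ f₀₃₄).1 ≫₁ f₂₃₄.1⋆₁ ⊳₁ e₀₂, by simp, by simp⟩
  let Ψ := C.tauMate (leftMor f₀₂₃ f₀₃₄).1 (rightMor f₀₁₄ f₁₂₄).1 f₂₃₄.1 f₀₁₂.1 Φ.1
  have hh : h.1 = f₀₃₄.1 ≫₁ (e₃₄ ⊲₁ f₀₂₃.1) ≫₁ f₂₃₄.1⋆₁ ⊳₁ e₀₂ := by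
    simp (maxDischargeDepth := 12) [h]
  have hd' := hd
  have hc' := hc
  simp (maxDischargeDepth := 12) at hd' hc'
  have hΨ : C.dom Ψ = f₀₃₄.1 ≫₁ (e₃₄ ⊲₁ f₀₂₃.1) ≫₁ f₂₃₄.1⋆₁ ⊳₁ e₀₂ ≫₁ e₂₄ ⊲₁ f₀₁₂.1 := by
    simp (maxDischargeDepth := 12) [Ψ, tauMate, hd', hc']
  have hΨ' : C.cod Ψ = f₀₁₄.1 ≫₁ f₁₂₄.1 ⊳₁ e₀₁ := by
    simp (maxDischargeDepth := 12) [Ψ, tauMate, hd', hc']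
  have hφd : ∀ φ : Hom2 h h, C.dom φ.1 = f₀₃₄.1 ≫₁ (e₃₄ ⊲₁ f₀₂₃.1) ≫₁ f₂₃₄.1⋆₁ ⊳₁ e₀₂ :=
    fun φ => φ.dom_eq.trans hh
  have hφc : ∀ φ : Hom2 h h, C.cod φ.1 = f₀₃₄.1 ≫₁ (e₃₄ ⊲₁ f₀₂₃.1) ≫₁ f₂₃₄.1⋆₁ ⊳₁ e₀₂ :=
    fun φ => φ.cod_eq.trans hh
  -- Bending back after inserting an endomorphism of `h`: linear in the inserted 2-morphism, with
  -- value `Φ` at the identity.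
  let Θ : (h ⟶ h) →ₗ[F] Hom2 (leftMor₄ f₀₁₂ f₀₂₃ f₀₃₄) (rightMor₄ f₀₁₄ f₁₂₄ f₂₃₄) :=
    Hom2.map (fun φ => (𝟙₂ (leftMor f₀₂₃ f₀₃₄).1 ⊙ₕ (C.e₁ f₂₃₄.1)⋆₂ ⊳₂ e₀₂ ⊙ₕ
          𝟙₂ (C.tgt f₂₃₄.1 ⊲₁ f₀₁₂.1)) ⊙ᵥ
        (𝟙₂ h.1 ⊙ₕ C.tau f₂₃₄.1 f₀₁₂.1) ⊙ᵥ
        (((φ ⊙ₕ 𝟙₂ (e₂₄ ⊲₁ f₀₁₂.1)) ⊙ᵥ Ψ) ⊙ₕ 𝟙₂ (f₂₃₄.1 ⊳₁ C.tgt f₀₁₂.1)))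
      (fun φ => by simp (maxDischargeDepth := 12) [hh, hφd, hφc, hΨ, hΨ'])
      (fun φ => by simp (maxDischargeDepth := 12) [hh, hφd, hφc, hΨ, hΨ'])
      (fun φ ψ => by
        simp (maxDischargeDepth := 12) [hh, hφd, hφc, hΨ, hΨ', add_hcomp, add_vcomp, vcomp_add,
          dom_add, cod_add])
      (fun c φ => by simp (maxDischargeDepth := 12) [hh, hφd, hφc, hΨ, hΨ'])
  have h1 : Θ (𝟙 h) = Φ := by
    apply Subtype.ext
    have h2 := tauMate_spec hd hc (by simp) (by simp)
    refine Eq.trans ?_ h2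
    change _ ⊙ᵥ _ ⊙ᵥ (((𝟙₂ h.1 ⊙ₕ 𝟙₂ (e₂₄ ⊲₁ f₀₁₂.1)) ⊙ᵥ Ψ) ⊙ₕ _) = _ ⊙ᵥ _ ⊙ᵥ (Ψ ⊙ₕ _)
    rw [id₂_hcomp_id₂ _ _ (by simp), id_vcomp_of (by simp (maxDischargeDepth := 12) [hΨ, hh])]
    simp [h]
  have h2 : Submodule.span F {φ : h ⟶ h | ∃ s ∈ (S : Set (C.Hom1 e₀₄ (e₂₄ ⊗₀ e₀₂))),
      ∃ (a : h ⟶ s) (b : s ⟶ h), φ = a ≫ b} ≤ N.comap Θ := by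
    refine Submodule.span_le.2 ?_
    rintro _ ⟨f, hf, a, b, rfl⟩
    have ha : C.dom a.1 = f₀₃₄.1 ≫₁ (e₃₄ ⊲₁ f₀₂₃.1) ≫₁ f₂₃₄.1⋆₁ ⊳₁ e₀₂ :=
      (Hom2.dom_eq (f := h) a).trans hh
    have ha' : C.cod a.1 = f.1 := Hom2.cod_eq (f := h) a
    have hb : C.dom b.1 = f.1 := Hom2.dom_eq (g := h) b
    have hb' : C.cod b.1 = f₀₃₄.1 ≫₁ (e₃₄ ⊲₁ f₀₂₃.1) ≫₁ f₂₃₄.1⋆₁ ⊳₁ e₀₂ :=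
      (Hom2.cod_eq (g := h) b).trans hh
    have h3 := tauMate_factor (h := (leftMor f₀₂₃ f₀₃₄).1) (p := f₂₃₄.1) (q := f₀₁₂.1) (Ψ := Ψ)
      (a := a.1) (b := b.1) (f := f.1) (by simp [ha]) ha' hb (by simp [hb'])
      (by simp (maxDischargeDepth := 12) [hΨ]) (by simp) (by simp)
    have h4 := hN f hf (⟨(𝟙₂ (leftMor f₀₂₃ f₀₃₄).1 ⊙ₕ (C.e₁ f₂₃₄.1)⋆₂ ⊳₂ e₀₂) ⊙ᵥ
        (a.1 ⊙ₕ 𝟙₂ (f₂₃₄.1 ⊳₁ e₀₂)), by simp (maxDischargeDepth := 12) [ha, ha'],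
          by simp (maxDischargeDepth := 12) [ha, ha']⟩ ⊗ₜ
      ⟨(b.1 ⊙ₕ 𝟙₂ (e₂₄ ⊲₁ f₀₁₂.1)) ⊙ᵥ Ψ, by simp (maxDischargeDepth := 12) [hb, hb', hΨ],
        by simp (maxDischargeDepth := 12) [hb, hb', hΨ, hΨ']⟩)
    change Θ (a ≫ b) ∈ N
    convert h4 using 1
    apply Subtype.ext
    refine Eq.trans ?_ (h3.trans ?_)
    · change _ ⊙ᵥ _ ⊙ᵥ ((((a.1 ⊙ᵥ b.1) ⊙ₕ _) ⊙ᵥ Ψ) ⊙ₕ _) = _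
      simp [h]
    · change _ = (((_ ⊙ᵥ _) ⊙ₕ 𝟙₂ (e₃₄ ⊲₁ e₂₃ ⊲₁ f₀₁₂.1)) ⊙ᵥ _) ⊙ᵥ
        (((b.1 ⊙ₕ 𝟙₂ (e₂₄ ⊲₁ f₀₁₂.1)) ⊙ᵥ Ψ) ⊙ₕ 𝟙₂ (f₂₃₄.1 ⊳₁ (e₁₂ ⊗₀ e₀₁)))
      rw [f₂₃₄.src_eq, f₂₃₄.tgt_eq, f₀₁₂.src_eq, f₀₁₂.tgt_eq, tl₁_tl₁]
  rw [← h1]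
  exact h2 (hS.generatedBy h)

variable [IsNondegenerate C] {E : Finset C.Obj} (hE : C.IsObjectBasis E)
  {B : ∀ A A' : C.Obj, Finset (C.Hom1 A A')}
  (hB : ∀ A A' : C.Obj, IsMorphismBasis (B A A'))

include hE hB

/-- A difference in `e₁₃`, `f₁₂₃` or `f₁₃₄` makes `αα'` vanish. If these agree, then `f₀₁₃` differs
and `ε'ε` vanishes. -/
theorem pairing_epsGammaAlpha_alphaGammaEps_of_ne (he : e₁₃ ∈ E) (he' : e₁₃' ∈ E)
    (h₀₁₃ : f₀₁₃ ∈ B _ _) (h₀₁₃' : f₀₁₃' ∈ B _ _) (h₁₂₃ : f₁₂₃ ∈ B _ _) (h₁₂₃' : f₁₂₃' ∈ B _ _)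
    (h₁₃₄ : f₁₃₄ ∈ B _ _) (h₁₃₄' : f₁₃₄' ∈ B _ _)
    (hne : (⟨e₁₃, f₀₁₃, f₁₂₃, f₁₃₄⟩ : Σ e : C.Obj, C.Hom1 e₀₃ (e ⊗₀ e₀₁) ×
      C.Hom1 e (e₂₃ ⊗₀ e₁₂) × C.Hom1 e₁₄ (e₃₄ ⊗₀ e)) ≠ ⟨e₁₃', f₀₁₃', f₁₂₃', f₁₃₄'⟩)
    (α : StateSpace f₁₂₃ f₁₂₄ f₁₃₄ f₂₃₄) (γ : StateSpace f₀₁₃ f₀₁₄ f₀₃₄ f₁₃₄)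
    (ε : StateSpace f₀₁₂ f₀₁₃ f₀₂₃ f₁₂₃) (α' : DualStateSpace f₁₂₃' f₁₂₄ f₁₃₄' f₂₃₄)
    (γ' : DualStateSpace f₀₁₃' f₀₁₄ f₀₃₄ f₁₃₄') (ε' : DualStateSpace f₀₁₂ f₀₁₃' f₀₂₃ f₁₂₃') :
    pairing _ _ (epsGammaAlpha f₀₁₂ f₀₁₃ f₀₁₄ f₀₂₃ f₀₃₄ f₁₂₃ f₁₂₄ f₁₃₄ f₂₃₄ (α ⊗ₜ (γ ⊗ₜ ε)))
      (alphaGammaEps f₀₁₂ f₀₁₃' f₀₁₄ f₀₂₃ f₀₃₄ f₁₂₃' f₁₂₄ f₁₃₄' f₂₃₄ (α' ⊗ₜ (γ' ⊗ₜ ε'))) = 0 := by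
  rw [pairing_epsGammaAlpha_eq_tr]
  have key : Hom2.vcompₗ _ _ _ α α' = 0 ∨ Hom2.vcompₗ _ _ _ ε' ε = 0 := by
    by_cases hee : e₁₃ = e₁₃'
    · subst hee
      by_cases h1 : f₁₂₃ = f₁₂₃'
      · subst h1
        by_cases h2 : f₁₃₄ = f₁₃₄'
        · subst h2
          refine Or.inr (hE.eq_zero_of_comp_ne he (hB _ _) h₁₂₃ (hB _ _) h₀₁₃' h₀₁₃ ?_
            (one_tensor _).symm (rightMor_eq_whisk _ _) (rightMor_eq_whisk _ _) _)
          rintro rfl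
          exact hne rfl
        · exact Or.inl (hE.eq_zero_of_comp_ne he (hB _ _) h₁₂₃ (hB _ _) h₁₃₄ h₁₃₄' h2
            (by rw [tensor_one]) (leftMor_eq_whisk _ _) (leftMor_eq_whisk _ _) _)
      · exact Or.inl (eq_zero_of_id_comp_dual (hE.id_comp_dual_of_ne he (hB _ _) h₁₂₃ h₁₂₃' h1)
          f₁₃₄ f₁₃₄' (by rw [tensor_one]) (by rw [tensor_one]) (leftMor_eq_whisk _ _)
          (leftMor_eq_whisk _ _) _)
    · exact Or.inl (eq_zero_of_id_comp_dual (hE.id_comp_dual_of_ne_obj he he' hee f₁₂₃ f₁₂₃')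
        f₁₃₄ f₁₃₄' (by rw [tensor_one]) (by rw [tensor_one]) (leftMor_eq_whisk _ _)
        (leftMor_eq_whisk _ _) _)
  rcases key with h | h <;> rw [h] <;> simp only [map_zero, LinearMap.zero_apply]

/-- Both `αα'` and `ε'ε` are scalars, being 2-endomorphisms of simple composites, so the trace
reduces to that of `γγ'` whiskered by `f₁₂₃`. Each of the three traces contributes one factor `dimq
f₁₂₃ / dim(e₁₃)`; comparing the two sides leaves exactly the stated weight. -/
theorem pairing_epsGammaAlpha_alphaGammaEps (he : e₁₃ ∈ E)
    (h₀₁₃ : f₀₁₃ ∈ B _ _) (h₁₂₃ : f₁₂₃ ∈ B _ _) (h₁₃₄ : f₁₃₄ ∈ B _ _)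
    (α : StateSpace f₁₂₃ f₁₂₄ f₁₃₄ f₂₃₄) (γ : StateSpace f₀₁₃ f₀₁₄ f₀₃₄ f₁₃₄)
    (ε : StateSpace f₀₁₂ f₀₁₃ f₀₂₃ f₁₂₃) (α' : DualStateSpace f₁₂₃ f₁₂₄ f₁₃₄ f₂₃₄)
    (γ' : DualStateSpace f₀₁₃ f₀₁₄ f₀₃₄ f₁₃₄) (ε' : DualStateSpace f₀₁₂ f₀₁₃ f₀₂₃ f₁₂₃) :
    (C.dimqObj e₁₃)⁻¹ * dimq f₀₁₃ * dimq f₁₂₃ * dimq f₁₃₄ *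
      pairing _ _ (epsGammaAlpha f₀₁₂ f₀₁₃ f₀₁₄ f₀₂₃ f₀₃₄ f₁₂₃ f₁₂₄ f₁₃₄ f₂₃₄ (α ⊗ₜ (γ ⊗ₜ ε)))
      (alphaGammaEps f₀₁₂ f₀₁₃ f₀₁₄ f₀₂₃ f₀₃₄ f₁₂₃ f₁₂₄ f₁₃₄ f₂₃₄ (α' ⊗ₜ (γ' ⊗ₜ ε'))) =
      pairing _ _ α α' * (pairing _ _ γ γ' * pairing _ _ ε ε') := by
  obtain ⟨c, hc⟩ := hE.exists_scalar_of_comp he (hB _ _) h₁₂₃ (hB _ _) h₁₃₄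
    (by rw [tensor_one]) (leftMor_eq_whisk _ _) (Hom2.vcompₗ _ _ _ α α')
  obtain ⟨c', hc'⟩ := hE.exists_scalar_of_comp he (hB _ _) h₁₂₃ (hB _ _) h₀₁₃
    (one_tensor _).symm (rightMor_eq_whisk _ _) (Hom2.vcompₗ _ _ _ ε' ε)
  have h1 := hE.tr_whiskering he f₁₂₃ (u := leftMor f₀₁₃ f₀₃₄) (L := e₃₄) (R := e₀₁) rfl
    (w := midMor₁ f₀₁₃ f₀₃₄ f₁₂₃) rfl (Hom2.vcompₗ _ _ _ γ γ')
    (Hom2.vcompₗ _ _ _ (glueγ f₀₁₃ f₀₁₄ f₀₃₄ f₁₂₃ f₁₃₄ γ) (glueγ' f₀₁₃ f₀₁₄ f₀₃₄ f₁₂₃ f₁₃₄ γ'))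
    (by
      change (γ.1 ⊙ₕ 𝟙₂ (e₃₄ ⊲₁ (f₁₂₃.1 ⊳₁ e₀₁))) ⊙ᵥ (γ'.1 ⊙ₕ 𝟙₂ (e₃₄ ⊲₁ (f₁₂₃.1 ⊳₁ e₀₁))) =
        (γ.1 ⊙ᵥ γ'.1) ⊙ₕ 𝟙₂ (e₃₄ ⊲₁ (f₁₂₃.1 ⊳₁ e₀₁))
      simp)
  have h2 := hE.dimq_comp he f₁₂₃ (u := f₁₃₄) (L := e₃₄) (R := C.one) (by rw [tensor_one])
    (leftMor_eq_whisk f₁₂₃ f₁₃₄)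
  have h3 := hE.dimq_comp he f₁₂₃ (u := f₀₁₃) (L := C.one) (R := e₀₁) (one_tensor _).symm
    (rightMor_eq_whisk f₀₁₃ f₁₂₃)
  rw [pairing_epsGammaAlpha_eq_tr, pairing_comm ε, pairing_eq_tr α, pairing_eq_tr ε', hc, hc',
    tr_smul_id, tr_smul_id, h2, h3, pairing_eq_tr]
  simp only [map_smul, LinearMap.smul_apply, whiskerTr_id, whiskerTl_id, Hom2.id_vcompₗ,
    Hom2.vcompₗ_id, h1, smul_eq_mul]
  ring

/-- Resolving the identities of `P` and `Q` through simple labels writes `Φ` as a sum of products of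
some `ε`, a middle 2-morphism `M`, and some `α`. The middle one vanishes unless the labels `(X, p)`
on both sides agree, and is then a whiskering of some `γ`. -/
theorem eq_top_of_epsGammaAlpha_mem
    (N : Submodule F (Hom2 (leftMor₄ f₀₁₂ f₀₂₃ f₀₃₄) (rightMor₄ f₀₁₄ f₁₂₄ f₂₃₄)))
    (hN : ∀ e₁₃ ∈ E, ∀ f₀₁₃ ∈ B e₀₃ (e₁₃ ⊗₀ e₀₁), ∀ f₁₂₃ ∈ B e₁₃ (e₂₃ ⊗₀ e₁₂),
      ∀ f₁₃₄ ∈ B e₁₄ (e₃₄ ⊗₀ e₁₃), ∀ w,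
        epsGammaAlpha f₀₁₂ f₀₁₃ f₀₁₄ f₀₂₃ f₀₃₄ f₁₂₃ f₁₂₄ f₁₃₄ f₂₃₄ w ∈ N) : N = ⊤ := by
  refine eq_top_iff.2 fun Φ _ => ?_
  let P := leftMor f₀₁₂ f₀₂₃
  let Q := rightMor f₁₂₄ f₂₃₄
  have hP := hE.generatedBy_whisk hB (L := C.one) (R := e₀₁) (D := e₂₃ ⊗₀ e₁₂) (· ⊗₀ e₀₁)
    (fun _ => (one_tensor _).symm) P (by rw [one_tensor, tensor_assoc])
  have hQ := hE.generatedBy_whisk hB (L := e₃₄) (R := C.one) (D := e₂₃ ⊗₀ e₁₂) (e₃₄ ⊗₀ ·)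
    (fun _ => by rw [tensor_one]) Q (by rw [tensor_one])
  -- `Φ` with 2-endomorphisms of `P` and `Q` inserted at its two ends, so that the two resolutions
  -- can be treated one after the other.
  let Θ : (P ⟶ P) →ₗ[F] (Q ⟶ Q) →ₗ[F] Hom2 (leftMor₄ f₀₁₂ f₀₂₃ f₀₃₄) (rightMor₄ f₀₁₄ f₁₂₄ f₂₃₄) :=
    (Hom2.vcompₗ _ _ _).compl₁₂
      (whiskerTl f₀₃₄ (g := P) (g' := P) leftMor₄_eq_tl leftMor₄_eq_tl)
      (Hom2.vcompₗ _ _ _ Φ ∘ₗ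
        whiskerTr f₀₁₄ (g := Q) (g' := Q) rightMor₄_eq_tr rightMor₄_eq_tr)
  have h1 : Θ (𝟙 P) (𝟙 Q) = Φ := by
    change Hom2.vcompₗ _ _ _ (whiskerTl _ _ _ (Hom2.id P)) (Hom2.vcompₗ _ _ _ Φ
      (whiskerTr _ _ _ (Hom2.id Q))) = Φ
    rw [whiskerTl_id, whiskerTr_id, Hom2.id_vcompₗ, Hom2.vcompₗ_id]
  have h2 : ∀ {X X' : C.Obj}, X ∈ E → X' ∈ E → ∀ u ∈ B e₀₃ (X ⊗₀ e₀₁), ∀ p ∈ B X (e₂₃ ⊗₀ e₁₂),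
      ∀ u' ∈ B e₁₄ (e₃₄ ⊗₀ X'), ∀ p' ∈ B X' (e₂₃ ⊗₀ e₁₂), ∀ (a : Hom2 P (rightMor u p))
      (M : Hom2 (midMor₁ u f₀₃₄ p) (midMor₂ f₀₁₄ p' u')) (b : Hom2 (leftMor p' u') Q),
      Hom2.vcompₗ _ _ _ (whiskerTl f₀₃₄ leftMor₄_eq_tl midMor₁_eq_tl a) (Hom2.vcompₗ _ _ _ M
        (whiskerTr f₀₁₄ midMor₂_eq_tr rightMor₄_eq_tr b)) ∈ N := by
    intro X X' hX hX' u hu p hp u' hu' p' hp' a M b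
    by_cases hXX : X = X'
    · subst hXX
      by_cases hpp : p = p'
      · subst hpp
        obtain ⟨γ, hγ⟩ := hE.exists_whiskering hX (hB _ _) hp (leftMor u f₀₃₄) (rightMor f₀₁₄ u')
          (L := e₃₄) (R := e₀₁) rfl rfl rfl M
        have hM : M = glueγ u f₀₁₄ f₀₃₄ p u' γ := Subtype.ext hγ
        rw [hM, ← Hom2.vcompₗ_assoc]
        exact hN X hX u hu p hp u' hu' (b ⊗ₜ (γ ⊗ₜ a))
      · rw [eq_zero_of_id_comp_dual (hE.id_comp_dual_of_ne hX (hB _ _) hp hp' hpp)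
          (leftMor u f₀₃₄) (rightMor f₀₁₄ u') (L := e₃₄) (R := e₀₁) rfl rfl rfl rfl M]
        simp only [map_zero, LinearMap.zero_apply, Submodule.zero_mem]
    · rw [eq_zero_of_id_comp_dual (hE.id_comp_dual_of_ne_obj hX hX' hXX p p')
          (leftMor u f₀₃₄) (rightMor f₀₁₄ u') (L := e₃₄) (R := e₀₁) rfl rfl rfl rfl M]
      simp only [map_zero, LinearMap.zero_apply, Submodule.zero_mem]
  rw [← h1]
  refine (Submodule.span_le (p := N.comap (Θ.flip (𝟙 Q)))).2 ?_ hP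
  rintro _ ⟨w, ⟨X, hX, p, hp, u, hu, hw⟩, a, a', rfl⟩
  obtain rfl : w = rightMor u p := Subtype.ext (hw.trans (rightMor_eq_whisk u p).symm)
  refine (Submodule.span_le (p := N.comap (Θ (a ≫ a')))).2 ?_ hQ
  rintro _ ⟨w, ⟨X', hX', p', hp', u', hu', hw'⟩, b, b', rfl⟩
  obtain rfl : w = leftMor p' u' := Subtype.ext (hw'.trans (leftMor_eq_whisk p' u').symm)
  -- The outer factors `a` and `b'` are kept as `ε` and `α`; everything between them, including `Φ`,
  -- is taken as the middle 2-morphism.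
  have h3 := h2 hX hX' u hu p hp u' hu' p' hp' a
    (Hom2.vcompₗ _ _ _ (whiskerTl f₀₃₄ midMor₁_eq_tl leftMor₄_eq_tl (g' := P) a')
      (Hom2.vcompₗ _ _ _ Φ (whiskerTr f₀₁₄ rightMor₄_eq_tr midMor₂_eq_tr (g := Q) b))) b'
  simp only [Hom2.vcompₗ_assoc] at h3
  rw [whiskerTr_vcompₗ, ← Hom2.vcompₗ_assoc, whiskerTl_vcompₗ] at h3
  exact h3

end Orthogonality

end TwoCatData

/-! ### Orthogonal decompositions of paired vector spaces -/

section DualFamilies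

variable {F : Type*} [Field F] {ι : Type*} {V V' : Type*} [AddCommGroup V] [Module F V]
  [AddCommGroup V'] [Module F V']

theorem sum_linearMap_comp {W : Type*} [AddCommGroup W] [Module F W] (s : Finset ι)
    (φ : ι → V →ₗ[F] V') (ψ : W →ₗ[F] V) : (∑ l ∈ s, φ l) ∘ₗ ψ = ∑ l ∈ s, φ l ∘ₗ ψ :=
  LinearMap.ext fun w => by simp [LinearMap.sum_apply]

theorem linearMap_comp_sum {W : Type*} [AddCommGroup W] [Module F W] (s : Finset ι)
    (φ : ι → W →ₗ[F] V) (ψ : V →ₗ[F] V') : ψ ∘ₗ (∑ l ∈ s, φ l) = ∑ l ∈ s, ψ ∘ₗ φ l :=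
  LinearMap.ext fun w => by simp [LinearMap.sum_apply]

/-- The component in `W` of vectors of `V`, with respect to `m' : W' → V'`, where `V` is paired
with `V'` and `W` with `W'`. -/
def dualComponent {W W' : Type*} [AddCommGroup W] [Module F W] [AddCommGroup W'] [Module F W']
    (p : V →ₗ[F] V' →ₗ[F] F) (q : W ≃ₗ[F] Module.Dual F W') (m' : W' →ₗ[F] V') : V →ₗ[F] W :=
  q.symm.toLinearMap ∘ₗ m'.dualMap ∘ₗ p

variable {W W' : ι → Type*} [∀ l, AddCommGroup (W l)] [∀ l, Module F (W l)]
  [∀ l, AddCommGroup (W' l)] [∀ l, Module F (W' l)] {p : V →ₗ[F] V' →ₗ[F] F}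
  {q : ∀ l, W l ≃ₗ[F] Module.Dual F (W' l)} {m : ∀ l, W l →ₗ[F] V} {m' : ∀ l, W' l →ₗ[F] V'}

/-- `dualComponent` is the adjoint of `m'`, so `h` says that `m` is isometric up to the factor `c`;
invertibility of `q` allows the check to be made on pairings. -/
theorem smul_dualComponent_comp {c : F} {l : ι} (h : ∀ w w', c * p (m l w) (m' l w') = q l w w') :
    c • dualComponent p (q l) (m' l) ∘ₗ m l = LinearMap.id := by
  refine LinearMap.ext fun w => (q l).injective (LinearMap.ext fun w' => ?_)
  simpa [dualComponent] using h w w'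

theorem dualComponent_comp_of_ne {l l' : ι} (h : ∀ w w', p (m l w) (m' l' w') = 0) :
    dualComponent p (q l') (m' l') ∘ₗ m l = 0 := by
  refine LinearMap.ext fun w => (q l').injective (LinearMap.ext fun w' => ?_)
  simpa [dualComponent] using h w w'

/-- Both sides are linear and agree on the image of each `m l`: the term `l` reproduces the vector
and the other terms vanish by orthogonality. These images span. -/
theorem sum_comp_dualComponent {c : ι → F} {s : Finset ι}
    (h : ∀ l ∈ s, ∀ w w', c l * p (m l w) (m' l w') = q l w w')
    (h0 : ∀ l ∈ s, ∀ l' ∈ s, l ≠ l' → ∀ w w', p (m l w) (m' l' w') = 0)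
    (hs : ∀ N : Submodule F V, (∀ l ∈ s, ∀ w, m l w ∈ N) → N = ⊤) :
    ∑ l ∈ s, c l • m l ∘ₗ dualComponent p (q l) (m' l) = LinearMap.id := by
  refine LinearMap.eqLocus_eq_top.1 (hs _ fun l hl w => ?_)
  change (∑ l ∈ s, c l • m l ∘ₗ dualComponent p (q l) (m' l)) (m l w) = m l w
  rw [LinearMap.sum_apply, Finset.sum_eq_single l]
  · have h1 := LinearMap.congr_fun (smul_dualComponent_comp (h l hl)) w
    simp only [LinearMap.smul_apply, LinearMap.comp_apply, LinearMap.id_apply] at h1 ⊢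
    rw [← map_smul, h1]
  · intro l' hl' hne
    have h1 := LinearMap.congr_fun (dualComponent_comp_of_ne (q := q) (h0 l hl l' hl' hne.symm)) w
    simp only [LinearMap.smul_apply, LinearMap.comp_apply, LinearMap.zero_apply] at h1 ⊢
    rw [h1, map_zero, smul_zero]
  · exact fun h => absurd hl h

end DualFamilies

/-! ### Partition functions as gluing followed by taking components -/

namespace TwoCatData

section PartitionFunctions

variable {F : Type u} [Field F] {C : TwoCatData.{u, v₀, v₁, v₂} F} [IsSpherical C]
  [IsVectLinear C]

theorem pairing_flip {A B : C.Obj} (f g : C.Hom1 A B) : (pairing g f).flip = pairing f g :=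
  LinearMap.ext₂ fun α β => pairing_comm β α

variable [IsNondegenerate C] {e₀₁ e₀₂ e₀₃ e₀₄ e₁₂ e₁₃ e₁₄ e₂₃ e₂₄ e₃₄ : C.Obj}
  (f₀₁₂ : C.Hom1 e₀₂ (e₁₂ ⊗₀ e₀₁)) (f₀₁₃ : C.Hom1 e₀₃ (e₁₃ ⊗₀ e₀₁))
  (f₀₁₄ : C.Hom1 e₀₄ (e₁₄ ⊗₀ e₀₁)) (f₀₂₃ : C.Hom1 e₀₃ (e₂₃ ⊗₀ e₀₂))
  (f₀₂₄ : C.Hom1 e₀₄ (e₂₄ ⊗₀ e₀₂)) (f₀₃₄ : C.Hom1 e₀₄ (e₃₄ ⊗₀ e₀₃))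
  (f₁₂₃ : C.Hom1 e₁₃ (e₂₃ ⊗₀ e₁₂)) (f₁₂₄ : C.Hom1 e₁₄ (e₂₄ ⊗₀ e₁₂))
  (f₁₃₄ : C.Hom1 e₁₄ (e₃₄ ⊗₀ e₁₃)) (f₂₃₄ : C.Hom1 e₂₄ (e₃₄ ⊗₀ e₂₃))

/-- The component in `2H(1234) ⊗ 2H(0134) ⊗ 2H(0123)`. -/
noncomputable def componentPlus :
    Hom2 (leftMor₄ f₀₁₂ f₀₂₃ f₀₃₄) (rightMor₄ f₀₁₄ f₁₂₄ f₂₃₄) →ₗ[F]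
    StateSpace f₁₂₃ f₁₂₄ f₁₃₄ f₂₃₄ ⊗[F]
      (StateSpace f₀₁₃ f₀₁₄ f₀₃₄ f₁₃₄ ⊗[F] StateSpace f₀₁₂ f₀₁₃ f₀₂₃ f₁₂₃) :=
  dualComponent (pairing _ _)
    (TensorProduct.congr (pairingEquiv _ _)
        (TensorProduct.congr (pairingEquiv _ _) (pairingEquiv _ _) ≪≫ₗ
          TensorProduct.dualDistribEquiv F _ _) ≪≫ₗ
      TensorProduct.dualDistribEquiv F _ _)
    (alphaGammaEps f₀₁₂ f₀₁₃ f₀₁₄ f₀₂₃ f₀₃₄ f₁₂₃ f₁₂₄ f₁₃₄ f₂₃₄)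

/-- The component in `2H(0234) ⊗ 2H(0124)`. -/
noncomputable def componentMinus :
    Hom2 (leftMor₄ f₀₁₂ f₀₂₃ f₀₃₄) (rightMor₄ f₀₁₄ f₁₂₄ f₂₃₄) →ₗ[F]
    StateSpace f₀₂₃ f₀₂₄ f₀₃₄ f₂₃₄ ⊗[F] StateSpace f₀₁₂ f₀₁₄ f₀₂₄ f₁₂₄ :=
  dualComponent (pairing _ _)
    (TensorProduct.congr (pairingEquiv _ _) (pairingEquiv _ _) ≪≫ₗ
      TensorProduct.dualDistribEquiv F _ _)
    (deltaBeta f₀₁₂ f₀₁₄ f₀₂₃ f₀₂₄ f₀₃₄ f₁₂₄ f₂₃₄)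

theorem Zplus_eq : Zplus f₀₁₂ f₀₁₃ f₀₁₄ f₀₂₃ f₀₂₄ f₀₃₄ f₁₂₃ f₁₂₄ f₁₃₄ f₂₃₄ =
    componentPlus f₀₁₂ f₀₁₃ f₀₁₄ f₀₂₃ f₀₃₄ f₁₂₃ f₁₂₄ f₁₃₄ f₂₃₄ ∘ₗ
      betaDelta f₀₁₂ f₀₁₄ f₀₂₃ f₀₂₄ f₀₃₄ f₁₂₄ f₂₃₄ := rfl

/-- `Zminus` pairs in the opposite order, with `δ'β'` first; symmetry of the pairing, that is
cyclicity of the trace, puts both partition functions on the same paired spaces. -/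
theorem Zminus_eq : Zminus f₀₁₂ f₀₁₃ f₀₁₄ f₀₂₃ f₀₂₄ f₀₃₄ f₁₂₃ f₁₂₄ f₁₃₄ f₂₃₄ =
    componentMinus f₀₁₂ f₀₁₄ f₀₂₃ f₀₂₄ f₀₃₄ f₁₂₄ f₂₃₄ ∘ₗ
      epsGammaAlpha f₀₁₂ f₀₁₃ f₀₁₄ f₀₂₃ f₀₃₄ f₁₂₃ f₁₂₄ f₁₃₄ f₂₃₄ := by
  rw [Zminus, pairing_flip]
  rfl

variable {f₀₁₂ f₀₁₃ f₀₁₄ f₀₂₃ f₀₂₄ f₀₃₄ f₁₂₃ f₁₂₄ f₁₃₄ f₂₃₄}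

theorem dimq_smul_pairing_betaDelta {S : Finset (C.Hom1 e₀₄ (e₂₄ ⊗₀ e₀₂))}
    (hS : IsMorphismBasis S) (hf : f₀₂₄ ∈ S)
    (w : StateSpace f₀₂₃ f₀₂₄ f₀₃₄ f₂₃₄ ⊗[F] StateSpace f₀₁₂ f₀₁₄ f₀₂₄ f₁₂₄)
    (w' : DualStateSpace f₀₂₃ f₀₂₄ f₀₃₄ f₂₃₄ ⊗[F] DualStateSpace f₀₁₂ f₀₁₄ f₀₂₄ f₁₂₄) :
    dimq f₀₂₄ * pairing _ _ (betaDelta f₀₁₂ f₀₁₄ f₀₂₃ f₀₂₄ f₀₃₄ f₁₂₄ f₂₃₄ w)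
      (deltaBeta f₀₁₂ f₀₁₄ f₀₂₃ f₀₂₄ f₀₃₄ f₁₂₄ f₂₃₄ w') =
    (TensorProduct.congr (pairingEquiv _ _) (pairingEquiv _ _) ≪≫ₗ
      TensorProduct.dualDistribEquiv F _ _) w w' := by
  have h : dimq f₀₂₄ • (pairing _ _).compl₁₂ (betaDelta f₀₁₂ f₀₁₄ f₀₂₃ f₀₂₄ f₀₃₄ f₁₂₄ f₂₃₄)
      (deltaBeta f₀₁₂ f₀₁₄ f₀₂₃ f₀₂₄ f₀₃₄ f₁₂₄ f₂₃₄) =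
      ((TensorProduct.congr (pairingEquiv _ _) (pairingEquiv _ _) ≪≫ₗ
        TensorProduct.dualDistribEquiv F _ _).toLinearMap) := by
    refine TensorProduct.ext' fun β δ => TensorProduct.ext' fun β' δ' => ?_
    exact (pairing_betaDelta_deltaBeta hS hf β δ β' δ').trans
      (TensorProduct.dualDistrib_apply _ _ _ _).symm
  exact LinearMap.congr_fun₂ h w w'

theorem pairing_betaDelta_eq_zero {f₀₂₄' : C.Hom1 e₀₄ (e₂₄ ⊗₀ e₀₂)}
    {S : Finset (C.Hom1 e₀₄ (e₂₄ ⊗₀ e₀₂))}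
    (hS : IsMorphismBasis S) (hf : f₀₂₄ ∈ S) (hf' : f₀₂₄' ∈ S) (hne : f₀₂₄ ≠ f₀₂₄')
    (w : StateSpace f₀₂₃ f₀₂₄ f₀₃₄ f₂₃₄ ⊗[F] StateSpace f₀₁₂ f₀₁₄ f₀₂₄ f₁₂₄)
    (w' : DualStateSpace f₀₂₃ f₀₂₄' f₀₃₄ f₂₃₄ ⊗[F] DualStateSpace f₀₁₂ f₀₁₄ f₀₂₄' f₁₂₄) :
    pairing _ _ (betaDelta f₀₁₂ f₀₁₄ f₀₂₃ f₀₂₄ f₀₃₄ f₁₂₄ f₂₃₄ w)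
      (deltaBeta f₀₁₂ f₀₁₄ f₀₂₃ f₀₂₄' f₀₃₄ f₁₂₄ f₂₃₄ w') = 0 := by
  have h : (pairing _ _).compl₁₂ (betaDelta f₀₁₂ f₀₁₄ f₀₂₃ f₀₂₄ f₀₃₄ f₁₂₄ f₂₃₄)
      (deltaBeta f₀₁₂ f₀₁₄ f₀₂₃ f₀₂₄' f₀₃₄ f₁₂₄ f₂₃₄) = 0 :=
    TensorProduct.ext' fun β δ => TensorProduct.ext' fun β' δ' =>
      pairing_betaDelta_deltaBeta_of_ne hS hf hf' hne β δ β' δ'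
  exact LinearMap.congr_fun₂ h w w'

theorem smul_componentMinus_betaDelta {S : Finset (C.Hom1 e₀₄ (e₂₄ ⊗₀ e₀₂))}
    (hS : IsMorphismBasis S) (hf : f₀₂₄ ∈ S) :
    dimq f₀₂₄ • componentMinus f₀₁₂ f₀₁₄ f₀₂₃ f₀₂₄ f₀₃₄ f₁₂₄ f₂₃₄ ∘ₗ
      betaDelta f₀₁₂ f₀₁₄ f₀₂₃ f₀₂₄ f₀₃₄ f₁₂₄ f₂₃₄ = LinearMap.id :=
  -- A single block is treated as a family with one index.
  smul_dualComponent_comp (ι := Unit) (l := ()) (m := fun _ => betaDelta _ _ _ _ _ _ _)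
    (m' := fun _ => deltaBeta _ _ _ _ _ _ _) (q := fun _ => _)
    (dimq_smul_pairing_betaDelta hS hf)

theorem sum_betaDelta_componentMinus {S : Finset (C.Hom1 e₀₄ (e₂₄ ⊗₀ e₀₂))}
    (hS : IsMorphismBasis S) :
    ∑ f₀₂₄ ∈ S, dimq f₀₂₄ • betaDelta f₀₁₂ f₀₁₄ f₀₂₃ f₀₂₄ f₀₃₄ f₁₂₄ f₂₃₄ ∘ₗ
      componentMinus f₀₁₂ f₀₁₄ f₀₂₃ f₀₂₄ f₀₃₄ f₁₂₄ f₂₃₄ = LinearMap.id :=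
  sum_comp_dualComponent (m := fun f₀₂₄ => betaDelta f₀₁₂ f₀₁₄ f₀₂₃ f₀₂₄ f₀₃₄ f₁₂₄ f₂₃₄)
    (m' := fun f₀₂₄ => deltaBeta f₀₁₂ f₀₁₄ f₀₂₃ f₀₂₄ f₀₃₄ f₁₂₄ f₂₃₄) (q := fun _ => _)
    (fun _ hf => dimq_smul_pairing_betaDelta hS hf)
    (fun _ hf _ hf' hne => pairing_betaDelta_eq_zero hS hf hf' hne)
    (eq_top_of_betaDelta_mem hS)

variable {E : Finset C.Obj} (hE : C.IsObjectBasis E)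
  {B : ∀ A A' : C.Obj, Finset (C.Hom1 A A')}
  (hB : ∀ A A' : C.Obj, IsMorphismBasis (B A A'))

include hE hB

theorem smul_pairing_epsGammaAlpha (he : e₁₃ ∈ E)
    (h₀₁₃ : f₀₁₃ ∈ B _ _) (h₁₂₃ : f₁₂₃ ∈ B _ _) (h₁₃₄ : f₁₃₄ ∈ B _ _)
    (w : StateSpace f₁₂₃ f₁₂₄ f₁₃₄ f₂₃₄ ⊗[F]
      (StateSpace f₀₁₃ f₀₁₄ f₀₃₄ f₁₃₄ ⊗[F] StateSpace f₀₁₂ f₀₁₃ f₀₂₃ f₁₂₃))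
    (w' : DualStateSpace f₁₂₃ f₁₂₄ f₁₃₄ f₂₃₄ ⊗[F]
      (DualStateSpace f₀₁₃ f₀₁₄ f₀₃₄ f₁₃₄ ⊗[F] DualStateSpace f₀₁₂ f₀₁₃ f₀₂₃ f₁₂₃)) :
    (C.dimqObj e₁₃)⁻¹ * dimq f₀₁₃ * dimq f₁₂₃ * dimq f₁₃₄ *
      pairing _ _ (epsGammaAlpha f₀₁₂ f₀₁₃ f₀₁₄ f₀₂₃ f₀₃₄ f₁₂₃ f₁₂₄ f₁₃₄ f₂₃₄ w)
      (alphaGammaEps f₀₁₂ f₀₁₃ f₀₁₄ f₀₂₃ f₀₃₄ f₁₂₃ f₁₂₄ f₁₃₄ f₂₃₄ w') =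
    (TensorProduct.congr (pairingEquiv _ _)
        (TensorProduct.congr (pairingEquiv _ _) (pairingEquiv _ _) ≪≫ₗ
          TensorProduct.dualDistribEquiv F _ _) ≪≫ₗ
      TensorProduct.dualDistribEquiv F _ _) w w' := by
  have h : ((C.dimqObj e₁₃)⁻¹ * dimq f₀₁₃ * dimq f₁₂₃ * dimq f₁₃₄) • (pairing _ _).compl₁₂
      (epsGammaAlpha f₀₁₂ f₀₁₃ f₀₁₄ f₀₂₃ f₀₃₄ f₁₂₃ f₁₂₄ f₁₃₄ f₂₃₄)
      (alphaGammaEps f₀₁₂ f₀₁₃ f₀₁₄ f₀₂₃ f₀₃₄ f₁₂₃ f₁₂₄ f₁₃₄ f₂₃₄) =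
      (TensorProduct.congr (pairingEquiv _ _)
        (TensorProduct.congr (pairingEquiv _ _) (pairingEquiv _ _) ≪≫ₗ
          TensorProduct.dualDistribEquiv F _ _) ≪≫ₗ
      TensorProduct.dualDistribEquiv F _ _).toLinearMap := by
    refine TensorProduct.ext_threefold' fun α γ ε =>
      TensorProduct.ext_threefold' fun α' γ' ε' => ?_
    refine (pairing_epsGammaAlpha_alphaGammaEps hE hB he h₀₁₃ h₁₂₃ h₁₃₄ α γ ε α' γ' ε').trans ?_
    refine Eq.trans ?_ (TensorProduct.dualDistrib_apply _ _ _ _).symm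
    exact congrArg _ (TensorProduct.dualDistrib_apply _ _ _ _).symm
  exact LinearMap.congr_fun₂ h w w'

theorem pairing_epsGammaAlpha_eq_zero {e₁₃' : C.Obj} {f₀₁₃' : C.Hom1 e₀₃ (e₁₃' ⊗₀ e₀₁)}
    {f₁₂₃' : C.Hom1 e₁₃' (e₂₃ ⊗₀ e₁₂)} {f₁₃₄' : C.Hom1 e₁₄ (e₃₄ ⊗₀ e₁₃')}
    (he : e₁₃ ∈ E) (he' : e₁₃' ∈ E)
    (h₀₁₃ : f₀₁₃ ∈ B _ _) (h₀₁₃' : f₀₁₃' ∈ B _ _) (h₁₂₃ : f₁₂₃ ∈ B _ _) (h₁₂₃' : f₁₂₃' ∈ B _ _)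
    (h₁₃₄ : f₁₃₄ ∈ B _ _) (h₁₃₄' : f₁₃₄' ∈ B _ _)
    (hne : (⟨e₁₃, f₀₁₃, f₁₂₃, f₁₃₄⟩ : Σ e : C.Obj, C.Hom1 e₀₃ (e ⊗₀ e₀₁) ×
      C.Hom1 e (e₂₃ ⊗₀ e₁₂) × C.Hom1 e₁₄ (e₃₄ ⊗₀ e)) ≠ ⟨e₁₃', f₀₁₃', f₁₂₃', f₁₃₄'⟩)
    (w : StateSpace f₁₂₃ f₁₂₄ f₁₃₄ f₂₃₄ ⊗[F]
      (StateSpace f₀₁₃ f₀₁₄ f₀₃₄ f₁₃₄ ⊗[F] StateSpace f₀₁₂ f₀₁₃ f₀₂₃ f₁₂₃))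
    (w' : DualStateSpace f₁₂₃' f₁₂₄ f₁₃₄' f₂₃₄ ⊗[F]
      (DualStateSpace f₀₁₃' f₀₁₄ f₀₃₄ f₁₃₄' ⊗[F] DualStateSpace f₀₁₂ f₀₁₃' f₀₂₃ f₁₂₃')) :
    pairing _ _ (epsGammaAlpha f₀₁₂ f₀₁₃ f₀₁₄ f₀₂₃ f₀₃₄ f₁₂₃ f₁₂₄ f₁₃₄ f₂₃₄ w)
      (alphaGammaEps f₀₁₂ f₀₁₃' f₀₁₄ f₀₂₃ f₀₃₄ f₁₂₃' f₁₂₄ f₁₃₄' f₂₃₄ w') = 0 := by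
  have h : (pairing _ _).compl₁₂ (epsGammaAlpha f₀₁₂ f₀₁₃ f₀₁₄ f₀₂₃ f₀₃₄ f₁₂₃ f₁₂₄ f₁₃₄ f₂₃₄)
      (alphaGammaEps f₀₁₂ f₀₁₃' f₀₁₄ f₀₂₃ f₀₃₄ f₁₂₃' f₁₂₄ f₁₃₄' f₂₃₄) = 0 :=
    TensorProduct.ext_threefold' fun α γ ε => TensorProduct.ext_threefold' fun α' γ' ε' =>
      pairing_epsGammaAlpha_alphaGammaEps_of_ne hE hB he he' h₀₁₃ h₀₁₃' h₁₂₃ h₁₂₃' h₁₃₄ h₁₃₄' hne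
        α γ ε α' γ' ε'
  exact LinearMap.congr_fun₂ h w w'

theorem smul_componentPlus_epsGammaAlpha (he : e₁₃ ∈ E)
    (h₀₁₃ : f₀₁₃ ∈ B _ _) (h₁₂₃ : f₁₂₃ ∈ B _ _) (h₁₃₄ : f₁₃₄ ∈ B _ _) :
    ((C.dimqObj e₁₃)⁻¹ * dimq f₀₁₃ * dimq f₁₂₃ * dimq f₁₃₄) •
      componentPlus f₀₁₂ f₀₁₃ f₀₁₄ f₀₂₃ f₀₃₄ f₁₂₃ f₁₂₄ f₁₃₄ f₂₃₄ ∘ₗ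
      epsGammaAlpha f₀₁₂ f₀₁₃ f₀₁₄ f₀₂₃ f₀₃₄ f₁₂₃ f₁₂₄ f₁₃₄ f₂₃₄ = LinearMap.id :=
  smul_dualComponent_comp (ι := Unit) (l := ()) (m := fun _ => epsGammaAlpha _ _ _ _ _ _ _ _ _)
    (m' := fun _ => alphaGammaEps _ _ _ _ _ _ _ _ _) (q := fun _ => _)
    (smul_pairing_epsGammaAlpha hE hB he h₀₁₃ h₁₂₃ h₁₃₄)

theorem sum_epsGammaAlpha_componentPlus :
    ∑ e₁₃ ∈ E, ∑ f₀₁₃ ∈ B e₀₃ (e₁₃ ⊗₀ e₀₁), ∑ f₁₂₃ ∈ B e₁₃ (e₂₃ ⊗₀ e₁₂),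
      ∑ f₁₃₄ ∈ B e₁₄ (e₃₄ ⊗₀ e₁₃), ((C.dimqObj e₁₃)⁻¹ * dimq f₀₁₃ * dimq f₁₂₃ * dimq f₁₃₄) •
        epsGammaAlpha f₀₁₂ f₀₁₃ f₀₁₄ f₀₂₃ f₀₃₄ f₁₂₃ f₁₂₄ f₁₃₄ f₂₃₄ ∘ₗ
        componentPlus f₀₁₂ f₀₁₃ f₀₁₄ f₀₂₃ f₀₃₄ f₁₂₃ f₁₂₄ f₁₃₄ f₂₃₄ = LinearMap.id := by
  -- The four labels are packed into one index, dependent because the three triangle labels live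
  -- over the choice of `e₁₃`.
  have h := sum_comp_dualComponent (ι := Σ e : C.Obj, C.Hom1 e₀₃ (e ⊗₀ e₀₁) ×
      C.Hom1 e (e₂₃ ⊗₀ e₁₂) × C.Hom1 e₁₄ (e₃₄ ⊗₀ e))
    (s := E.sigma fun e => B e₀₃ (e ⊗₀ e₀₁) ×ˢ B e (e₂₃ ⊗₀ e₁₂) ×ˢ B e₁₄ (e₃₄ ⊗₀ e))
    (c := fun l => (C.dimqObj l.1)⁻¹ * dimq l.2.1 * dimq l.2.2.1 * dimq l.2.2.2)
    (m := fun l => epsGammaAlpha f₀₁₂ l.2.1 f₀₁₄ f₀₂₃ f₀₃₄ l.2.2.1 f₁₂₄ l.2.2.2 f₂₃₄)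
    (m' := fun l => alphaGammaEps f₀₁₂ l.2.1 f₀₁₄ f₀₂₃ f₀₃₄ l.2.2.1 f₁₂₄ l.2.2.2 f₂₃₄)
    (q := fun _ => _) (p := pairing _ _)
    (fun l hl => by
      simp only [Finset.mem_sigma, Finset.mem_product] at hl
      exact smul_pairing_epsGammaAlpha hE hB hl.1 hl.2.1 hl.2.2.1 hl.2.2.2)
    (fun l hl l' hl' hne => by
      simp only [Finset.mem_sigma, Finset.mem_product] at hl hl'
      exact pairing_epsGammaAlpha_eq_zero hE hB hl.1 hl'.1 hl.2.1 hl'.2.1 hl.2.2.1 hl'.2.2.1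
        hl.2.2.2 hl'.2.2.2 hne)
    (fun N hN => eq_top_of_epsGammaAlpha_mem hE hB N fun e he f h f' h' f'' h'' w =>
      hN ⟨e, f, f', f''⟩ (by simp [he, h, h', h'']) w)
  simp only [Finset.sum_sigma, Finset.sum_product] at h
  exact h

end PartitionFunctions

end TwoCatData

theorem lemma5p2 {F : Type u} [Field F] [CharZero F] (C : TwoCatData.{u, v₀, v₁, v₂} F)
    [C.IsSpherical] [C.IsVectLinear] [C.IsNondegenerate]
    (E : Finset C.Obj) (hE : C.IsObjectBasis E)
    (B : ∀ A A' : C.Obj, Finset (C.Hom1 A A'))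
    (hB : ∀ A A' : C.Obj, TwoCatData.IsMorphismBasis (B A A')) :
    (∀ e₀₁ ∈ E, ∀ e₀₂ ∈ E, ∀ e₀₃ ∈ E, ∀ e₀₄ ∈ E, ∀ e₁₂ ∈ E, ∀ e₁₄ ∈ E,
      ∀ e₂₃ ∈ E, ∀ e₂₄ ∈ E, ∀ e₃₄ ∈ E,
      ∀ f₀₁₂ ∈ B e₀₂ (e₁₂ ⊗₀ e₀₁), ∀ f₀₁₄ ∈ B e₀₄ (e₁₄ ⊗₀ e₀₁),
      ∀ f₀₂₃ ∈ B e₀₃ (e₂₃ ⊗₀ e₀₂), ∀ f₀₂₄ ∈ B e₀₄ (e₂₄ ⊗₀ e₀₂),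
      ∀ f₀₃₄ ∈ B e₀₄ (e₃₄ ⊗₀ e₀₃), ∀ f₁₂₄ ∈ B e₁₄ (e₂₄ ⊗₀ e₁₂),
      ∀ f₂₃₄ ∈ B e₂₄ (e₃₄ ⊗₀ e₂₃),
        TwoCatData.dimq f₀₂₄ •
          ∑ e₁₃ ∈ E, ∑ f₀₁₃ ∈ B e₀₃ (e₁₃ ⊗₀ e₀₁), ∑ f₁₂₃ ∈ B e₁₃ (e₂₃ ⊗₀ e₁₂),
            ∑ f₁₃₄ ∈ B e₁₄ (e₃₄ ⊗₀ e₁₃),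
              ((C.dimqObj e₁₃)⁻¹ * TwoCatData.dimq f₀₁₃ * TwoCatData.dimq f₁₂₃ *
                  TwoCatData.dimq f₁₃₄) •
                (TwoCatData.Zminus f₀₁₂ f₀₁₃ f₀₁₄ f₀₂₃ f₀₂₄ f₀₃₄ f₁₂₃ f₁₂₄ f₁₃₄ f₂₃₄ ∘ₗ
                  TwoCatData.Zplus f₀₁₂ f₀₁₃ f₀₁₄ f₀₂₃ f₀₂₄ f₀₃₄ f₁₂₃ f₁₂₄ f₁₃₄ f₂₃₄) =
          (LinearMap.id :
            TwoCatData.StateSpace f₀₂₃ f₀₂₄ f₀₃₄ f₂₃₄ ⊗[F]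
                TwoCatData.StateSpace f₀₁₂ f₀₁₄ f₀₂₄ f₁₂₄ →ₗ[F]
              TwoCatData.StateSpace f₀₂₃ f₀₂₄ f₀₃₄ f₂₃₄ ⊗[F]
                TwoCatData.StateSpace f₀₁₂ f₀₁₄ f₀₂₄ f₁₂₄)) ∧
    (∀ e₀₁ ∈ E, ∀ e₀₂ ∈ E, ∀ e₀₃ ∈ E, ∀ e₀₄ ∈ E, ∀ e₁₂ ∈ E, ∀ e₁₃ ∈ E, ∀ e₁₄ ∈ E,
      ∀ e₂₃ ∈ E, ∀ e₂₄ ∈ E, ∀ e₃₄ ∈ E,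
      ∀ f₀₁₂ ∈ B e₀₂ (e₁₂ ⊗₀ e₀₁), ∀ f₀₁₃ ∈ B e₀₃ (e₁₃ ⊗₀ e₀₁),
      ∀ f₀₁₄ ∈ B e₀₄ (e₁₄ ⊗₀ e₀₁), ∀ f₀₂₃ ∈ B e₀₃ (e₂₃ ⊗₀ e₀₂),
      ∀ f₀₃₄ ∈ B e₀₄ (e₃₄ ⊗₀ e₀₃), ∀ f₁₂₃ ∈ B e₁₃ (e₂₃ ⊗₀ e₁₂),
      ∀ f₁₂₄ ∈ B e₁₄ (e₂₄ ⊗₀ e₁₂), ∀ f₁₃₄ ∈ B e₁₄ (e₃₄ ⊗₀ e₁₃),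
      ∀ f₂₃₄ ∈ B e₂₄ (e₃₄ ⊗₀ e₂₃),
        ((C.dimqObj e₁₃)⁻¹ * TwoCatData.dimq f₀₁₃ * TwoCatData.dimq f₁₂₃ *
            TwoCatData.dimq f₁₃₄) •
          ∑ f₀₂₄ ∈ B e₀₄ (e₂₄ ⊗₀ e₀₂),
            TwoCatData.dimq f₀₂₄ •
              (TwoCatData.Zplus f₀₁₂ f₀₁₃ f₀₁₄ f₀₂₃ f₀₂₄ f₀₃₄ f₁₂₃ f₁₂₄ f₁₃₄ f₂₃₄ ∘ₗ
                TwoCatData.Zminus f₀₁₂ f₀₁₃ f₀₁₄ f₀₂₃ f₀₂₄ f₀₃₄ f₁₂₃ f₁₂₄ f₁₃₄ f₂₃₄) =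
          (LinearMap.id :
            TwoCatData.StateSpace f₁₂₃ f₁₂₄ f₁₃₄ f₂₃₄ ⊗[F]
                (TwoCatData.StateSpace f₀₁₃ f₀₁₄ f₀₃₄ f₁₃₄ ⊗[F]
                  TwoCatData.StateSpace f₀₁₂ f₀₁₃ f₀₂₃ f₁₂₃) →ₗ[F]
              TwoCatData.StateSpace f₁₂₃ f₁₂₄ f₁₃₄ f₂₃₄ ⊗[F]
                (TwoCatData.StateSpace f₀₁₃ f₀₁₄ f₀₃₄ f₁₃₄ ⊗[F]
                  TwoCatData.StateSpace f₀₁₂ f₀₁₃ f₀₂₃ f₁₂₃))) := by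
  constructor
  · intro e₀₁ _ e₀₂ _ e₀₃ _ e₀₄ _ e₁₂ _ e₁₄ _ e₂₃ _ e₂₄ _ e₃₄ _ f₀₁₂ _ f₀₁₄ _ f₀₂₃ _ f₀₂₄ h₀₂₄
      f₀₃₄ _ f₁₂₄ _ f₂₃₄ _
    -- The resolution of the identity by the `εγα` blocks is inserted between `betaDelta` and
    -- `componentMinus`. Each term becomes `Z(+)` followed by `Z(-)`, and the total is the `βδ`
    -- block relation for `f₀₂₄`.
    have h := congrArg (fun φ =>
        TwoCatData.componentMinus f₀₁₂ f₀₁₄ f₀₂₃ f₀₂₄ f₀₃₄ f₁₂₄ f₂₃₄ ∘ₗ φ ∘ₗ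
          TwoCatData.betaDelta f₀₁₂ f₀₁₄ f₀₂₃ f₀₂₄ f₀₃₄ f₁₂₄ f₂₃₄)
      (TwoCatData.sum_epsGammaAlpha_componentPlus hE hB (f₀₁₂ := f₀₁₂) (f₀₁₄ := f₀₁₄)
        (f₀₂₃ := f₀₂₃) (f₀₃₄ := f₀₃₄) (f₁₂₄ := f₁₂₄) (f₂₃₄ := f₂₃₄))
    simp only [LinearMap.id_comp, sum_linearMap_comp, linearMap_comp_sum, LinearMap.smul_comp,
      LinearMap.comp_smul, LinearMap.comp_assoc] at h
    simp only [TwoCatData.Zplus_eq, TwoCatData.Zminus_eq, LinearMap.comp_assoc, h]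
    exact TwoCatData.smul_componentMinus_betaDelta (hB _ _) h₀₂₄
  · intro e₀₁ _ e₀₂ _ e₀₃ _ e₀₄ _ e₁₂ _ e₁₃ h₁₃ e₁₄ _ e₂₃ _ e₂₄ _ e₃₄ _ f₀₁₂ _ f₀₁₃ h₀₁₃ f₀₁₄ _
      f₀₂₃ _ f₀₃₄ _ f₁₂₃ h₁₂₃ f₁₂₄ _ f₁₃₄ h₁₃₄ f₂₃₄ _
    -- The same with the two decompositions exchanged: the sum over `f₀₂₄` resolves the identity
    -- between `epsGammaAlpha` and `componentPlus`.
    have h := congrArg (fun φ =>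
        TwoCatData.componentPlus f₀₁₂ f₀₁₃ f₀₁₄ f₀₂₃ f₀₃₄ f₁₂₃ f₁₂₄ f₁₃₄ f₂₃₄ ∘ₗ φ ∘ₗ
          TwoCatData.epsGammaAlpha f₀₁₂ f₀₁₃ f₀₁₄ f₀₂₃ f₀₃₄ f₁₂₃ f₁₂₄ f₁₃₄ f₂₃₄)
      (TwoCatData.sum_betaDelta_componentMinus (hB e₀₄ (e₂₄ ⊗₀ e₀₂)) (f₀₁₂ := f₀₁₂)
        (f₀₁₄ := f₀₁₄) (f₀₂₃ := f₀₂₃) (f₀₃₄ := f₀₃₄) (f₁₂₄ := f₁₂₄) (f₂₃₄ := f₂₃₄))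
    simp only [LinearMap.id_comp, sum_linearMap_comp, linearMap_comp_sum, LinearMap.smul_comp,
      LinearMap.comp_smul, LinearMap.comp_assoc] at h
    simp only [TwoCatData.Zplus_eq, TwoCatData.Zminus_eq, LinearMap.comp_assoc, h]
    exact TwoCatData.smul_componentPlus_epsGammaAlpha hE hB h₁₃ h₀₁₃ h₁₂₃ h₁₃₄
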